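/- **Lemma.** Consider the $T^4_4$ theory: a pair of complex conjugate rank-four tensor fields $T_{\mathbf n},\bar T_{\mathbf n}$, $\mathbf n\in\mathbb Z^4$, with propagator $C(\mathbf n)=(1+\|\mathbf n\|^2)^{-1}$ and quartic melonic vertices of colours $c\in\{1,2,3,4\}$. A vertex of colour $c$ carries fields $T_1,\bar T_1,T_2,\bar T_2$; $T_b$ shares its three indices of colours $\neq c$ with $\bar T_b$, and its index of colour $c$ with the other field $\bar T$. A vacuum Feynman graph $G$ of order $n(G)$ consists of $n(G)$ coloured vertices together with a bijection from their $T$'s to their $\bar T$'s (the $2n(G)$ lines). Its faces of colour $k$ are the closed cycles followed by the indices of colour $k$, and each face carries one index in $\mathbb Z$. Fix an integer $M>1$. Let $C_1(\mathbf n)=C(\mathbf n)\,\mathbf 1_{1+\|\mathbf n\|^2\le M^2}$ and $C_j(\mathbf n)=C(\mathbf n)\,\mathbf 1_{M^{2(j-1)}<1+\|\mathbf n\|^2\le M^{2j}}$ for $j\ge 2$. A scale attribution $\mu=\{i_\ell\}$ assigns an integer $i_\ell\ge1$ to each line $\ell$ of $G$, and $A_{G,\mu}$ is the sum over all face indices of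 $\prod_\ell C_{i_\ell}(\mathbf n_\ell)$, where $\mathbf n_\ell\in\mathbb Z^4$ consists of the indices of the four faces through $\ell$ (coupling constants and symmetry factors are not included). The divergent graphs are the two-point graph $\mathcal M_1$ (a melonic tadpole, i.e. one vertex with $T_b$ contracted with $\bar T_b$), the two-point graph $\mathcal M_2$ (a melonic tadpole with an $\mathcal M_1$ inserted on its line), and the connected vacuum graphs whose number of faces is at least twice their number of lines (forgetting colours, seven melonic and three non-melonic ones). The renormalised amplitude is $$A^{\mathrm r}_{G,\mu}=\sum_{\mathcal F}\ \prod_{g\in\mathcal F}(-\tau_g)\ A_{G,\mu},$$ where $\mathcal F$ runs over the forests of divergent subgraphs of $G$ (sets, possibly empty, of divergent subgraphs any two of which are nested or have no common vertex; a divergent connected component of $G$ is an allowed member), and $\tau_g$ sets to $0$ the external indices of the amplitude of $g$ (so $\tau_g$ is the identity for a vacuum graph $g$). Then there exists $K>0$, depending only on $M$, such that for every vacuum Feynman graph $G$ the following sum over all scale attributions converges and satisfies $$\sum_\mu \bigl|A^{\mathrm r}_{G,\mu}\bigr|\,\prod_{\ell\in G}M^{\,i_\ell/24}\ \le\ K^{\,n(G)}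 .$$ -/

import Mathlib

namespace TensorT44

/-- A vacuum Feynman graph of the `T⁴₄` theory (a Wick contraction of quartic melonic vertices).
The vertex `v` has a colour `c = colour v` and carries two fields `T_{v,b}` and two fields
`T̄_{v,b}`, with `b` a Boolean. At this vertex `T_{v,b}` shares its three indices of colours `≠ c`
with `T̄_{v,b}`, and its index of colour `c` with `T̄_{v,!b}`.
The field `T_{v,b}` is contracted with the field `T̄` labelled `contraction (v, b)`. -/
structure VacuumGraph where
  /-- the number of vertices -/
  order : ℕ
  /-- the colours of the vertices -/
  colour : Fin order → Fin 4
  /-- the Wick contraction -/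
  contraction : Equiv.Perm (Fin order × Bool)

namespace VacuumGraph

/-- The lines (propagators). A line is named by the field `T` at its origin; it ends at the field
`T̄` labelled by `contraction`. -/
abbrev Line (G : VacuumGraph) : Type := Fin G.order × Bool

/-- The field `T` whose index of colour `k` is identified, inside the vertex, with the index of
colour `k` of the field `T̄` labelled `x`. -/
def vertexStrand (G : VacuumGraph) (k : Fin 4) (x : Fin G.order × Bool) : Fin G.order × Bool :=
  if G.colour x.1 = k then (x.1, !x.2) else x

theorem vertexStrand_involutive (G : VacuumGraph) (k : Fin 4) :
    Function.Involutive (G.vertexStrand k) := by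
  rintro ⟨v, b⟩
  by_cases h : G.colour v = k <;> simp [vertexStrand, h]

/-- The line which follows a given line along its face of colour `k`. -/
def facePerm (G : VacuumGraph) (k : Fin 4) : Equiv.Perm G.Line :=
  G.contraction.trans (G.vertexStrand_involutive k).toPerm

/-- The faces: a face of colour `k` is a cycle (possibly of length one) of `facePerm k`. -/
def Face (G : VacuumGraph) : Type :=
  Σ k : Fin 4, Quotient (Equiv.Perm.SameCycle.setoid (G.facePerm k))

/-- The face of colour `k` which runs through the line `l`. -/
def faceOf (G : VacuumGraph) (l : G.Line) (k : Fin 4) : G.Face :=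
  ⟨k, Quotient.mk _ l⟩

/-- A subgraph is given by its set of lines; these are its vertices. -/
def vertices (G : VacuumGraph) (g : Finset G.Line) : Set (Fin G.order) :=
  {v | ∃ l ∈ g, l.1 = v ∨ (G.contraction l).1 = v}

/-- The face `f` is internal to the subgraph `g`: it runs only through lines of `g`. -/
def IsInternal (G : VacuumGraph) (g : Finset G.Line) (f : G.Face) : Prop :=
  ∀ l : G.Line, G.faceOf l f.1 = f → l ∈ g

/-- The superficial degree of divergence: number of internal faces minus twice the number of
lines. -/
noncomputable def degree (G : VacuumGraph) (g : Finset G.Line) : ℤ :=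
  (Nat.card {f : G.Face // G.IsInternal g f} : ℤ) - 2 * (g.card : ℤ)

/-- The divergent two-point graph `M₁`: a melonic tadpole, with its single line. -/
def IsM1 (G : VacuumGraph) (g : Finset G.Line) : Prop :=
  ∃ l : G.Line, G.contraction l = l ∧ g = {l}

/-- The divergent two-point graph `M₂`: a melonic tadpole `M₁` at `(w, d)` is inserted on the line
of a melonic tadpole at `(v, b)`, thus cutting it into the two lines `(v, b)` and `(w, !d)`. -/
def IsM2 (G : VacuumGraph) (g : Finset G.Line) : Prop :=
  ∃ (v w : Fin G.order) (b d : Bool), v ≠ w ∧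
    G.contraction (w, d) = (w, d) ∧
    G.contraction (v, b) = (w, !d) ∧ G.contraction (w, !d) = (v, b) ∧
    g = {(v, b), (w, !d), (w, d)}

/-- Two vertices are adjacent when a line joins them. -/
def adjacency (G : VacuumGraph) : SimpleGraph (Fin G.order) :=
  SimpleGraph.fromRel fun v w => ∃ b : Bool, (G.contraction (v, b)).1 = w

/-- `g` is a connected vacuum subgraph, that is, the set of all lines of a connected component. -/
def IsComponent (G : VacuumGraph) (g : Finset G.Line) : Prop :=
  ∃ v : Fin G.order, ∀ l : G.Line, l ∈ g ↔ G.adjacency.Reachable v l.1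

/-- The divergent (connected) subgraphs: the two-point graphs `M₁` and `M₂`, and the connected
vacuum graphs of nonnegative superficial degree. -/
def IsDivergent (G : VacuumGraph) (g : Finset G.Line) : Prop :=
  G.IsM1 g ∨ G.IsM2 g ∨ (G.IsComponent g ∧ 0 ≤ G.degree g)

/-- A forest of divergent subgraphs: any two members are nested or disjoint. -/
def IsForest (G : VacuumGraph) (F : Finset (Finset G.Line)) : Prop :=
  (∀ g ∈ F, G.IsDivergent g) ∧
    ∀ g ∈ F, ∀ h ∈ F, g ⊆ h ∨ h ⊆ g ∨ Disjoint (G.vertices g) (G.vertices h)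

/-- The four-tuple of indices carried by the line `l`, for the indices `n` of the faces, after the
operators `τ_g`, `g ∈ F`, have set to `0` the external indices of the amplitudes of the subgraphs
`g ∈ F`. -/
noncomputable def lineIndex (G : VacuumGraph) (F : Finset (Finset G.Line)) (n : G.Face → ℤ)
    (l : G.Line) (k : Fin 4) : ℤ :=
  open Classical in
  if ∃ g ∈ F, l ∈ g ∧ ¬ G.IsInternal g (G.faceOf l k) then 0 else n (G.faceOf l k)

end VacuumGraph

/-- `1 + ‖n‖²`. -/
def symbol (n : Fin 4 → ℤ) : ℤ := 1 + ∑ k, n k ^ 2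

/-- The indices `n` lie in the slice `j ≥ 1` of ratio `M`: `1 + ‖n‖² ≤ M²` if `j = 1`, and
`M^{2(j-1)} < 1 + ‖n‖² ≤ M^{2j}` if `j ≥ 2`. -/
def InSlice (M : ℕ) (j : ℕ+) (n : Fin 4 → ℤ) : Prop :=
  symbol n ≤ (M : ℤ) ^ (2 * (j : ℕ)) ∧ (j ≠ 1 → (M : ℤ) ^ (2 * ((j : ℕ) - 1)) < symbol n)

/-- The diagonal coefficient of the propagator `C = (1 + ‖n‖²)⁻¹` cut to the slice `j`. -/
noncomputable def slicePropagator (M : ℕ) (j : ℕ+) (n : Fin 4 → ℤ) : ℝ :=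
  open Classical in
  if InSlice M j n then ((symbol n : ℤ) : ℝ)⁻¹ else 0

namespace VacuumGraph

/-- A scale attribution: a slice index for each line. -/
abbrev ScaleAttribution (G : VacuumGraph) : Type := G.Line → ℕ+

/-- `(∏_{g ∈ F} τ_g) A_{G,μ}`; for `F = ∅` it is the bare amplitude `A_{G,μ}`, the sum over the
indices of all faces of the product of all the sliced propagators. -/
noncomputable def forestAmplitude (G : VacuumGraph) (M : ℕ) (F : Finset (Finset G.Line))
    (μ : G.ScaleAttribution) : ℝ :=
  ∑' n : G.Face → ℤ, ∏ l : G.Line, slicePropagator M (μ l) (G.lineIndex F n l)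

/-- The renormalised amplitude `∑_F ∏_{g ∈ F} (-τ_g) A_{G,μ}` at scale attribution `μ`. The sum
runs over all forests of divergent subgraphs; those which contain `G` itself, if `G` is divergent,
provide the factor `1 - τ_G`. -/
noncomputable def renormalisedAmplitude (G : VacuumGraph) (M : ℕ) (μ : G.ScaleAttribution) : ℝ :=
  open Classical in
  ∑ F : Finset (Finset G.Line) with G.IsForest F, (-1 : ℝ) ^ F.card * G.forestAmplitude M F μ

end VacuumGraph

end TensorT44

/-!
Contract each cycle of the Wick contraction to a point: the graph becomes a map (the intermediate
field map) whose edges are the quartic vertices, whose corners are the lines, and whose leaves are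
the melonic tadpoles `M₁`. A graph `M₂` is a leaf inserted on a map vertex with just two edges.

*Forests.* If a component `g` of `G` is divergent, adding `g` to a forest or removing it flips the
sign of the term and leaves the amplitude unchanged, so that the renormalised amplitude vanishes
(`renormalisedAmplitude_eq_zero`). Otherwise the divergent subgraphs are the `M₁` and the `M₂`. Two
of them overlap only in vacuum graphs that are themselves divergent, so every set of them is a
forest (`NoDivergentComponent.sum_forests`), and the sum over the forests factorises into subtracted
tadpoles, subtracted pairs of outer lines of an `M₂`, and plain propagators of the remaining
lines, called reduced (`NoDivergentComponent.sum_forest_integrand`).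

*Two-point graphs.* The sums over the scales and over the face indices may then be exchanged, all
terms being nonnegative. With the weight `M^{i/24}`, the sum over the scale `i` of a propagator at
`s = 1 + ‖n‖²` is `O(s^{-47/48})`. The slices are sharp, so a subtracted propagator is small
except where a slice boundary separates the two arguments, and there it has full size. Those points
lie in a thin shell around a sphere of `ℝ³`, and have to be counted: fixing one coordinate puts the
others on a circle, which carries `O(X^{2/3})` integer points if its radius is at most `X`
(`card_circle_le`), and this beats the area of the sphere (`card_shell_le`). Consequently the sum
over the three internal faces of a tadpole with external index `m` is `O((1+m²)^{13/24})`, and the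
sum over the six internal faces of an `M₂` is `O((1+m²)^{5/48})` (`exists_tsum_tadpole_le`,
`exists_tsum_clusterSum_le`).

*Reduced lines.* The growth of what is attached at the start of a reduced line `y` is absorbed by
the decrease of its propagator: what remains is a power `-capacity y / 2` of `1 + ‖n‖²`. It is shared
among the four faces through `y`, and the sum over the index of a face converges as soon as the face
receives in total more than `1` (`NoDivergentComponent.le_sum_allotment`). The capacity could be too
small only at map vertices with few edges; there, the configurations in question close up into a
component with at least twice as many faces as lines, or form an `M₂`, and so do not occur
(`NoDivergentComponent.five_le`,
`NoDivergentComponent.not_selfLoop`, `NoDivergentComponent.not_selfLoop_leaf`,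
`NoDivergentComponent.not_doubleEdge`). A graph of order `n` has `2n` lines and at most `8n` faces,
whence the bound `Kⁿ`.
-/

open scoped ENNReal

namespace TensorT44

/-! ### Integer points on a circle -/

/-- On the arc `|a| ≤ b` of a circle, distinct integer points differ more in `a` than in `b`. -/
theorem abs_sub_lt_of_mem_arc {N a b c d : ℤ} (h₁ : a ^ 2 + b ^ 2 = N) (h₂ : |a| ≤ b)
    (h₃ : c ^ 2 + d ^ 2 = N) (h₄ : |c| ≤ d) (hne : ¬ (a = c ∧ b = d)) :
    |b - d| < |a - c| := by
  by_contra! hle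
  have hmul : |b - d| * (b + d) = |a - c| * |a + c| := by
    have hbd : 0 ≤ b + d := by linarith [abs_nonneg a, abs_nonneg c]
    calc |b - d| * (b + d) = |(b - d) * (b + d)| := by rw [abs_mul, abs_of_nonneg hbd]
      _ = |-((a - c) * (a + c))| := by congr 1; linarith
      _ = |a - c| * |a + c| := by rw [abs_neg, abs_mul]
  have hac : |a + c| ≤ b + d := (abs_add_le a c).trans (add_le_add h₂ h₄)
  rcases (abs_nonneg (a - c)).eq_or_lt with h0 | hpos
  · have hac' : a = c := by
      have := abs_eq_zero.1 h0.symm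
      linarith
    subst hac'
    have hb : 0 ≤ b := (abs_nonneg a).trans h₂
    have hd : 0 ≤ d := (abs_nonneg a).trans h₄
    exact hne ⟨rfl, (sq_eq_sq₀ hb hd).1 (by linarith)⟩
  · have heq : |a + c| = b + d := by
      apply le_antisymm hac
      have : |a - c| * (b + d) ≤ |a - c| * |a + c| := by
        rw [← hmul]
        exact mul_le_mul_of_nonneg_right hle ((abs_nonneg _).trans hac)
      exact le_of_mul_le_mul_left this hpos
    rcases abs_cases (a + c) with ⟨h, _⟩ | ⟨h, _⟩ <;> rcases abs_cases a with ⟨ha, _⟩ | ⟨ha, _⟩ <;>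
      rcases abs_cases c with ⟨hc, _⟩ | ⟨hc, _⟩ <;>
      refine hne ⟨?_, ?_⟩ <;> nlinarith

/-- A nonzero vector is the difference of at most one pair of integer points of the arc. -/
theorem eq_of_sub_eq_sub_of_mem_arc {N : ℤ} {p q r s : ℤ × ℤ}
    (hp : p.1 ^ 2 + p.2 ^ 2 = N ∧ |p.1| ≤ p.2) (hq : q.1 ^ 2 + q.2 ^ 2 = N ∧ |q.1| ≤ q.2)
    (hr : r.1 ^ 2 + r.2 ^ 2 = N ∧ |r.1| ≤ r.2) (hs : s.1 ^ 2 + s.2 ^ 2 = N ∧ |s.1| ≤ s.2)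
    (hpr : p ≠ r) (h : p - r = q - s) : r = s := by
  by_contra hne
  have e₁ : p.1 - r.1 = q.1 - s.1 := congrArg Prod.fst h
  have e₂ : p.2 - r.2 = q.2 - s.2 := congrArg Prod.snd h
  have l₁ := abs_sub_lt_of_mem_arc hp.1 hp.2 hr.1 hr.2 (fun h => hpr (Prod.ext h.1 h.2))
  have l₂ := abs_sub_lt_of_mem_arc hr.1 hr.2 hs.1 hs.2 (fun h => hne (Prod.ext h.1 h.2))
  have orth : (p.1 - r.1) * (r.1 - s.1) = -((p.2 - r.2) * (r.2 - s.2)) := by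
    obtain ⟨hp, -⟩ := hp
    obtain ⟨hq, -⟩ := hq
    obtain ⟨hr, -⟩ := hr
    obtain ⟨hs, -⟩ := hs
    have e₃ : q.1 = p.1 - r.1 + s.1 := by linarith
    have e₄ : q.2 = p.2 - r.2 + s.2 := by linarith
    rw [e₃, e₄] at hq
    nlinarith
  have habs := congrArg abs orth
  rw [abs_neg, abs_mul, abs_mul] at habs
  have := mul_lt_mul'' l₁ l₂ (abs_nonneg _) (abs_nonneg _)
  linarith

/-- Cut the arc into windows of width `H` in `a`. Apart from one point in each window, every point
is determined by its difference with the chosen point of its window. -/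
theorem card_arc_le {N : ℤ} {X H : ℕ} (hH : 0 < H) (hN : N ≤ (X : ℤ) ^ 2) (S : Finset (ℤ × ℤ))
    (hS : ∀ p ∈ S, p.1 ^ 2 + p.2 ^ 2 = N ∧ |p.1| ≤ p.2) :
    S.card ≤ 2 * (X / H) + 2 + (2 * H + 1) ^ 2 := by
  classical
  have hH' : (0 : ℤ) < H := by exact_mod_cast hH
  have hex : ∀ w : ℤ, ∃ r : ℤ × ℤ, (∃ p ∈ S, p.1 / (H : ℤ) = w) → r ∈ S ∧ r.1 / (H : ℤ) = w := by
    intro w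
    by_cases h : ∃ p ∈ S, p.1 / (H : ℤ) = w
    · obtain ⟨p, hp⟩ := h
      exact ⟨p, fun _ => hp⟩
    · exact ⟨0, fun h' => absurd h' h⟩
  choose rep hrep using hex
  have hrepS : ∀ p ∈ S, rep (p.1 / H) ∈ S ∧ (rep (p.1 / H)).1 / (H : ℤ) = p.1 / H :=
    fun p hp => hrep _ ⟨p, hp, rfl⟩
  let T : Finset (ℤ ⊕ ℤ × ℤ) := (Finset.Icc (-((X / H : ℕ) : ℤ) - 1) ((X / H : ℕ) : ℤ)).disjSum
    (Finset.Icc (-(H : ℤ)) H ×ˢ Finset.Icc (-(H : ℤ)) H)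
  let f : ℤ × ℤ → ℤ ⊕ ℤ × ℤ := fun p =>
    if p = rep (p.1 / H) then Sum.inl (p.1 / H) else Sum.inr (p - rep (p.1 / H))
  have hT : T.card = 2 * (X / H) + 2 + (2 * H + 1) ^ 2 := by
    simp only [T, Finset.card_disjSum, Finset.card_product, Int.card_Icc]
    generalize X / H = k
    have h₁ : ((k : ℤ) + 1 - (-(k : ℤ) - 1)).toNat = 2 * k + 2 := by omega
    have h₂ : ((H : ℤ) + 1 - -(H : ℤ)).toNat = 2 * H + 1 := by omega
    rw [h₁, h₂]
    ring
  rw [← hT]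
  refine Finset.card_le_card_of_injOn f ?_ ?_
  · intro p hp
    have hp : p ∈ S := hp
    obtain ⟨h₁, h₂⟩ := hS p hp
    obtain ⟨hr, hw⟩ := hrepS p hp
    by_cases h : p = rep (p.1 / H)
    · have habs : |p.1| ≤ X := abs_le_of_sq_le_sq (by nlinarith) (by positivity)
      rw [abs_le] at habs
      simp only [f, if_pos h]
      simp only [T, Finset.mem_coe, Finset.inl_mem_disjSum, Finset.mem_Icc]
      push_cast
      constructor
      · have h₃ : (-(X : ℤ)) / H ≤ p.1 / H := Int.ediv_le_ediv hH' habs.1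
        have h₄ : -((X : ℤ) / H) - 1 ≤ (-(X : ℤ)) / H := by
          rw [Int.le_ediv_iff_mul_le hH']
          have := Int.lt_ediv_add_one_mul_self (X : ℤ) hH'
          nlinarith
        linarith
      · exact Int.ediv_le_ediv hH' habs.2
    · have hlt := abs_sub_lt_of_mem_arc h₁ h₂ (hS _ hr).1 (hS _ hr).2
        (fun h' => h (Prod.ext h'.1 h'.2))
      have hwin : |p.1 - (rep (p.1 / H)).1| ≤ H := by
        have a₁ := Int.emod_add_mul_ediv p.1 H
        have a₂ := Int.emod_add_mul_ediv (rep (p.1 / H)).1 H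
        have a₃ := Int.emod_nonneg p.1 hH'.ne'
        have a₄ := Int.emod_lt_of_pos p.1 hH'
        have a₅ := Int.emod_nonneg (rep (p.1 / H)).1 hH'.ne'
        have a₆ := Int.emod_lt_of_pos (rep (p.1 / H)).1 hH'
        rw [hw] at a₂
        rw [abs_le]
        constructor <;> linarith
      simp only [f, if_neg h]
      simp only [T, Finset.mem_coe, Finset.inr_mem_disjSum, Finset.mem_product, Finset.mem_Icc,
        Prod.fst_sub, Prod.snd_sub]
      exact ⟨abs_le.1 hwin, abs_le.1 (hlt.le.trans hwin)⟩
  · intro p hp q hq hpq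
    have hp : p ∈ S := hp
    have hq : q ∈ S := hq
    by_cases h : p = rep (p.1 / H) <;> by_cases h' : q = rep (q.1 / H)
    · simp only [f, if_pos h, if_pos h', Sum.inl.injEq] at hpq
      rw [h, h', hpq]
    · simp [f, if_pos h, if_neg h'] at hpq
    · simp [f, if_neg h, if_pos h'] at hpq
    · simp only [f, if_neg h, if_neg h', Sum.inr.injEq] at hpq
      have := eq_of_sub_eq_sub_of_mem_arc (hS p hp) (hS q hq) (hS _ (hrepS p hp).1)
        (hS _ (hrepS q hq).1) h hpq
      rw [this] at hpq
      exact sub_left_injective hpq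

/-- A circle of radius at most `X` carries `O(X^{2/3})` integer points. -/
theorem card_circle_le {N : ℤ} {X : ℕ} (hX : 1 ≤ X) (hN : N ≤ (X : ℤ) ^ 2) (S : Finset (ℤ × ℤ))
    (hS : ∀ p ∈ S, p.1 ^ 2 + p.2 ^ 2 = N) :
    (S.card : ℝ) ≤ 120 * (X : ℝ) ^ (2 / 3 : ℝ) := by
  classical
  have hX1 : (1 : ℝ) ≤ X := by exact_mod_cast hX
  have hc1 : (1 : ℝ) ≤ (X : ℝ) ^ (1 / 3 : ℝ) := Real.one_le_rpow hX1 (by norm_num)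
  set H : ℕ := ⌈(X : ℝ) ^ (1 / 3 : ℝ)⌉₊ with hHdef
  have hH1 : (X : ℝ) ^ (1 / 3 : ℝ) ≤ H := Nat.le_ceil _
  have hH2 : (H : ℝ) ≤ 2 * (X : ℝ) ^ (1 / 3 : ℝ) := by
    have := Nat.ceil_lt_add_one (a := (X : ℝ) ^ (1 / 3 : ℝ)) (by positivity)
    linarith
  have hH : 0 < H := Nat.ceil_pos.2 (by linarith)
  -- four quarter turns of the arc cover the circle
  let A : Finset (ℤ × ℤ) := S.filter fun p => |p.1| ≤ p.2
  let B : Finset (ℤ × ℤ) := S.filter fun p => |p.1| ≤ -p.2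
  let C : Finset (ℤ × ℤ) := S.filter fun p => |p.2| ≤ p.1
  let D : Finset (ℤ × ℤ) := S.filter fun p => |p.2| ≤ -p.1
  have hcov : S ⊆ (A ∪ B) ∪ (C ∪ D) := by
    intro p hp
    simp only [A, B, C, D, Finset.mem_union, Finset.mem_filter, hp, true_and]
    rcases abs_cases p.1 with h | h <;> rcases abs_cases p.2 with h' | h' <;> omega
  have key : ∀ (T : Finset (ℤ × ℤ)) (e : ℤ × ℤ → ℤ × ℤ), Function.Injective e →
      (∀ p ∈ T, (e p).1 ^ 2 + (e p).2 ^ 2 = N ∧ |(e p).1| ≤ (e p).2) →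
      T.card ≤ 2 * (X / H) + 2 + (2 * H + 1) ^ 2 := by
    intro T e he hT
    rw [← Finset.card_image_of_injective T he]
    refine card_arc_le hH hN _ ?_
    intro q hq
    obtain ⟨p, hp, rfl⟩ := Finset.mem_image.1 hq
    exact hT p hp
  have hA := key A id Function.injective_id (fun p hp => by
    have := Finset.mem_filter.1 hp
    exact ⟨hS p this.1, this.2⟩)
  have hB := key B (fun p => (p.1, -p.2)) (fun p q h => by
      simp only [Prod.mk.injEq, neg_inj] at h
      exact Prod.ext h.1 h.2) (fun p hp => by
    have := Finset.mem_filter.1 hp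
    exact ⟨by simpa using hS p this.1, this.2⟩)
  have hC := key C (fun p => (p.2, p.1)) (fun p q h => by
      simp only [Prod.mk.injEq] at h
      exact Prod.ext h.2 h.1) (fun p hp => by
    have := Finset.mem_filter.1 hp
    exact ⟨by rw [add_comm]; exact hS p this.1, this.2⟩)
  have hD := key D (fun p => (p.2, -p.1)) (fun p q h => by
      simp only [Prod.mk.injEq, neg_inj] at h
      exact Prod.ext h.2 h.1) (fun p hp => by
    have := Finset.mem_filter.1 hp
    exact ⟨by rw [add_comm]; simpa using hS p this.1, this.2⟩)
  have htot : S.card ≤ 4 * (2 * (X / H) + 2 + (2 * H + 1) ^ 2) := by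
    have h₁ := Finset.card_le_card hcov
    have h₂ := Finset.card_union_le (A ∪ B) (C ∪ D)
    have h₃ := Finset.card_union_le A B
    have h₄ := Finset.card_union_le C D
    omega
  have htot' : (S.card : ℝ) ≤ 4 * (2 * ((X / H : ℕ) : ℝ) + 2 + (2 * (H : ℝ) + 1) ^ 2) := by
    exact_mod_cast htot
  have hdiv : ((X / H : ℕ) : ℝ) ≤ (X : ℝ) ^ (2 / 3 : ℝ) := by
    refine Nat.cast_div_le.trans ?_
    rw [div_le_iff₀ (by exact_mod_cast hH)]
    calc (X : ℝ) = (X : ℝ) ^ (2 / 3 : ℝ) * (X : ℝ) ^ (1 / 3 : ℝ) := by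
          rw [← Real.rpow_add (by linarith)]; norm_num
      _ ≤ _ := by gcongr
  have hsq : (X : ℝ) ^ (2 / 3 : ℝ) = ((X : ℝ) ^ (1 / 3 : ℝ)) ^ 2 := by
    rw [← Real.rpow_natCast, ← Real.rpow_mul (by linarith)]; norm_num
  have hc2 : (1 : ℝ) ≤ (X : ℝ) ^ (2 / 3 : ℝ) := Real.one_le_rpow hX1 (by norm_num)
  have hquad : (2 * (H : ℝ) + 1) ^ 2 ≤ 25 * (X : ℝ) ^ (2 / 3 : ℝ) := by
    rw [hsq]
    have : 2 * (H : ℝ) + 1 ≤ 5 * (X : ℝ) ^ (1 / 3 : ℝ) := by linarith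
    calc (2 * (H : ℝ) + 1) ^ 2 ≤ (5 * (X : ℝ) ^ (1 / 3 : ℝ)) ^ 2 := by gcongr
      _ = _ := by ring
  linarith

/-! ### Integer points in a thin shell -/

theorem card_le_of_forall_abs_sub_le {T : Finset ℤ} {D : ℕ}
    (h : ∀ a ∈ T, ∀ b ∈ T, |a - b| ≤ D) : T.card ≤ D + 1 := by
  rcases T.eq_empty_or_nonempty with rfl | hT
  · simp
  · have hsub : T ⊆ Finset.Icc (T.min' hT) (T.min' hT + D) := by
      intro a ha
      have := (abs_le.1 (h a ha _ (T.min'_mem hT))).2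
      exact Finset.mem_Icc.2 ⟨T.min'_le a ha, by linarith⟩
    refine (Finset.card_le_card hsub).trans ?_
    rw [Int.card_Icc]
    omega

/-- The integer points `p` of `ℤ³` close to a sphere of radius `X`: those with
`m² < 1 + |p|² ≤ X² < 1 + |p|² + m²`. -/
def InShell (X m : ℕ) (p : Fin 3 → ℤ) : Prop :=
  (m : ℤ) ^ 2 < 1 + ∑ j, p j ^ 2 ∧ 1 + ∑ j, p j ^ 2 ≤ (X : ℤ) ^ 2 ∧
    (X : ℤ) ^ 2 < 1 + ∑ j, p j ^ 2 + (m : ℤ) ^ 2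

theorem InShell.abs_le {X m : ℕ} {p : Fin 3 → ℤ} (h : InShell X m p) (j : Fin 3) :
    |p j| ≤ X := by
  have h₁ := h.2.1
  have h₂ : p j ^ 2 ≤ ∑ j, p j ^ 2 :=
    Finset.single_le_sum (f := fun j => p j ^ 2) (fun i _ => sq_nonneg _) (Finset.mem_univ j)
  exact abs_le_of_sq_le_sq (by linarith) (by positivity)

/-- Fix one coordinate and the norm: the other two coordinates lie on a circle. -/
theorem card_shell_le_mul {X m : ℕ} (hX : 1 ≤ X) (S : Finset (Fin 3 → ℤ))
    (hS : ∀ p ∈ S, InShell X m p) :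
    (S.card : ℝ) ≤ 360 * ((m : ℝ) ^ 2 * (X : ℝ) ^ (5 / 3 : ℝ)) := by
  classical
  have hX1 : (1 : ℝ) ≤ X := by exact_mod_cast hX
  let T : Finset (ℤ × ℤ) := Finset.Icc (-(X : ℤ)) X ×ˢ Finset.Ico 0 ((m : ℤ) ^ 2)
  let f : (Fin 3 → ℤ) → ℤ × ℤ := fun p => (p 0, (X : ℤ) ^ 2 - (1 + ∑ j, p j ^ 2))
  have hcard := Finset.card_le_mul_card_image_of_maps_to (s := S) (t := T) (f := f) (by
      intro p hp
      obtain ⟨-, h₂, h₃⟩ := hS p hp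
      simp only [T, f, Finset.mem_product, Finset.mem_Icc, Finset.mem_Ico]
      exact ⟨_root_.abs_le.1 ((hS p hp).abs_le 0), by linarith, by linarith⟩)
    ⌊120 * (X : ℝ) ^ (2 / 3 : ℝ)⌋₊ (by
      rintro ⟨a, e⟩ hb
      simp only [T, Finset.mem_product, Finset.mem_Icc, Finset.mem_Ico] at hb
      have hinj : Set.InjOn (fun p : Fin 3 → ℤ => (p 1, p 2))
          (S.filter fun p => f p = (a, e)) := by
        intro p hp q hq hpq
        have hp := (Finset.mem_filter.1 (Finset.mem_coe.1 hp)).2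
        have hq := (Finset.mem_filter.1 (Finset.mem_coe.1 hq)).2
        simp only [f, Prod.mk.injEq] at hp hq hpq
        funext j
        fin_cases j
        · exact hp.1.trans hq.1.symm
        · exact hpq.1
        · exact hpq.2
      rw [← Finset.card_image_of_injOn hinj]
      refine Nat.le_floor (card_circle_le (N := (X : ℤ) ^ 2 - 1 - e - a ^ 2) hX ?_ _ ?_)
      · nlinarith [sq_nonneg a]
      · intro q hq
        obtain ⟨p, hp, rfl⟩ := Finset.mem_image.1 hq
        have hp := (Finset.mem_filter.1 hp).2
        simp only [f, Prod.mk.injEq, Fin.sum_univ_three] at hp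
        obtain ⟨rfl, rfl⟩ := hp
        ring)
  have hT : T.card = (2 * X + 1) * m ^ 2 := by
    simp only [T, Finset.card_product, Int.card_Icc, Int.card_Ico]
    congr 1
    omega
  rw [hT] at hcard
  have hpow : (X : ℝ) ^ (5 / 3 : ℝ) = X * (X : ℝ) ^ (2 / 3 : ℝ) := by
    rw [← Real.rpow_one_add' (by linarith) (by norm_num)]; norm_num
  have hfl := Nat.floor_le (a := 120 * (X : ℝ) ^ (2 / 3 : ℝ)) (by positivity)
  calc (S.card : ℝ) ≤ (⌊120 * (X : ℝ) ^ (2 / 3 : ℝ)⌋₊ : ℝ) * ((2 * X + 1) * m ^ 2) := by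
        exact_mod_cast hcard
    _ ≤ (120 * (X : ℝ) ^ (2 / 3 : ℝ)) * ((3 * X) * m ^ 2) := by gcongr; linarith
    _ = _ := by rw [hpow]; ring

/-- Fix all coordinates but the largest one: it runs through a short interval. -/
theorem card_shell_le_add {X m : ℕ} (hm : 1 ≤ m) (hmX : m < X) (S : Finset (Fin 3 → ℤ))
    (hS : ∀ p ∈ S, InShell X m p) :
    (S.card : ℝ) ≤ 54 * (X : ℝ) ^ 2 + 108 * (X * (m : ℝ) ^ 2) := by
  classical
  have hX2 : 2 ≤ X := by omega
  have hX1 : (1 : ℝ) ≤ X := by exact_mod_cast (by omega : 1 ≤ X)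
  have key : ∀ j : Fin 3, (S.filter fun p => ∀ i, p i ^ 2 ≤ p j ^ 2).card ≤
      (2 * m ^ 2 / X + 1) * ((2 * X + 1) * ((2 * X + 1) * 2)) := by
    intro j
    let T : Finset (ℤ × ℤ × Bool) :=
      Finset.Icc (-(X : ℤ)) X ×ˢ Finset.Icc (-(X : ℤ)) X ×ˢ Finset.univ
    have hT : T.card = (2 * X + 1) * ((2 * X + 1) * 2) := by
      simp only [T, Finset.card_product, Int.card_Icc, Finset.card_univ, Fintype.card_bool]
      have : ((X : ℤ) + 1 - -(X : ℤ)).toNat = 2 * X + 1 := by omega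
      rw [this]
    rw [← hT]
    refine Finset.card_le_mul_card_image_of_maps_to
      (f := fun p => (p (j.succAbove 0), p (j.succAbove 1), decide (0 ≤ p j))) ?_ _ ?_
    · intro p hp
      have hp := hS p (Finset.mem_filter.1 hp).1
      simp only [T, Finset.mem_product, Finset.mem_Icc, Finset.mem_univ, and_true]
      exact ⟨_root_.abs_le.1 (hp.abs_le _), _root_.abs_le.1 (hp.abs_le _)⟩
    · rintro ⟨a, b, c⟩ -
      have hinj : Set.InjOn (fun p : Fin 3 → ℤ => p j)
          ((S.filter fun p => ∀ i, p i ^ 2 ≤ p j ^ 2).filter fun p =>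
            (p (j.succAbove 0), p (j.succAbove 1), decide (0 ≤ p j)) = (a, b, c)) := by
        intro p hp q hq hpq
        have hp := (Finset.mem_filter.1 (Finset.mem_coe.1 hp)).2
        have hq := (Finset.mem_filter.1 (Finset.mem_coe.1 hq)).2
        simp only [Prod.mk.injEq] at hp hq
        funext i
        refine Fin.succAboveCases j hpq (fun i => ?_) i
        fin_cases i
        · exact hp.1.trans hq.1.symm
        · exact hp.2.1.trans hq.2.1.symm
      rw [← Finset.card_image_of_injOn hinj]
      apply card_le_of_forall_abs_sub_le
      intro x hx y hy
      obtain ⟨p, hp, rfl⟩ := Finset.mem_image.1 hx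
      obtain ⟨q, hq, rfl⟩ := Finset.mem_image.1 hy
      obtain ⟨hp, hpf⟩ := Finset.mem_filter.1 hp
      obtain ⟨hq, hqf⟩ := Finset.mem_filter.1 hq
      obtain ⟨hpS, hpj⟩ := Finset.mem_filter.1 hp
      obtain ⟨hqS, hqj⟩ := Finset.mem_filter.1 hq
      simp only [Prod.mk.injEq] at hpf hqf
      obtain ⟨p₁, p₂, p₃⟩ := hS p hpS
      obtain ⟨q₁, q₂, q₃⟩ := hS q hqS
      have big : ∀ r : Fin 3 → ℤ, InShell X m r → (∀ i, r i ^ 2 ≤ r j ^ 2) →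
          (X : ℤ) ≤ 3 * |r j| := by
        rintro r ⟨r₁, r₂, r₃⟩ hr
        have h₀ := hr 0
        have h₁ := hr 1
        have h₂ := hr 2
        rw [Fin.sum_univ_three] at r₁ r₂ r₃
        have hX2' : (2 : ℤ) ≤ X := by exact_mod_cast hX2
        refine le_of_sq_le_sq ?_ (by positivity)
        rw [mul_pow, sq_abs]
        nlinarith
      have bp := big p (hS p hpS) hpj
      have bq := big q (hS q hqS) hqj
      rw [Fin.sum_univ_succAbove _ j, Fin.sum_univ_two] at p₁ p₂ p₃ q₁ q₂ q₃
      rw [hpf.1, hpf.2.1] at p₁ p₂ p₃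
      rw [hqf.1, hqf.2.1] at q₁ q₂ q₃
      have hsign : |p j + q j| = |p j| + |q j| := by
        have hd : decide (0 ≤ p j) = decide (0 ≤ q j) := hpf.2.2.trans hqf.2.2.symm
        rw [decide_eq_decide] at hd
        rcases abs_cases (p j) with h | h <;> rcases abs_cases (q j) with h' | h' <;>
          rcases abs_cases (p j + q j) with h'' | h'' <;> omega
      have hdiff : |p j - q j| * |p j + q j| < (m : ℤ) ^ 2 := by
        rw [← abs_mul, abs_lt]
        constructor <;> nlinarith
      have hmain : |p j - q j| * X ≤ 2 * (m : ℤ) ^ 2 := by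
        rw [hsign] at hdiff
        nlinarith [abs_nonneg (p j - q j)]
      push_cast
      rwa [Int.le_ediv_iff_mul_le (by omega)]
  have hcov : S ⊆ Finset.univ.biUnion fun j => S.filter fun p => ∀ i, p i ^ 2 ≤ p j ^ 2 := by
    intro p hp
    obtain ⟨j, -, hj⟩ := Finset.exists_max_image Finset.univ (fun j => p j ^ 2) ⟨0, by simp⟩
    simp only [Finset.mem_biUnion, Finset.mem_univ, true_and, Finset.mem_filter]
    exact ⟨j, hp, fun i => hj i (Finset.mem_univ i)⟩
  have htot : S.card ≤ 3 * ((2 * m ^ 2 / X + 1) * ((2 * X + 1) * ((2 * X + 1) * 2))) := by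
    refine (Finset.card_le_card hcov).trans (Finset.card_biUnion_le.trans ?_)
    refine (Finset.sum_le_card_nsmul _ _ _ (fun j _ => key j)).trans ?_
    simp
  have hdiv : ((2 * m ^ 2 / X : ℕ) : ℝ) ≤ 2 * (m : ℝ) ^ 2 / X := by
    refine Nat.cast_div_le.trans ?_
    push_cast
    exact le_rfl
  calc (S.card : ℝ) ≤
        3 * ((((2 * m ^ 2 / X : ℕ) : ℝ) + 1) * ((2 * X + 1) * ((2 * X + 1) * 2))) := by
        exact_mod_cast htot
    _ ≤ 3 * ((2 * (m : ℝ) ^ 2 / X + 1) * ((3 * X) * ((3 * X) * 2))) := by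
        gcongr <;> linarith
    _ = _ := by
        field_simp
        ring

/-- The two ways to count combine into a bound with a gain over the area of the sphere. -/
theorem card_shell_le {X m : ℕ} (hm : 1 ≤ m) (hmX : m < X) (S : Finset (Fin 3 → ℤ))
    (hS : ∀ p ∈ S, InShell X m p) :
    (S.card : ℝ) ≤ 250 * (X * (m : ℝ) ^ 2 + m * (X : ℝ) ^ (11 / 6 : ℝ)) := by
  have hX0 : (0 : ℝ) < X := by exact_mod_cast (by omega : 0 < X)
  have hA := card_shell_le_add hm hmX S hS
  have hB := card_shell_le_mul (by omega) S hS
  have hpow : (X : ℝ) ^ 2 * (X : ℝ) ^ (5 / 3 : ℝ) = ((X : ℝ) ^ (11 / 6 : ℝ)) ^ 2 := by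
    rw [← Real.rpow_natCast, ← Real.rpow_natCast, ← Real.rpow_mul hX0.le, ← Real.rpow_add hX0]
    norm_num
  have hY : 0 ≤ m * (X : ℝ) ^ (11 / 6 : ℝ) := by positivity
  rcases le_total ((m : ℝ) ^ 2) X with h | h
  · have hA' : (S.card : ℝ) ≤ 162 * (X : ℝ) ^ 2 := by nlinarith
    have : (S.card : ℝ) ≤ 250 * (m * (X : ℝ) ^ (11 / 6 : ℝ)) := by
      refine le_of_sq_le_sq ?_ (by positivity)
      calc (S.card : ℝ) ^ 2 = S.card * S.card := sq _
        _ ≤ (162 * (X : ℝ) ^ 2) * (360 * ((m : ℝ) ^ 2 * (X : ℝ) ^ (5 / 3 : ℝ))) := by gcongr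
        _ = 58320 * ((m : ℝ) ^ 2 * ((X : ℝ) ^ 2 * (X : ℝ) ^ (5 / 3 : ℝ))) := by ring
        _ ≤ 62500 * ((m : ℝ) ^ 2 * ((X : ℝ) ^ 2 * (X : ℝ) ^ (5 / 3 : ℝ))) := by gcongr; norm_num
        _ = _ := by rw [hpow]; ring
    have : 0 ≤ X * (m : ℝ) ^ 2 := by positivity
    linarith
  · have : (X : ℝ) ^ 2 ≤ X * (m : ℝ) ^ 2 := by nlinarith
    have : 0 ≤ X * (m : ℝ) ^ 2 := by positivity
    linarith

/-! ### Sums over the three internal indices of a tadpole -/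

/-- In `ℝ≥0∞`, the sum of a product of functions of independent variables is at most the product of
the sums. -/
theorem tsum_pi_prod_le {ι α : Type*} [Fintype ι] (f : ι → α → ℝ≥0∞) :
    ∑' p : ι → α, ∏ i, f i (p i) ≤ ∏ i, ∑' a, f i a := by
  classical
  rw [ENNReal.tsum_eq_iSup_sum]
  refine iSup_le fun S => ?_
  calc ∑ p ∈ S, ∏ i, f i (p i)
      ≤ ∑ p ∈ Fintype.piFinset fun i => S.image fun p => p i, ∏ i, f i (p i) := by
        refine Finset.sum_le_sum_of_subset fun p hp => ?_
        exact Fintype.mem_piFinset.2 fun i => Finset.mem_image_of_mem _ hp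
    _ = ∏ i, ∑ a ∈ S.image fun p => p i, f i a := (Finset.prod_univ_sum _ _).symm
    _ ≤ _ := Finset.prod_le_prod' fun i _ => ENNReal.sum_le_tsum _

/-- `∑_{a ∈ ℤ} (1 + a²)^{-x}` converges for `x > 1/2`. -/
theorem tsum_one_add_sq_rpow_lt_top {x : ℝ} (hx : 1 / 2 < x) :
    ∑' a : ℤ, ENNReal.ofReal ((1 + (a : ℝ) ^ 2) ^ (-x)) < ∞ := by
  have hs : Summable fun a : ℤ => (1 + (a : ℝ) ^ 2) ^ (-x) := by
    have h₁ := Real.summable_abs_int_rpow (b := 2 * x) (by linarith)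
    have h₂ : Summable fun a : ℤ => if a = 0 then (1 : ℝ) else 0 :=
      summable_of_ne_finset_zero (s := {0}) (by
        intro b hb
        simp only [Finset.mem_singleton] at hb
        simp [hb])
    refine Summable.of_nonneg_of_le (fun a => by positivity) (fun a => ?_) (h₁.add h₂)
    rcases eq_or_ne a 0 with rfl | ha
    · simp only [Int.cast_zero, if_true]
      have : 0 ≤ |(0 : ℝ)| ^ (-(2 * x)) := by positivity
      simp only [ne_eq, OfNat.ofNat_ne_zero, not_false_eq_true, zero_pow, add_zero, Real.one_rpow]
      linarith
    · have ha' : (0 : ℝ) < |(a : ℝ)| := abs_pos.2 (by exact_mod_cast ha)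
      rw [if_neg ha, add_zero, show -(2 * x) = 2 * (-x) by ring, Real.rpow_mul ha'.le]
      refine Real.rpow_le_rpow_of_nonpos (by positivity) ?_ (by linarith)
      rw [Real.rpow_two, sq_abs]
      linarith
  rw [← ENNReal.ofReal_tsum_of_nonneg (fun a => by positivity) hs]
  exact ENNReal.ofReal_lt_top

/-- `1 + |p|²` for `p ∈ ℤ³`, the indices of the three faces which are internal to a tadpole. -/
def symbol3 (p : Fin 3 → ℤ) : ℤ := 1 + ∑ j, p j ^ 2

theorem one_le_symbol3 (p : Fin 3 → ℤ) : 1 ≤ symbol3 p := by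
  have : 0 ≤ ∑ j, p j ^ 2 := Finset.sum_nonneg fun j _ => sq_nonneg _
  unfold symbol3
  linarith

theorem one_le_cast_symbol3 (p : Fin 3 → ℤ) : (1 : ℝ) ≤ symbol3 p := by
  exact_mod_cast one_le_symbol3 p

theorem one_add_sq_le_symbol3 (p : Fin 3 → ℤ) (j : Fin 3) :
    1 + (p j : ℝ) ^ 2 ≤ symbol3 p := by
  have : p j ^ 2 ≤ ∑ j, p j ^ 2 :=
    Finset.single_le_sum (f := fun j => p j ^ 2) (fun i _ => sq_nonneg _) (Finset.mem_univ j)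
  have h : 1 + p j ^ 2 ≤ symbol3 p := by
    unfold symbol3
    linarith
  exact_mod_cast h

/-- The exponent `73/48` is just above the critical value `3/2`. -/
theorem tsum_symbol3_rpow_lt_top :
    ∑' p : Fin 3 → ℤ, ENNReal.ofReal ((symbol3 p : ℝ) ^ (-(73 / 48) : ℝ)) < ∞ := by
  have h := tsum_one_add_sq_rpow_lt_top (x := 73 / 144) (by norm_num)
  calc ∑' p : Fin 3 → ℤ, ENNReal.ofReal ((symbol3 p : ℝ) ^ (-(73 / 48) : ℝ))
      ≤ ∑' p : Fin 3 → ℤ, ∏ j, ENNReal.ofReal ((1 + (p j : ℝ) ^ 2) ^ (-(73 / 144) : ℝ)) := by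
        refine ENNReal.tsum_le_tsum fun p => ?_
        rw [← ENNReal.ofReal_prod_of_nonneg (fun j _ => by positivity)]
        refine ENNReal.ofReal_le_ofReal ?_
        have hs := one_le_cast_symbol3 p
        calc (symbol3 p : ℝ) ^ (-(73 / 48) : ℝ)
            = ∏ _j : Fin 3, (symbol3 p : ℝ) ^ (-(73 / 144) : ℝ) := by
              rw [Finset.prod_const, Finset.card_univ, Fintype.card_fin, ← Real.rpow_natCast,
                ← Real.rpow_mul (by linarith)]
              norm_num
          _ ≤ _ := Finset.prod_le_prod (fun j _ => by positivity) fun j _ =>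
              Real.rpow_le_rpow_of_nonpos (by positivity) (one_add_sq_le_symbol3 p j) (by norm_num)
    _ ≤ ∏ _j : Fin 3, ∑' a : ℤ, ENNReal.ofReal ((1 + (a : ℝ) ^ 2) ^ (-(73 / 144) : ℝ)) :=
        tsum_pi_prod_le _
    _ < ∞ := ENNReal.prod_lt_top fun j _ => h

/-- For `γ + θ = 73/48`, the sum of `(1 + |p|²)^{-γ}` over a single shell. -/
theorem tsum_inShell_le {X m : ℕ} {γ θ : ℝ} (hγθ : γ + θ = 73 / 48) (hθ : 0 ≤ θ)
    (hθ' : θ ≤ 7 / 12) :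
    ∑' p : Fin 3 → ℤ, (open Classical in
      if InShell X m p then ENNReal.ofReal ((symbol3 p : ℝ) ^ (-γ)) else 0) ≤
      ENNReal.ofReal (2000 * ((m : ℝ) ^ 2) ^ θ * (X : ℝ) ^ (-(1 / 24) : ℝ)) := by
  classical
  by_cases hm : 1 ≤ m ∧ m < X
  · obtain ⟨hm, hmX⟩ := hm
    have hm1 : (1 : ℝ) ≤ m := by exact_mod_cast hm
    have hmX' : (m : ℝ) ≤ X := by exact_mod_cast hmX.le
    have hX1 : (1 : ℝ) ≤ X := hm1.trans hmX'
    have hX0 : (0 : ℝ) < X := by linarith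
    have hm0 : (0 : ℝ) < m := by linarith
    have hterm : ∀ p : Fin 3 → ℤ, InShell X m p →
        (symbol3 p : ℝ) ^ (-γ) ≤ 4 * (X : ℝ) ^ (-(2 * γ)) := by
      rintro p ⟨h₁, h₂, h₃⟩
      have h₄ : (X : ℤ) ^ 2 ≤ 2 * symbol3 p := by
        unfold symbol3
        linarith
      have h₅ : (X : ℝ) ^ 2 / 2 ≤ symbol3 p := by
        have : (X : ℝ) ^ 2 ≤ 2 * symbol3 p := by exact_mod_cast h₄
        linarith
      calc (symbol3 p : ℝ) ^ (-γ) ≤ ((X : ℝ) ^ 2 / 2) ^ (-γ) :=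
            Real.rpow_le_rpow_of_nonpos (by positivity) h₅ (by linarith)
        _ = 2 ^ γ * (X : ℝ) ^ (-(2 * γ)) := by
            rw [Real.div_rpow (by positivity) (by norm_num), Real.rpow_neg (by norm_num : (0:ℝ) ≤ 2),
              div_inv_eq_mul, ← Real.rpow_natCast, ← Real.rpow_mul hX0.le, mul_comm]
            congr 2
            push_cast
            ring
        _ ≤ 2 ^ (2 : ℝ) * (X : ℝ) ^ (-(2 * γ)) := by
            gcongr
            · norm_num
            · linarith
        _ = _ := by norm_num
    have hreal : 250 * (X * (m : ℝ) ^ 2 + m * (X : ℝ) ^ (11 / 6 : ℝ)) *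
        (4 * (X : ℝ) ^ (-(2 * γ))) ≤ 2000 * ((m : ℝ) ^ 2) ^ θ * (X : ℝ) ^ (-(1 / 24) : ℝ) := by
      have hsq : ((m : ℝ) ^ 2) ^ θ = (m : ℝ) ^ (2 * θ) := by
        rw [← Real.rpow_natCast, ← Real.rpow_mul hm0.le]
        norm_num
      have t₁ : X * (m : ℝ) ^ 2 * (X : ℝ) ^ (-(2 * γ)) ≤
          (m : ℝ) ^ (2 * θ) * (X : ℝ) ^ (-(1 / 24) : ℝ) := by
        calc X * (m : ℝ) ^ 2 * (X : ℝ) ^ (-(2 * γ))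
            = (m : ℝ) ^ (2 * θ) * ((m : ℝ) ^ (2 - 2 * θ) * (X : ℝ) ^ (1 - 2 * γ)) := by
              rw [← mul_assoc, ← Real.rpow_add hm0, sub_eq_add_neg 1, Real.rpow_add hX0,
                Real.rpow_one]
              rw [show 2 * θ + (2 - 2 * θ) = (2 : ℕ) by push_cast; ring, Real.rpow_natCast]
              ring
          _ ≤ (m : ℝ) ^ (2 * θ) * ((X : ℝ) ^ (2 - 2 * θ) * (X : ℝ) ^ (1 - 2 * γ)) := by
              gcongr
              linarith
          _ = _ := by
              rw [← Real.rpow_add hX0]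
              congr 2
              linarith
      have t₂ : m * (X : ℝ) ^ (11 / 6 : ℝ) * (X : ℝ) ^ (-(2 * γ)) ≤
          (m : ℝ) ^ (2 * θ) * (X : ℝ) ^ (-(1 / 24) : ℝ) := by
        rw [mul_assoc, ← Real.rpow_add hX0]
        rcases le_total (2 * θ) 1 with h | h
        · calc (m : ℝ) * (X : ℝ) ^ (11 / 6 + -(2 * γ))
              = (m : ℝ) ^ (2 * θ) * ((m : ℝ) ^ (1 - 2 * θ) * (X : ℝ) ^ (11 / 6 + -(2 * γ))) := by
                rw [← mul_assoc, ← Real.rpow_add hm0]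
                norm_num
            _ ≤ (m : ℝ) ^ (2 * θ) * ((X : ℝ) ^ (1 - 2 * θ) * (X : ℝ) ^ (11 / 6 + -(2 * γ))) := by
                gcongr
            _ ≤ _ := by
                rw [← Real.rpow_add hX0]
                gcongr
                linarith
        · gcongr
          · calc (m : ℝ) = (m : ℝ) ^ (1 : ℝ) := (Real.rpow_one _).symm
              _ ≤ _ := Real.rpow_le_rpow_of_exponent_le hm1 h
          linarith
      rw [hsq]
      linarith
    rw [ENNReal.tsum_eq_iSup_sum]
    refine iSup_le fun S => ?_
    rw [← Finset.sum_filter, ← ENNReal.ofReal_sum_of_nonneg (fun p _ => Real.rpow_nonneg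
      (by linarith [one_le_cast_symbol3 p]) _)]
    refine ENNReal.ofReal_le_ofReal (le_trans ?_ hreal)
    refine (Finset.sum_le_card_nsmul _ _ (4 * (X : ℝ) ^ (-(2 * γ)))
      fun p hp => hterm p (Finset.mem_filter.1 hp).2).trans ?_
    rw [nsmul_eq_mul]
    gcongr
    exact card_shell_le hm hmX _ fun p hp => (Finset.mem_filter.1 hp).2
  · -- the shell is empty
    have hempty : ∀ p : Fin 3 → ℤ, ¬ InShell X m p := by
      rintro p ⟨h₁, h₂, h₃⟩
      refine hm ⟨?_, ?_⟩
      · by_contra h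
        have : m = 0 := by omega
        subst this
        simp at h₃
        linarith
      · have : (m : ℤ) ^ 2 < (X : ℤ) ^ 2 := by linarith
        exact_mod_cast lt_of_pow_lt_pow_left₀ 2 (by positivity) this
    simp [hempty]

open Classical in
/-- The gain which comes from the subtraction at `m = 0` of a function of `1 + |p|² + m²` cut to a
slice: a factor `min(1, m²/(1 + |p|²))`, unless the boundary of a slice separates `1 + |p|²` from
`1 + |p|² + m²`. -/
noncomputable def gain (M : ℕ) (m : ℤ) (p : Fin 3 → ℤ) : ℝ :=
  min 1 ((m : ℝ) ^ 2 / symbol3 p) +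
    if ∃ i : ℕ, symbol3 p ≤ (M : ℤ) ^ (2 * i) ∧ (M : ℤ) ^ (2 * i) < symbol3 p + m ^ 2 then 1 else 0

theorem gain_nonneg (M : ℕ) (m : ℤ) (p : Fin 3 → ℤ) : 0 ≤ gain M m p := by
  have := one_le_cast_symbol3 p
  unfold gain
  split_ifs <;> positivity

/-- Power counting of a subtracted tadpole. Where no slice boundary intervenes, `min(1, x) ≤ x^θ`
makes the sum converge; the points near a slice boundary are few. -/
theorem exists_tsum_gain_le {γ θ : ℝ} (hγθ : γ + θ = 73 / 48) (hθ : 0 ≤ θ) (hθ' : θ ≤ 7 / 12) :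
    ∃ K : ℝ, 0 < K ∧ ∀ M : ℕ, 1 < M → ∀ m : ℤ,
      ∑' p : Fin 3 → ℤ, ENNReal.ofReal ((symbol3 p : ℝ) ^ (-γ) * gain M m p) ≤
        ENNReal.ofReal (K * ((m : ℝ) ^ 2) ^ θ) := by
  classical
  set S := ∑' p : Fin 3 → ℤ, ENNReal.ofReal ((symbol3 p : ℝ) ^ (-(73 / 48) : ℝ)) with hS
  have hStop : S ≠ ∞ := tsum_symbol3_rpow_lt_top.ne
  set r : ℝ := 2 ^ (-(1 / 24) : ℝ) with hr
  have hr0 : 0 < r := by positivity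
  have hr1 : r < 1 := Real.rpow_lt_one_of_one_lt_of_neg (by norm_num) (by norm_num)
  refine ⟨2 * S.toReal + 2000 * (1 - r)⁻¹, by
    have : 0 < 1 - r := by linarith
    positivity, fun M hM m => ?_⟩
  have hgain : ∀ p : Fin 3 → ℤ, ENNReal.ofReal ((symbol3 p : ℝ) ^ (-γ) * gain M m p) ≤
      ENNReal.ofReal (2 * ((m : ℝ) ^ 2) ^ θ) * ENNReal.ofReal ((symbol3 p : ℝ) ^ (-(73 / 48) : ℝ)) +
      ∑' i : ℕ, if InShell (M ^ i) m.natAbs p then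
        ENNReal.ofReal ((symbol3 p : ℝ) ^ (-γ)) else 0 := by
    intro p
    have hs := one_le_cast_symbol3 p
    have hs0 : (0 : ℝ) < symbol3 p := by linarith
    have hsplit : (symbol3 p : ℝ) ^ (-γ) * ((m : ℝ) ^ 2 / symbol3 p) ^ θ =
        ((m : ℝ) ^ 2) ^ θ * (symbol3 p : ℝ) ^ (-(73 / 48) : ℝ) := by
      rw [Real.div_rpow (by positivity) hs0.le, div_eq_mul_inv, ← Real.rpow_neg hs0.le,
        mul_left_comm, ← Real.rpow_add hs0]
      congr 2
      linarith
    have hmin : min 1 ((m : ℝ) ^ 2 / symbol3 p) ≤ ((m : ℝ) ^ 2 / symbol3 p) ^ θ := by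
      have hx : 0 ≤ (m : ℝ) ^ 2 / symbol3 p := by positivity
      rcases le_total 1 ((m : ℝ) ^ 2 / symbol3 p) with h | h
      · exact (min_le_left _ _).trans (Real.one_le_rpow h hθ)
      · refine (min_le_right _ _).trans ?_
        calc (m : ℝ) ^ 2 / symbol3 p = ((m : ℝ) ^ 2 / symbol3 p) ^ (1 : ℝ) :=
              (Real.rpow_one _).symm
          _ ≤ _ := Real.rpow_le_rpow_of_exponent_ge' hx h hθ (by linarith)
    by_cases hshell : ∃ i : ℕ, InShell (M ^ i) m.natAbs p
    · obtain ⟨i, hi⟩ := hshell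
      have hle : gain M m p ≤ 2 * ((m : ℝ) ^ 2 / symbol3 p) ^ θ + 1 := by
        have h0 : 0 ≤ ((m : ℝ) ^ 2 / symbol3 p) ^ θ := by positivity
        unfold gain
        split_ifs <;> linarith
      calc ENNReal.ofReal ((symbol3 p : ℝ) ^ (-γ) * gain M m p)
          ≤ ENNReal.ofReal (2 * ((m : ℝ) ^ 2) ^ θ * (symbol3 p : ℝ) ^ (-(73 / 48) : ℝ) +
              (symbol3 p : ℝ) ^ (-γ)) := by
            refine ENNReal.ofReal_le_ofReal ?_
            calc (symbol3 p : ℝ) ^ (-γ) * gain M m p ≤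
                (symbol3 p : ℝ) ^ (-γ) * (2 * ((m : ℝ) ^ 2 / symbol3 p) ^ θ + 1) := by gcongr
              _ = 2 * ((symbol3 p : ℝ) ^ (-γ) * ((m : ℝ) ^ 2 / symbol3 p) ^ θ) +
                  (symbol3 p : ℝ) ^ (-γ) := by ring
              _ = _ := by rw [hsplit]; ring
        _ = ENNReal.ofReal (2 * ((m : ℝ) ^ 2) ^ θ) *
              ENNReal.ofReal ((symbol3 p : ℝ) ^ (-(73 / 48) : ℝ)) +
              ENNReal.ofReal ((symbol3 p : ℝ) ^ (-γ)) := by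
            rw [ENNReal.ofReal_add (by positivity) (by positivity),
              ENNReal.ofReal_mul (by positivity)]
        _ ≤ _ := by
            gcongr
            refine le_trans ?_ (ENNReal.le_tsum i)
            rw [if_pos hi]
    · have hle : gain M m p ≤ 2 * ((m : ℝ) ^ 2 / symbol3 p) ^ θ := by
        have h0 : 0 ≤ ((m : ℝ) ^ 2 / symbol3 p) ^ θ := by positivity
        unfold gain
        split_ifs with h
        · obtain ⟨i, h₁, h₂⟩ := h
          have h₃ : symbol3 p ≤ m ^ 2 := by
            by_contra! h₃
            refine hshell ⟨i, ?_, ?_, ?_⟩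
            · rw [Int.natAbs_sq]; exact h₃
            · push_cast; rw [← pow_mul, mul_comm]; exact h₁
            · push_cast; rw [← pow_mul, mul_comm, sq_abs]; exact h₂
          have h₄ : (symbol3 p : ℝ) ≤ (m : ℝ) ^ 2 := by exact_mod_cast h₃
          have : 1 ≤ ((m : ℝ) ^ 2 / symbol3 p) ^ θ :=
            Real.one_le_rpow ((one_le_div hs0).2 h₄) hθ
          linarith
        · linarith
      refine le_trans ?_ le_self_add
      rw [← ENNReal.ofReal_mul (by positivity)]
      refine ENNReal.ofReal_le_ofReal ?_
      calc (symbol3 p : ℝ) ^ (-γ) * gain M m p ≤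
          (symbol3 p : ℝ) ^ (-γ) * (2 * ((m : ℝ) ^ 2 / symbol3 p) ^ θ) := by gcongr
        _ = 2 * ((symbol3 p : ℝ) ^ (-γ) * ((m : ℝ) ^ 2 / symbol3 p) ^ θ) := by ring
        _ = _ := by rw [hsplit]; ring
  have hgeom : ∑' i : ℕ, ENNReal.ofReal (2000 * ((m : ℝ) ^ 2) ^ θ * r ^ i) =
      ENNReal.ofReal (2000 * ((m : ℝ) ^ 2) ^ θ * (1 - r)⁻¹) := by
    rw [← ENNReal.ofReal_tsum_of_nonneg (fun i => by positivity)
      ((summable_geometric_of_lt_one hr0.le hr1).mul_left _), tsum_mul_left,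
      tsum_geometric_of_lt_one hr0.le hr1]
  calc ∑' p : Fin 3 → ℤ, ENNReal.ofReal ((symbol3 p : ℝ) ^ (-γ) * gain M m p)
      ≤ ∑' p : Fin 3 → ℤ, (ENNReal.ofReal (2 * ((m : ℝ) ^ 2) ^ θ) *
          ENNReal.ofReal ((symbol3 p : ℝ) ^ (-(73 / 48) : ℝ)) +
          ∑' i : ℕ, if InShell (M ^ i) m.natAbs p then
            ENNReal.ofReal ((symbol3 p : ℝ) ^ (-γ)) else 0) := ENNReal.tsum_le_tsum hgain
    _ = ENNReal.ofReal (2 * ((m : ℝ) ^ 2) ^ θ) * S + ∑' i : ℕ, ∑' p : Fin 3 → ℤ,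
          if InShell (M ^ i) m.natAbs p then ENNReal.ofReal ((symbol3 p : ℝ) ^ (-γ)) else 0 := by
        rw [ENNReal.tsum_add, ENNReal.tsum_mul_left, ENNReal.tsum_comm]
    _ ≤ ENNReal.ofReal (2 * ((m : ℝ) ^ 2) ^ θ) * S +
          ∑' i : ℕ, ENNReal.ofReal (2000 * ((m : ℝ) ^ 2) ^ θ * r ^ i) := by
        gcongr with i
        refine (tsum_inShell_le hγθ hθ hθ').trans (ENNReal.ofReal_le_ofReal ?_)
        have hcast : ((m.natAbs : ℕ) : ℝ) ^ 2 = (m : ℝ) ^ 2 := by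
          rw [Nat.cast_natAbs, Int.cast_abs, sq_abs]
        rw [hcast]
        gcongr
        have h2M : (2 : ℝ) ≤ M := by exact_mod_cast hM
        push_cast
        rw [hr, ← Real.rpow_natCast, ← Real.rpow_natCast, ← Real.rpow_mul (by positivity),
          ← Real.rpow_mul (by norm_num), mul_comm, Real.rpow_mul (by positivity),
          Real.rpow_mul (by norm_num)]
        exact Real.rpow_le_rpow (by positivity)
          (Real.rpow_le_rpow_of_nonpos (by norm_num) h2M (by norm_num)) (by positivity)
    _ = _ := by
        rw [hgeom]
        nth_rewrite 1 [← ENNReal.ofReal_toReal hStop]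
        have : 0 ≤ (1 - r)⁻¹ := inv_nonneg.2 (by linarith)
        rw [← ENNReal.ofReal_mul (by positivity), ← ENNReal.ofReal_add (by positivity)
          (by positivity)]
        congr 1
        ring

/-! ### Propagators cut to the slices -/

theorem one_le_symbol (n : Fin 4 → ℤ) : 1 ≤ symbol n := by
  have : 0 ≤ ∑ j, n j ^ 2 := Finset.sum_nonneg fun j _ => sq_nonneg _
  unfold symbol
  linarith

theorem one_add_sq_le_symbol (n : Fin 4 → ℤ) (k : Fin 4) :
    1 + (n k : ℝ) ^ 2 ≤ symbol n := by
  have : n k ^ 2 ≤ ∑ j, n j ^ 2 :=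
    Finset.single_le_sum (f := fun j => n j ^ 2) (fun i _ => sq_nonneg _) (Finset.mem_univ k)
  have h : 1 + n k ^ 2 ≤ symbol n := by
    unfold symbol
    linarith
  exact_mod_cast h

theorem symbol_insertNth (c : Fin 4) (m : ℤ) (p : Fin 3 → ℤ) :
    symbol (c.insertNth (α := fun _ => ℤ) m p) = symbol3 p + m ^ 2 := by
  unfold symbol symbol3
  rw [Fin.sum_univ_succAbove _ c]
  simp only [Fin.insertNth_apply_same, Fin.insertNth_apply_succAbove]
  ring

/-- `j` is the slice of the integer `s`. -/
def IsSlice (M : ℕ) (j : ℕ+) (s : ℤ) : Prop :=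
  s ≤ (M : ℤ) ^ (2 * (j : ℕ)) ∧ (j ≠ 1 → (M : ℤ) ^ (2 * ((j : ℕ) - 1)) < s)

/-- The sliced propagator as a function of `s = 1 + ‖n‖²`. -/
noncomputable def sliceValue (M : ℕ) (i : ℕ+) (s : ℤ) : ℝ :=
  open Classical in
  if IsSlice M i s then (s : ℝ)⁻¹ else 0

theorem slicePropagator_eq_sliceValue (M : ℕ) (i : ℕ+) (n : Fin 4 → ℤ) :
    slicePropagator M i n = sliceValue M i (symbol n) := rfl

theorem sliceValue_nonneg (M : ℕ) (i : ℕ+) {s : ℤ} (hs : 1 ≤ s) : 0 ≤ sliceValue M i s := by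
  unfold sliceValue
  split_ifs
  · have : (1 : ℝ) ≤ s := by exact_mod_cast hs
    positivity
  · exact le_rfl

theorem slicePropagator_nonneg (M : ℕ) (i : ℕ+) (n : Fin 4 → ℤ) : 0 ≤ slicePropagator M i n :=
  sliceValue_nonneg M i (one_le_symbol n)

/-- The weight `M^{i/24}` of a line of scale `i`. -/
noncomputable def scaleWeight (M : ℕ) (i : ℕ+) : ℝ := (M : ℝ) ^ (((i : ℕ) : ℝ) / 24)

theorem scaleWeight_nonneg (M : ℕ) (i : ℕ+) : 0 ≤ scaleWeight M i := by
  unfold scaleWeight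
  positivity

theorem exists_isSlice {M : ℕ} (hM : 1 < M) (s : ℤ) : ∃ j, IsSlice M j s := by
  classical
  have hex : ∃ k : ℕ, s ≤ (M : ℤ) ^ (2 * (k + 1)) := by
    obtain ⟨k, hk⟩ := pow_unbounded_of_one_lt s (by exact_mod_cast hM : (1 : ℤ) < M)
    refine ⟨k, hk.le.trans ?_⟩
    exact pow_le_pow_right₀ (by exact_mod_cast hM.le) (by omega)
  refine ⟨(Nat.find hex).succPNat, Nat.find_spec hex, fun hne => ?_⟩
  have h0 : Nat.find hex ≠ 0 := by
    intro h
    apply hne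
    rw [h]
    rfl
  have := Nat.find_min hex (m := Nat.find hex - 1) (by omega)
  rw [not_le, Nat.sub_add_cancel (by omega)] at this
  exact this

theorem IsSlice.unique {M : ℕ} (hM : 1 < M) {i j : ℕ+} {s : ℤ} (hi : IsSlice M i s)
    (hj : IsSlice M j s) : i = j := by
  have key : ∀ {i j : ℕ+}, IsSlice M i s → IsSlice M j s → ¬ i < j := by
    intro i j hi hj hlt
    have hj1 : j ≠ 1 := by
      rintro rfl
      exact absurd hlt (not_lt_one)
    have h₁ := hj.2 hj1
    have h₂ := hi.1
    have hlt' : (i : ℕ) < j := hlt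
    have : (M : ℤ) ^ (2 * (i : ℕ)) ≤ (M : ℤ) ^ (2 * ((j : ℕ) - 1)) :=
      pow_le_pow_right₀ (by exact_mod_cast hM.le) (by omega)
    linarith
  exact le_antisymm (not_lt.1 (key hj hi)) (not_lt.1 (key hi hj))

theorem IsSlice.sliceValue_eq {M : ℕ} (hM : 1 < M) {j : ℕ+} {s : ℤ} (hj : IsSlice M j s) (i : ℕ+) :
    sliceValue M i s = if i = j then (s : ℝ)⁻¹ else 0 := by
  unfold sliceValue
  split_ifs with h₁ h₂ h₂
  · rfl
  · exact absurd (IsSlice.unique hM h₁ hj) h₂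
  · exact absurd (h₂ ▸ hj) h₁
  · rfl

/-- If two integers lie in different slices, a slice boundary separates them. -/
theorem IsSlice.exists_between {M : ℕ} (hM : 1 < M) {i j : ℕ+} {s t : ℤ} (hst : s ≤ t)
    (hi : IsSlice M i s) (hj : IsSlice M j t) (hij : i ≠ j) :
    ∃ k : ℕ, s ≤ (M : ℤ) ^ (2 * k) ∧ (M : ℤ) ^ (2 * k) < t := by
  refine ⟨i, hi.1, ?_⟩
  by_contra! h
  exact hij (IsSlice.unique hM ⟨h, fun h1 => (hi.2 h1).trans_le hst⟩ hj)

/-- In the slice `j`, `M^{2(j-1)} ≤ s`, so the weight `M^{j/24}` is at most `M s^{1/48}`. -/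
theorem IsSlice.scaleWeight_le {M : ℕ} (hM : 1 < M) {j : ℕ+} {s : ℤ} (hs : 1 ≤ s)
    (hj : IsSlice M j s) : scaleWeight M j ≤ M * (s : ℝ) ^ (1 / 48 : ℝ) := by
  have hM1 : (1 : ℝ) ≤ M := by exact_mod_cast hM.le
  have hs1 : (1 : ℝ) ≤ s := by exact_mod_cast hs
  have hpow : (M : ℝ) ^ (j : ℕ) ≤ M * (s : ℝ) ^ (1 / 2 : ℝ) := by
    by_cases h1 : j = 1
    · subst h1
      simp only [PNat.one_coe, pow_one]
      exact le_mul_of_one_le_right (by linarith) (Real.one_le_rpow hs1 (by norm_num))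
    · have h₂ : (M : ℝ) ^ (2 * ((j : ℕ) - 1)) ≤ s := by exact_mod_cast (hj.2 h1).le
      have h₃ : (M : ℝ) ^ ((j : ℕ) - 1) ≤ (s : ℝ) ^ (1 / 2 : ℝ) := by
        rw [← Real.sqrt_eq_rpow]
        refine Real.le_sqrt_of_sq_le ?_
        rwa [← pow_mul, mul_comm]
      calc (M : ℝ) ^ (j : ℕ) = M * (M : ℝ) ^ ((j : ℕ) - 1) := by
            rw [← pow_succ', Nat.sub_add_cancel j.pos]
        _ ≤ _ := by gcongr
  calc scaleWeight M j = ((M : ℝ) ^ (j : ℕ)) ^ (1 / 24 : ℝ) := by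
        unfold scaleWeight
        rw [← Real.rpow_natCast, ← Real.rpow_mul (by linarith)]
        congr 1
        ring
    _ ≤ (M * (s : ℝ) ^ (1 / 2 : ℝ)) ^ (1 / 24 : ℝ) := by gcongr
    _ = (M : ℝ) ^ (1 / 24 : ℝ) * (s : ℝ) ^ (1 / 48 : ℝ) := by
        rw [Real.mul_rpow (by linarith) (by positivity), ← Real.rpow_mul (by linarith)]
        norm_num
    _ ≤ (M : ℝ) ^ (1 : ℝ) * (s : ℝ) ^ (1 / 48 : ℝ) := by
        gcongr
        norm_num
    _ = _ := by rw [Real.rpow_one]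

theorem IsSlice.scaleWeight_mul_inv_le {M : ℕ} (hM : 1 < M) {j : ℕ+} {s : ℤ} (hs : 1 ≤ s)
    (hj : IsSlice M j s) : scaleWeight M j * (s : ℝ)⁻¹ ≤ M * (s : ℝ) ^ (-(47 / 48) : ℝ) := by
  have hs0 : (0 : ℝ) < s := by exact_mod_cast (by linarith : 0 < s)
  calc scaleWeight M j * (s : ℝ)⁻¹ ≤ M * (s : ℝ) ^ (1 / 48 : ℝ) * (s : ℝ)⁻¹ := by
        gcongr
        exact hj.scaleWeight_le hM hs
    _ = _ := by
        rw [← Real.rpow_neg_one, mul_assoc, ← Real.rpow_add hs0]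
        norm_num

/-- Summing over the scale of a line turns the weights `M^{i/24}` into a small loss of decrease of
the propagator. -/
theorem tsum_scaleWeight_mul_sliceValue_le {M : ℕ} (hM : 1 < M) {s : ℤ} (hs : 1 ≤ s) :
    ∑' i : ℕ+, ENNReal.ofReal (scaleWeight M i * sliceValue M i s) ≤
      ENNReal.ofReal (M * (s : ℝ) ^ (-(47 / 48) : ℝ)) := by
  obtain ⟨j, hj⟩ := exists_isSlice hM s
  rw [tsum_eq_single j (fun i hi => by rw [hj.sliceValue_eq hM, if_neg hi]; simp),
    hj.sliceValue_eq hM, if_pos rfl]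
  exact ENNReal.ofReal_le_ofReal (hj.scaleWeight_mul_inv_le hM hs)

theorem inv_sub_inv_le {s m : ℝ} (hs : 1 ≤ s) :
    s⁻¹ - (s + m ^ 2)⁻¹ ≤ s⁻¹ * min 1 (m ^ 2 / s) := by
  have hm := sq_nonneg m
  have hs0 : 0 < s := by linarith
  have hsm : 0 < s + m ^ 2 := by linarith
  rw [mul_min_of_nonneg _ _ (by positivity), le_min_iff]
  constructor
  · have : 0 < (s + m ^ 2)⁻¹ := by positivity
    linarith
  · rw [inv_sub_inv hs0.ne' hsm.ne', inv_mul_eq_div, div_div]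
    refine div_le_div₀ hm (by linarith) (by positivity) ?_
    nlinarith

/-- Without any cancellation, a subtracted propagator is bounded by the sum of its two terms; the
term with the smaller argument `s` dominates. -/
theorem tsum_scaleWeight_mul_le_of_le_add {M : ℕ} (hM : 1 < M) {s t : ℤ} (hs : 1 ≤ s) (hst : s ≤ t)
    (f : ℕ+ → ℝ) (hf : ∀ i, f i ≤ sliceValue M i t + sliceValue M i s) :
    ∑' i : ℕ+, ENNReal.ofReal (scaleWeight M i * f i) ≤
      ENNReal.ofReal (2 * M * (s : ℝ) ^ (-(47 / 48) : ℝ)) := by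
  have hs0 : (0 : ℝ) < s := by exact_mod_cast (by linarith : 0 < s)
  have hst' : (s : ℝ) ≤ t := by exact_mod_cast hst
  have ht0 : (0 : ℝ) < t := hs0.trans_le hst'
  calc ∑' i : ℕ+, ENNReal.ofReal (scaleWeight M i * f i)
      ≤ ∑' i : ℕ+, (ENNReal.ofReal (scaleWeight M i * sliceValue M i t) +
          ENNReal.ofReal (scaleWeight M i * sliceValue M i s)) := by
        refine ENNReal.tsum_le_tsum fun i => ?_
        have h := scaleWeight_nonneg M i
        rw [← ENNReal.ofReal_add (mul_nonneg h (sliceValue_nonneg M i (hs.trans hst)))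
          (mul_nonneg h (sliceValue_nonneg M i hs)), ← mul_add]
        exact ENNReal.ofReal_le_ofReal (mul_le_mul_of_nonneg_left (hf i) h)
    _ ≤ ENNReal.ofReal (M * (t : ℝ) ^ (-(47 / 48) : ℝ)) +
          ENNReal.ofReal (M * (s : ℝ) ^ (-(47 / 48) : ℝ)) := by
        rw [ENNReal.tsum_add]
        exact add_le_add (tsum_scaleWeight_mul_sliceValue_le hM (hs.trans hst))
          (tsum_scaleWeight_mul_sliceValue_le hM hs)
    _ ≤ _ := by
        rw [← ENNReal.ofReal_add (by positivity) (by positivity)]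
        refine ENNReal.ofReal_le_ofReal ?_
        have : (M : ℝ) * (t : ℝ) ^ (-(47 / 48) : ℝ) ≤ M * (s : ℝ) ^ (-(47 / 48) : ℝ) := by
          gcongr ?_ * ?_
          exact Real.rpow_le_rpow_of_nonpos hs0 hst' (by norm_num)
        linarith

/-- The subtraction gains where both arguments lie in the same slice. -/
theorem min_le_gain (M : ℕ) (m : ℤ) (p : Fin 3 → ℤ) :
    min 1 ((m : ℝ) ^ 2 / symbol3 p) ≤ gain M m p := by
  unfold gain
  split_ifs <;> linarith

/-- There is no gain where a slice boundary separates the two arguments. -/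
theorem one_le_gain {M : ℕ} {m : ℤ} {p : Fin 3 → ℤ}
    (h : ∃ i : ℕ, symbol3 p ≤ (M : ℤ) ^ (2 * i) ∧ (M : ℤ) ^ (2 * i) < symbol3 p + m ^ 2) :
    1 ≤ gain M m p := by
  have := one_le_cast_symbol3 p
  have h0 : 0 ≤ min 1 ((m : ℝ) ^ 2 / symbol3 p) := by positivity
  unfold gain
  rw [if_pos h]
  linarith

/-- The sum over the scale of a subtracted tadpole line. -/
theorem tsum_scaleWeight_mul_abs_sub_le {M : ℕ} (hM : 1 < M) (m : ℤ) (p : Fin 3 → ℤ) :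
    ∑' i : ℕ+, ENNReal.ofReal (scaleWeight M i *
        |sliceValue M i (symbol3 p + m ^ 2) - sliceValue M i (symbol3 p)|) ≤
      ENNReal.ofReal (2 * M * ((symbol3 p : ℝ) ^ (-(47 / 48) : ℝ) * gain M m p)) := by
  have hs := one_le_symbol3 p
  have hs1 := one_le_cast_symbol3 p
  have hst : symbol3 p ≤ symbol3 p + m ^ 2 := by linarith [sq_nonneg m]
  obtain ⟨i, hi⟩ := exists_isSlice hM (symbol3 p)
  obtain ⟨j, hj⟩ := exists_isSlice hM (symbol3 p + m ^ 2)
  by_cases hij : i = j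
  · subst hij
    rw [tsum_eq_single i (fun k hk => by
      rw [hi.sliceValue_eq hM, hj.sliceValue_eq hM, if_neg hk, if_neg hk]; simp),
      hi.sliceValue_eq hM, hj.sliceValue_eq hM, if_pos rfl, if_pos rfl]
    refine ENNReal.ofReal_le_ofReal ?_
    push_cast
    have hanti : ((symbol3 p : ℝ) + (m : ℝ) ^ 2)⁻¹ ≤ (symbol3 p : ℝ)⁻¹ := by
      gcongr
      linarith [sq_nonneg (m : ℝ)]
    rw [abs_sub_comm, abs_of_nonneg (by linarith)]
    have h0 : 0 ≤ min 1 ((m : ℝ) ^ 2 / symbol3 p) := by positivity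
    calc scaleWeight M i * ((symbol3 p : ℝ)⁻¹ - ((symbol3 p : ℝ) + (m : ℝ) ^ 2)⁻¹)
        ≤ scaleWeight M i * ((symbol3 p : ℝ)⁻¹ * min 1 ((m : ℝ) ^ 2 / symbol3 p)) := by
          gcongr
          · exact scaleWeight_nonneg M i
          · exact inv_sub_inv_le hs1
      _ = (scaleWeight M i * (symbol3 p : ℝ)⁻¹) * min 1 ((m : ℝ) ^ 2 / symbol3 p) := by ring
      _ ≤ (M * (symbol3 p : ℝ) ^ (-(47 / 48) : ℝ)) * gain M m p := by
          exact mul_le_mul (hi.scaleWeight_mul_inv_le hM hs) (min_le_gain M m p) h0 (by positivity)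
      _ ≤ _ := by
          have : 0 ≤ (M * (symbol3 p : ℝ) ^ (-(47 / 48) : ℝ)) * gain M m p :=
            mul_nonneg (by positivity) (gain_nonneg M m p)
          linarith
  · have hg := one_le_gain (hi.exists_between hM hst hj hij)
    refine (tsum_scaleWeight_mul_le_of_le_add hM hs hst _ fun k => ?_).trans
      (ENNReal.ofReal_le_ofReal ?_)
    · have h₁ := sliceValue_nonneg M k hs
      have h₂ := sliceValue_nonneg M k (hs.trans hst)
      rw [abs_le]
      constructor <;> linarith
    · rw [← mul_assoc]
      exact le_mul_of_one_le_right (by positivity) hg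

/-- The square root of the difference of the squares, which is the share of each of the two lines
outside the inner tadpole in the subtracted graph `M₂`. -/
noncomputable def sliceRoot (M : ℕ) (i : ℕ+) (s t : ℤ) : ℝ :=
  √|sliceValue M i t ^ 2 - sliceValue M i s ^ 2|

theorem sliceRoot_nonneg (M : ℕ) (i : ℕ+) (s t : ℤ) : 0 ≤ sliceRoot M i s t := Real.sqrt_nonneg _

/-- The two lines carry the same indices, so they lie in the same slice. -/
theorem abs_mul_sub_mul_le_sliceRoot {M : ℕ} (hM : 1 < M) (i j : ℕ+) (s t : ℤ) :
    |sliceValue M i t * sliceValue M j t - sliceValue M i s * sliceValue M j s| ≤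
      sliceRoot M i s t * sliceRoot M j s t := by
  by_cases hij : i = j
  · subst hij
    unfold sliceRoot
    rw [Real.mul_self_sqrt (abs_nonneg _), sq, sq]
  · have h : ∀ u : ℤ, sliceValue M i u * sliceValue M j u = 0 := by
      intro u
      obtain ⟨k, hk⟩ := exists_isSlice hM u
      rw [hk.sliceValue_eq hM, hk.sliceValue_eq hM]
      split_ifs with h₁ h₂
      · exact absurd (h₁.trans h₂.symm) hij
      all_goals simp
    rw [h, h]
    simpa using mul_nonneg (sliceRoot_nonneg M i s t) (sliceRoot_nonneg M j s t)

/-- The sum over the scales of the two outer lines of a graph `M₂` whose vertices have different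
colours: there are two propagators, but the subtraction gains only once. -/
theorem sq_tsum_scaleWeight_mul_sliceRoot_le {M : ℕ} (hM : 1 < M) (m : ℤ) (p : Fin 3 → ℤ) :
    (∑' i : ℕ+, ENNReal.ofReal (scaleWeight M i *
        sliceRoot M i (symbol3 p) (symbol3 p + m ^ 2))) ^ 2 ≤
      ENNReal.ofReal (4 * (M : ℝ) ^ 2 * ((symbol3 p : ℝ) ^ (-(47 / 24) : ℝ) * gain M m p)) := by
  have hs := one_le_symbol3 p
  have hs1 := one_le_cast_symbol3 p
  have hs0 : (0 : ℝ) < symbol3 p := by linarith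
  have hst : symbol3 p ≤ symbol3 p + m ^ 2 := by linarith [sq_nonneg m]
  have hpow : ((symbol3 p : ℝ) ^ (-(47 / 48) : ℝ)) ^ 2 = (symbol3 p : ℝ) ^ (-(47 / 24) : ℝ) := by
    rw [← Real.rpow_natCast, ← Real.rpow_mul hs0.le]
    norm_num
  obtain ⟨i, hi⟩ := exists_isSlice hM (symbol3 p)
  obtain ⟨j, hj⟩ := exists_isSlice hM (symbol3 p + m ^ 2)
  by_cases hij : i = j
  · subst hij
    unfold sliceRoot
    rw [tsum_eq_single i (fun k hk => by
      rw [hi.sliceValue_eq hM, hj.sliceValue_eq hM, if_neg hk, if_neg hk]; simp),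
      hi.sliceValue_eq hM, hj.sliceValue_eq hM, if_pos rfl, if_pos rfl,
      ← ENNReal.ofReal_pow (mul_nonneg (scaleWeight_nonneg M i) (Real.sqrt_nonneg _))]
    refine ENNReal.ofReal_le_ofReal ?_
    push_cast
    have hanti : ((symbol3 p : ℝ) + (m : ℝ) ^ 2)⁻¹ ≤ (symbol3 p : ℝ)⁻¹ := by
      gcongr
      linarith [sq_nonneg (m : ℝ)]
    have hpos : 0 < ((symbol3 p : ℝ) + (m : ℝ) ^ 2)⁻¹ := by positivity
    have hdiff := inv_sub_inv_le (m := (m : ℝ)) hs1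
    have hg := min_le_gain M m p
    have hg0 := gain_nonneg M m p
    have hw := hi.scaleWeight_mul_inv_le hM hs
    have hw0 := scaleWeight_nonneg M i
    have hsinv : 0 < (symbol3 p : ℝ)⁻¹ := by positivity
    rw [mul_pow, Real.sq_sqrt (abs_nonneg _), abs_sub_comm, abs_of_nonneg (by nlinarith),
      ← hpow]
    have hfac : (symbol3 p : ℝ)⁻¹ ^ 2 - ((symbol3 p : ℝ) + (m : ℝ) ^ 2)⁻¹ ^ 2 ≤
        2 * ((symbol3 p : ℝ)⁻¹ ^ 2 * gain M m p) := by
      calc (symbol3 p : ℝ)⁻¹ ^ 2 - ((symbol3 p : ℝ) + (m : ℝ) ^ 2)⁻¹ ^ 2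
          = ((symbol3 p : ℝ)⁻¹ - ((symbol3 p : ℝ) + (m : ℝ) ^ 2)⁻¹) *
            ((symbol3 p : ℝ)⁻¹ + ((symbol3 p : ℝ) + (m : ℝ) ^ 2)⁻¹) := by ring
        _ ≤ ((symbol3 p : ℝ)⁻¹ * gain M m p) * ((symbol3 p : ℝ)⁻¹ + (symbol3 p : ℝ)⁻¹) := by
            gcongr
            exact hdiff.trans (by gcongr)
        _ = _ := by ring
    calc scaleWeight M i ^ 2 *
          ((symbol3 p : ℝ)⁻¹ ^ 2 - ((symbol3 p : ℝ) + (m : ℝ) ^ 2)⁻¹ ^ 2)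
        ≤ scaleWeight M i ^ 2 * (2 * ((symbol3 p : ℝ)⁻¹ ^ 2 * gain M m p)) := by gcongr
      _ = 2 * ((scaleWeight M i * (symbol3 p : ℝ)⁻¹) ^ 2 * gain M m p) := by ring
      _ ≤ 2 * ((M * (symbol3 p : ℝ) ^ (-(47 / 48) : ℝ)) ^ 2 * gain M m p) := by gcongr
      _ = 2 * ((M : ℝ) ^ 2 * (((symbol3 p : ℝ) ^ (-(47 / 48) : ℝ)) ^ 2 * gain M m p)) := by ring
      _ ≤ _ := by
          have : 0 ≤ (M : ℝ) ^ 2 * (((symbol3 p : ℝ) ^ (-(47 / 48) : ℝ)) ^ 2 * gain M m p) := by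
            positivity
          linarith
  · have hg := one_le_gain (hi.exists_between hM hst hj hij)
    refine (pow_le_pow_left₀ zero_le
      (tsum_scaleWeight_mul_le_of_le_add hM hs hst _ fun k => ?_) 2).trans ?_
    · have h₁ := sliceValue_nonneg M k hs
      have h₂ := sliceValue_nonneg M k (hs.trans hst)
      refine Real.sqrt_le_iff.2 ⟨by linarith, ?_⟩
      rw [abs_le]
      constructor <;> nlinarith
    · rw [← ENNReal.ofReal_pow (by positivity)]
      refine ENNReal.ofReal_le_ofReal ?_
      rw [mul_pow, hpow, ← mul_assoc, mul_pow]
      norm_num only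
      exact le_mul_of_one_le_right (by positivity) hg

/-- A subtracted tadpole with external index `m`, summed over its scale and its three internal
faces. -/
theorem exists_tsum_tadpole_le {M : ℕ} (hM : 1 < M) : ∃ K : ℝ, 0 < K ∧ ∀ m : ℤ,
    ∑' p : Fin 3 → ℤ, ∑' i : ℕ+, ENNReal.ofReal (scaleWeight M i *
        |sliceValue M i (symbol3 p + m ^ 2) - sliceValue M i (symbol3 p)|) ≤
      ENNReal.ofReal (K * (1 + (m : ℝ) ^ 2) ^ (13 / 24 : ℝ)) := by
  obtain ⟨K, hK, h⟩ := exists_tsum_gain_le (γ := 47 / 48) (θ := 13 / 24) (by norm_num)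
    (by norm_num) (by norm_num)
  have hM0 : (0 : ℝ) < M := by exact_mod_cast (by omega : 0 < M)
  refine ⟨2 * M * K, by positivity, fun m => ?_⟩
  calc ∑' p : Fin 3 → ℤ, ∑' i : ℕ+, ENNReal.ofReal (scaleWeight M i *
        |sliceValue M i (symbol3 p + m ^ 2) - sliceValue M i (symbol3 p)|)
      ≤ ∑' p : Fin 3 → ℤ, ENNReal.ofReal (2 * M) *
          ENNReal.ofReal ((symbol3 p : ℝ) ^ (-(47 / 48) : ℝ) * gain M m p) := by
        refine ENNReal.tsum_le_tsum fun p => ?_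
        rw [← ENNReal.ofReal_mul (by positivity)]
        exact tsum_scaleWeight_mul_abs_sub_le hM m p
    _ ≤ ENNReal.ofReal (2 * M) * ENNReal.ofReal (K * ((m : ℝ) ^ 2) ^ (13 / 24 : ℝ)) := by
        rw [ENNReal.tsum_mul_left]
        gcongr
        exact h M hM m
    _ ≤ _ := by
        rw [← ENNReal.ofReal_mul (by positivity)]
        refine ENNReal.ofReal_le_ofReal ?_
        rw [mul_assoc _ K]
        gcongr
        linarith

/-- The subtracted graph `M₂` whose two vertices have different colours: its inner tadpole depends
on the index `q j` of an internal face. -/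
theorem exists_tsum_outer_ne_le {M : ℕ} (hM : 1 < M) : ∃ K : ℝ, 0 < K ∧ ∀ (m : ℤ) (j : Fin 3),
    ∑' q : Fin 3 → ℤ, ENNReal.ofReal ((1 + (q j : ℝ) ^ 2) ^ (13 / 24 : ℝ)) *
      (∑' i : ℕ+, ENNReal.ofReal (scaleWeight M i *
        sliceRoot M i (symbol3 q) (symbol3 q + m ^ 2))) ^ 2 ≤
      ENNReal.ofReal (K * (1 + (m : ℝ) ^ 2) ^ (5 / 48 : ℝ)) := by
  obtain ⟨K, hK, h⟩ := exists_tsum_gain_le (γ := 17 / 12) (θ := 5 / 48) (by norm_num)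
    (by norm_num) (by norm_num)
  have hM0 : (0 : ℝ) < M := by exact_mod_cast (by omega : 0 < M)
  refine ⟨4 * (M : ℝ) ^ 2 * K, by positivity, fun m j => ?_⟩
  calc ∑' q : Fin 3 → ℤ, ENNReal.ofReal ((1 + (q j : ℝ) ^ 2) ^ (13 / 24 : ℝ)) *
        (∑' i : ℕ+, ENNReal.ofReal (scaleWeight M i *
          sliceRoot M i (symbol3 q) (symbol3 q + m ^ 2))) ^ 2
      ≤ ∑' q : Fin 3 → ℤ, ENNReal.ofReal (4 * (M : ℝ) ^ 2) *
          ENNReal.ofReal ((symbol3 q : ℝ) ^ (-(17 / 12) : ℝ) * gain M m q) := by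
        refine ENNReal.tsum_le_tsum fun q => ?_
        have hs1 := one_le_cast_symbol3 q
        have hg0 := gain_nonneg M m q
        calc _ ≤ ENNReal.ofReal ((symbol3 q : ℝ) ^ (13 / 24 : ℝ)) * ENNReal.ofReal
              (4 * (M : ℝ) ^ 2 * ((symbol3 q : ℝ) ^ (-(47 / 24) : ℝ) * gain M m q)) := by
              gcongr
              · exact one_add_sq_le_symbol3 q j
              · exact sq_tsum_scaleWeight_mul_sliceRoot_le hM m q
          _ = _ := by
              rw [← ENNReal.ofReal_mul (by positivity), ← ENNReal.ofReal_mul (by positivity)]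
              congr 1
              rw [show (-(17 / 12) : ℝ) = 13 / 24 + -(47 / 24) by norm_num,
                Real.rpow_add (by linarith)]
              ring
    _ ≤ ENNReal.ofReal (4 * (M : ℝ) ^ 2) * ENNReal.ofReal (K * ((m : ℝ) ^ 2) ^ (5 / 48 : ℝ)) := by
        rw [ENNReal.tsum_mul_left]
        gcongr
        exact h M hM m
    _ ≤ _ := by
        rw [← ENNReal.ofReal_mul (by positivity)]
        refine ENNReal.ofReal_le_ofReal ?_
        rw [mul_assoc _ K]
        gcongr
        linarith

/-- The subtracted graph `M₂` whose two vertices have the same colour: subtracting the inner tadpole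
at zero external index suffices. -/
theorem exists_tsum_outer_eq_le {M : ℕ} (hM : 1 < M) : ∃ K : ℝ, 0 < K ∧ ∀ m : ℤ,
    ∑' q : Fin 3 → ℤ, ENNReal.ofReal ((1 + (m : ℝ) ^ 2) ^ (13 / 24 : ℝ)) *
      (∑' i : ℕ+, ENNReal.ofReal (scaleWeight M i * sliceValue M i (symbol3 q + m ^ 2))) ^ 2 ≤
      ENNReal.ofReal (K * (1 + (m : ℝ) ^ 2) ^ (5 / 48 : ℝ)) := by
  set S := ∑' p : Fin 3 → ℤ, ENNReal.ofReal ((symbol3 p : ℝ) ^ (-(73 / 48) : ℝ)) with hS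
  have hStop : S ≠ ∞ := tsum_symbol3_rpow_lt_top.ne
  have hM0 : (0 : ℝ) < M := by exact_mod_cast (by omega : 0 < M)
  refine ⟨(M : ℝ) ^ 2 * (S.toReal + 1), by positivity, fun m => ?_⟩
  have hm : (0 : ℝ) < 1 + (m : ℝ) ^ 2 := by positivity
  calc ∑' q : Fin 3 → ℤ, ENNReal.ofReal ((1 + (m : ℝ) ^ 2) ^ (13 / 24 : ℝ)) *
        (∑' i : ℕ+, ENNReal.ofReal (scaleWeight M i * sliceValue M i (symbol3 q + m ^ 2))) ^ 2
      ≤ ∑' q : Fin 3 → ℤ, ENNReal.ofReal ((M : ℝ) ^ 2 * (1 + (m : ℝ) ^ 2) ^ (5 / 48 : ℝ)) *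
          ENNReal.ofReal ((symbol3 q : ℝ) ^ (-(73 / 48) : ℝ)) := by
        refine ENNReal.tsum_le_tsum fun q => ?_
        have hs1 := one_le_cast_symbol3 q
        have hm2 := sq_nonneg (m : ℝ)
        have hst : 1 ≤ symbol3 q + m ^ 2 := by nlinarith [one_le_symbol3 q]
        have ht : ((symbol3 q + m ^ 2 : ℤ) : ℝ) = symbol3 q + (m : ℝ) ^ 2 := by push_cast; rfl
        have ht0 : (0 : ℝ) < symbol3 q + (m : ℝ) ^ 2 := by linarith
        calc _ ≤ ENNReal.ofReal ((1 + (m : ℝ) ^ 2) ^ (13 / 24 : ℝ)) *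
              ENNReal.ofReal (M * ((symbol3 q + m ^ 2 : ℤ) : ℝ) ^ (-(47 / 48) : ℝ)) ^ 2 := by
              gcongr
              exact tsum_scaleWeight_mul_sliceValue_le hM hst
          _ ≤ _ := by
              rw [ht, ← ENNReal.ofReal_pow (by positivity), ← ENNReal.ofReal_mul (by positivity),
                ← ENNReal.ofReal_mul (by positivity)]
              refine ENNReal.ofReal_le_ofReal ?_
              have h₁ : (symbol3 q + (m : ℝ) ^ 2) ^ (-(73 / 48) : ℝ) ≤
                  (symbol3 q : ℝ) ^ (-(73 / 48) : ℝ) :=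
                Real.rpow_le_rpow_of_nonpos (by linarith) (by linarith) (by norm_num)
              have h₂ : (symbol3 q + (m : ℝ) ^ 2) ^ (-(7 / 16) : ℝ) ≤
                  (1 + (m : ℝ) ^ 2) ^ (-(7 / 16) : ℝ) :=
                Real.rpow_le_rpow_of_nonpos (by linarith) (by linarith) (by norm_num)
              have h₃ : ((symbol3 q + (m : ℝ) ^ 2) ^ (-(47 / 48) : ℝ)) ^ 2 =
                  (symbol3 q + (m : ℝ) ^ 2) ^ (-(73 / 48) : ℝ) *
                  (symbol3 q + (m : ℝ) ^ 2) ^ (-(7 / 16) : ℝ) := by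
                rw [← Real.rpow_natCast, ← Real.rpow_mul ht0.le, ← Real.rpow_add ht0]
                norm_num
              rw [mul_pow, h₃]
              calc _ ≤ (1 + (m : ℝ) ^ 2) ^ (13 / 24 : ℝ) * ((M : ℝ) ^ 2 *
                    ((symbol3 q : ℝ) ^ (-(73 / 48) : ℝ) * (1 + (m : ℝ) ^ 2) ^ (-(7 / 16) : ℝ))) := by
                    gcongr
                _ = _ := by
                    rw [show (5 / 48 : ℝ) = 13 / 24 + -(7 / 16) by norm_num, Real.rpow_add hm]
                    ring
    _ = ENNReal.ofReal ((M : ℝ) ^ 2 * (1 + (m : ℝ) ^ 2) ^ (5 / 48 : ℝ)) * ENNReal.ofReal S.toReal := by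
        rw [ENNReal.tsum_mul_left, ENNReal.ofReal_toReal hStop]
    _ ≤ _ := by
        rw [← ENNReal.ofReal_mul (by positivity)]
        refine ENNReal.ofReal_le_ofReal ?_
        have : 0 ≤ (M : ℝ) ^ 2 * (1 + (m : ℝ) ^ 2) ^ (5 / 48 : ℝ) := by positivity
        nlinarith

/-! ### Sums over a tadpole and over a graph `M₂` -/

/-- The contribution of a tadpole with internal indices `p` and external index `m`. -/
noncomputable def tadpoleSum (M : ℕ) (m : ℤ) (p : Fin 3 → ℤ) : ℝ≥0∞ :=
  ∑' i : ℕ+, ENNReal.ofReal (scaleWeight M i *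
    |sliceValue M i (symbol3 p + m ^ 2) - sliceValue M i (symbol3 p)|)

/-- The contribution of each outer line of a graph `M₂` with vertices of the colours `c` and `d`;
the outer lines carry the external index `m` and the indices `q`. -/
noncomputable def outerSum (M : ℕ) (c d : Fin 4) (m : ℤ) (q : Fin 3 → ℤ) : ℝ≥0∞ :=
  if d = c then ∑' i : ℕ+, ENNReal.ofReal (scaleWeight M i * sliceValue M i (symbol3 q + m ^ 2))
  else ∑' i : ℕ+, ENNReal.ofReal (scaleWeight M i *
    sliceRoot M i (symbol3 q) (symbol3 q + m ^ 2))

/-- The contribution of a graph `M₂` with vertices of the colours `c` and `d`, external index `m`,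
indices `q` on the outer lines and internal indices `p` of the inserted tadpole. -/
noncomputable def clusterSum (M : ℕ) (c d : Fin 4) (m : ℤ) (q p : Fin 3 → ℤ) : ℝ≥0∞ :=
  outerSum M c d m q ^ 2 * tadpoleSum M (c.insertNth (α := fun _ => ℤ) m q d) p

theorem exists_tsum_clusterSum_le {M : ℕ} (hM : 1 < M) : ∃ K : ℝ, 0 < K ∧
    ∀ (c d : Fin 4) (m : ℤ), ∑' w : (Fin 3 → ℤ) × (Fin 3 → ℤ), clusterSum M c d m w.1 w.2 ≤
      ENNReal.ofReal (K * (1 + (m : ℝ) ^ 2) ^ (5 / 48 : ℝ)) := by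
  obtain ⟨K₀, hK₀, h₀⟩ := exists_tsum_tadpole_le hM
  obtain ⟨K₁, hK₁, h₁⟩ := exists_tsum_outer_ne_le hM
  obtain ⟨K₂, hK₂, h₂⟩ := exists_tsum_outer_eq_le hM
  refine ⟨K₀ * (K₁ + K₂), by positivity, fun c d m => ?_⟩
  have hm : (0 : ℝ) ≤ (1 + (m : ℝ) ^ 2) ^ (5 / 48 : ℝ) := by positivity
  have hsum : ∑' q : Fin 3 → ℤ, ENNReal.ofReal
      ((1 + ((c.insertNth (α := fun _ => ℤ) m q d : ℤ) : ℝ) ^ 2) ^ (13 / 24 : ℝ)) *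
        outerSum M c d m q ^ 2 ≤
      ENNReal.ofReal ((K₁ + K₂) * (1 + (m : ℝ) ^ 2) ^ (5 / 48 : ℝ)) := by
    by_cases hcd : d = c
    · subst hcd
      simp only [outerSum, if_true, Fin.insertNth_apply_same]
      refine (h₂ m).trans (ENNReal.ofReal_le_ofReal ?_)
      exact mul_le_mul_of_nonneg_right (by linarith) hm
    · obtain ⟨j, rfl⟩ := Fin.exists_succAbove_eq hcd
      simp only [outerSum, if_neg hcd, Fin.insertNth_apply_succAbove]
      refine (h₁ m j).trans (ENNReal.ofReal_le_ofReal ?_)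
      exact mul_le_mul_of_nonneg_right (by linarith) hm
  calc ∑' w : (Fin 3 → ℤ) × (Fin 3 → ℤ), clusterSum M c d m w.1 w.2
      = ∑' q : Fin 3 → ℤ, ∑' p : Fin 3 → ℤ, clusterSum M c d m q p := ENNReal.tsum_prod'
    _ ≤ ∑' q : Fin 3 → ℤ, ENNReal.ofReal K₀ * (ENNReal.ofReal
          ((1 + ((c.insertNth (α := fun _ => ℤ) m q d : ℤ) : ℝ) ^ 2) ^ (13 / 24 : ℝ)) *
            outerSum M c d m q ^ 2) := by
        refine ENNReal.tsum_le_tsum fun q => ?_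
        unfold clusterSum
        rw [ENNReal.tsum_mul_left, ← mul_assoc, mul_comm, ← ENNReal.ofReal_mul hK₀.le]
        gcongr
        exact h₀ _
    _ ≤ ENNReal.ofReal K₀ * ENNReal.ofReal ((K₁ + K₂) * (1 + (m : ℝ) ^ 2) ^ (5 / 48 : ℝ)) := by
        rw [ENNReal.tsum_mul_left]
        gcongr
    _ = _ := by rw [← ENNReal.ofReal_mul hK₀.le, mul_assoc]

/-! ### Tadpoles, graphs `M₂` and connected components -/

/-- A set which is stable under a permutation of a finite type contains the cycles of its
elements. -/
theorem mem_of_sameCycle {α : Type*} [Finite α] {f : Equiv.Perm α} {s : Set α}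
    (hs : ∀ a ∈ s, f a ∈ s) {a b : α} (h : f.SameCycle a b) (ha : a ∈ s) : b ∈ s := by
  obtain ⟨i, rfl⟩ := h.exists_nat_pow_eq
  clear h
  induction i with
  | zero => exact ha
  | succ i ih =>
    rw [pow_succ']
    exact hs _ ih

namespace VacuumGraph

variable {G : VacuumGraph}

/-- The other label at the same vertex. -/
def flip (l : G.Line) : G.Line := (l.1, !l.2)

@[simp] theorem flip_flip (l : G.Line) : flip (flip l) = l := by simp [flip]

@[simp] theorem flip_fst (l : G.Line) : (flip l).1 = l.1 := rfl

theorem flip_ne (l : G.Line) : flip l ≠ l := fun h => by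
  have := congrArg Prod.snd h
  simp [flip] at this

theorem flip_injective : Function.Injective (flip : G.Line → G.Line) :=
  Function.LeftInverse.injective flip_flip

theorem flip_eq_iff {l l' : G.Line} : flip l = l' ↔ l = flip l' :=
  ⟨fun h => by rw [← h, flip_flip], fun h => by rw [h, flip_flip]⟩

theorem eq_or_eq_flip {l l' : G.Line} (h : l.1 = l'.1) : l = l' ∨ l = flip l' := by
  obtain ⟨v, b⟩ := l
  obtain ⟨v', b'⟩ := l'
  obtain rfl : v = v' := h
  cases b <;> cases b' <;> simp [flip]

theorem facePerm_of_eq {k : Fin 4} {l : G.Line} (h : G.colour (G.contraction l).1 = k) :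
    G.facePerm k l = flip (G.contraction l) := by
  simp [facePerm, vertexStrand, h, flip]

theorem facePerm_of_ne {k : Fin 4} {l : G.Line} (h : G.colour (G.contraction l).1 ≠ k) :
    G.facePerm k l = G.contraction l := by
  simp [facePerm, vertexStrand, h]

theorem facePerm_eq_or (k : Fin 4) (l : G.Line) :
    G.facePerm k l = flip (G.contraction l) ∨ G.facePerm k l = G.contraction l := by
  by_cases h : G.colour (G.contraction l).1 = k
  · exact Or.inl (facePerm_of_eq h)
  · exact Or.inr (facePerm_of_ne h)

theorem faceOf_eq_iff {l l' : G.Line} {k : Fin 4} :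
    G.faceOf l k = G.faceOf l' k ↔ (G.facePerm k).SameCycle l l' := by
  constructor
  · intro h
    exact Quotient.exact (eq_of_heq (Sigma.mk.inj_iff.1 h).2)
  · intro h
    exact congrArg (Sigma.mk k) (Quotient.sound h)

theorem faceOf_eq_faceOf {l l' : G.Line} {k k' : Fin 4} (h : G.faceOf l k = G.faceOf l' k') :
    k = k' ∧ (G.facePerm k).SameCycle l l' := by
  have hk : k = k' := congrArg Sigma.fst h
  subst hk
  exact ⟨rfl, faceOf_eq_iff.1 h⟩

theorem exists_faceOf_eq (f : G.Face) : ∃ l, G.faceOf l f.1 = f := by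
  obtain ⟨k, q⟩ := f
  obtain ⟨l, rfl⟩ := Quotient.exists_rep q
  exact ⟨l, rfl⟩

theorem faceOf_facePerm (k : Fin 4) (l : G.Line) : G.faceOf (G.facePerm k l) k = G.faceOf l k :=
  faceOf_eq_iff.2 (Equiv.Perm.sameCycle_apply_left.2 (Equiv.Perm.SameCycle.refl _ _))

instance : Finite G.Face := by
  unfold Face
  infer_instance

/-- The line `l` closes a melonic tadpole, that is, `{l}` is a graph `M₁`. -/
def IsLeaf (l : G.Line) : Prop := G.contraction l = l

/-- The line `u` starts at the vertex of a graph `M₂` to which the external fields are attached: it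
ends at another vertex, which carries the inserted tadpole, and from which `contraction u` comes
back. -/
def IsOuter (u : G.Line) : Prop :=
  G.contraction (G.contraction u) = u ∧ IsLeaf (flip (G.contraction u)) ∧
    (G.contraction u).1 ≠ u.1

/-- The lines of the graph `M₂` with outer line `u`. -/
def outerLines (u : G.Line) : Finset G.Line :=
  {u, G.contraction u, flip (G.contraction u)}

theorem mem_outerLines {u l : G.Line} :
    l ∈ outerLines u ↔ l = u ∨ l = G.contraction u ∨ l = flip (G.contraction u) := by
  simp [outerLines]

theorem isM1_iff {g : Finset G.Line} : G.IsM1 g ↔ ∃ l : G.Line, IsLeaf l ∧ g = {l} := Iff.rfl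

/-- A graph `M₂` is determined by its outer line `(v, b)`, from which one reads off the inserted
tadpole as `flip (contraction (v, b))`. -/
theorem isM2_iff {g : Finset G.Line} : G.IsM2 g ↔ ∃ u : G.Line, IsOuter u ∧ g = outerLines u := by
  constructor
  · rintro ⟨v, w, b, d, hvw, h₁, h₂, h₃, rfl⟩
    refine ⟨(v, b), ⟨?_, ?_, ?_⟩, ?_⟩
    · rw [h₂, h₃]
    · rw [h₂]
      simpa [flip, IsLeaf] using h₁
    · rw [h₂]
      exact hvw.symm
    · rw [outerLines, h₂]
      simp [flip]
  · rintro ⟨u, ⟨h₁, h₂, h₃⟩, rfl⟩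
    refine ⟨u.1, (G.contraction u).1, u.2, !(G.contraction u).2, h₃.symm, h₂, ?_, ?_, ?_⟩
    · simp
    · simpa using h₁
    · simp [outerLines, flip]

theorem IsLeaf.eq_of_sameCycle {l l' : G.Line} (h : IsLeaf l)
    (hs : G.contraction.SameCycle l l') : l' = l := (hs.eq_of_left h).symm

theorem IsOuter.contraction_ne {u : G.Line} (h : IsOuter u) : G.contraction u ≠ u :=
  fun h' => h.2.2 (congrArg Prod.fst h')

theorem IsOuter.not_isLeaf {u : G.Line} (h : IsOuter u) : ¬ IsLeaf u := h.contraction_ne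

theorem IsOuter.not_isLeaf_contraction {u : G.Line} (h : IsOuter u) :
    ¬ IsLeaf (G.contraction u) := fun h' => h.contraction_ne (h'.symm.trans h.1)

theorem IsOuter.flip_ne_contraction {u : G.Line} (h : IsOuter u) : flip u ≠ G.contraction u :=
  fun h' => h.2.2 (congrArg Prod.fst h').symm

theorem IsOuter.eq_or_eq_of_sameCycle {u l : G.Line} (h : IsOuter u)
    (hs : G.contraction.SameCycle u l) : l = u ∨ l = G.contraction u := by
  refine mem_of_sameCycle (s := {u, G.contraction u}) ?_ hs (by simp)
  rintro a (rfl | rfl)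
  · simp
  · simp [h.1]

/-- The faces of a tadpole of colours other than that of its vertex have length one. -/
theorem IsLeaf.eq_of_sameCycle_facePerm {l l' : G.Line} {k : Fin 4} (h : IsLeaf l)
    (hk : k ≠ G.colour l.1) (hs : (G.facePerm k).SameCycle l l') : l' = l := by
  refine (hs.eq_of_left ?_).symm
  change G.facePerm k l = l
  have h' : G.contraction l = l := h
  rw [facePerm_of_ne (by rw [h']; exact hk.symm), h']

/-- A face which enters a graph `M₂` with a colour other than that of its external vertex does not
leave it. -/
theorem IsOuter.facePerm_mem {u : G.Line} {k : Fin 4} (h : IsOuter u)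
    (hk : k ≠ G.colour u.1) {l : G.Line} (hl : l ∈ outerLines u) :
    G.facePerm k l ∈ outerLines u := by
  rw [mem_outerLines] at hl ⊢
  obtain ⟨h₁, h₂, h₃⟩ := h
  rcases hl with rfl | rfl | rfl
  · rcases facePerm_eq_or k l with h | h <;> simp [h]
  · rw [facePerm_of_ne (by rw [h₁]; exact hk.symm), h₁]
    simp
  · have h₂' : G.contraction (flip (G.contraction u)) = flip (G.contraction u) := h₂
    rcases facePerm_eq_or k (flip (G.contraction u)) with h | h <;> simp [h, h₂']

theorem IsOuter.mem_of_sameCycle_facePerm {u l l' : G.Line} {k : Fin 4} (h : IsOuter u)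
    (hk : k ≠ G.colour u.1) (hl : l ∈ outerLines u) (hs : (G.facePerm k).SameCycle l l') :
    l' ∈ outerLines u :=
  mem_of_sameCycle (s := (outerLines u : Set G.Line)) (fun _ ha => h.facePerm_mem hk ha) hs hl

open Classical in
/-- The lines of the connected component of the vertex `v`. -/
noncomputable def component (G : VacuumGraph) (v : Fin G.order) : Finset G.Line :=
  Finset.univ.filter fun l => G.adjacency.Reachable v l.1

theorem mem_component {v : Fin G.order} {l : G.Line} :
    l ∈ G.component v ↔ G.adjacency.Reachable v l.1 := by simp [component]

theorem isComponent_component (v : Fin G.order) : G.IsComponent (G.component v) :=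
  ⟨v, fun _ => mem_component⟩

theorem isComponent_iff {g : Finset G.Line} : G.IsComponent g ↔ ∃ v, g = G.component v := by
  constructor
  · rintro ⟨v, hv⟩
    exact ⟨v, Finset.ext fun l => (hv l).trans mem_component.symm⟩
  · rintro ⟨v, rfl⟩
    exact isComponent_component v

theorem reachable_contraction (l : G.Line) :
    G.adjacency.Reachable l.1 (G.contraction l).1 := by
  by_cases h : l.1 = (G.contraction l).1
  · rw [← h]
  · refine SimpleGraph.Adj.reachable ?_
    rw [adjacency, SimpleGraph.fromRel_adj]
    exact ⟨h, Or.inl ⟨l.2, rfl⟩⟩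

theorem contraction_mem_component {v : Fin G.order} {l : G.Line} (h : l ∈ G.component v) :
    G.contraction l ∈ G.component v :=
  mem_component.2 ((mem_component.1 h).trans (reachable_contraction l))

theorem flip_mem_component {v : Fin G.order} {l : G.Line} (h : l ∈ G.component v) :
    flip l ∈ G.component v :=
  mem_component.2 (show G.adjacency.Reachable v l.1 from mem_component.1 h)

theorem mem_component_of_sameCycle {v : Fin G.order} {l l' : G.Line} (h : l ∈ G.component v)
    (hs : G.contraction.SameCycle l l') : l' ∈ G.component v :=
  mem_of_sameCycle (s := (G.component v : Set G.Line)) (fun _ ha => contraction_mem_component ha)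
    hs h

theorem mem_component_of_faceOf_eq {v : Fin G.order} {l l' : G.Line} {k : Fin 4}
    (h : l ∈ G.component v) (hf : G.faceOf l k = G.faceOf l' k) : l' ∈ G.component v := by
  refine mem_of_sameCycle (s := (G.component v : Set G.Line)) (fun a ha => ?_)
    (faceOf_eq_iff.1 hf) h
  rcases facePerm_eq_or k a with h | h <;> rw [h]
  · exact flip_mem_component (contraction_mem_component ha)
  · exact contraction_mem_component ha

theorem isInternal_component {v : Fin G.order} {l : G.Line} (h : l ∈ G.component v) (k : Fin 4) :
    G.IsInternal (G.component v) (G.faceOf l k) :=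
  fun _ hl' => mem_component_of_faceOf_eq h hl'.symm

/-- A set of lines which is stable under the contraction and under `flip` contains the connected
components of its elements. -/
theorem component_subset {Z : Finset G.Line} (hσ : ∀ a ∈ Z, G.contraction a ∈ Z)
    (hι : ∀ a ∈ Z, flip a ∈ Z) {x : G.Line} (hx : x ∈ Z) : G.component x.1 ⊆ Z := by
  have hfst : ∀ {a b : G.Line}, a ∈ Z → b.1 = a.1 → b ∈ Z := by
    intro a b ha hb
    rcases eq_or_eq_flip hb with rfl | rfl
    · exact ha
    · exact hι a ha
  have hinv : ∀ {a : G.Line}, G.contraction a ∈ Z → a ∈ Z := by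
    intro a ha
    refine mem_of_sameCycle (s := (Z : Set G.Line)) hσ ?_ ha
    exact Equiv.Perm.sameCycle_apply_left.2 (Equiv.Perm.SameCycle.refl _ _)
  have hreach : ∀ w, G.adjacency.Reachable x.1 w → ∀ b : G.Line, b.1 = w → b ∈ Z := by
    intro w hw
    obtain ⟨p⟩ := hw
    generalize hv : x.1 = v at p
    have hstart : ∀ b : G.Line, b.1 = v → b ∈ Z := fun b hb => hfst hx (hb.trans hv.symm)
    clear hv hx
    induction p with
    | nil => exact hstart
    | @cons v' w' _ hadj _ ih =>
      apply ih
      intro b hb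
      rw [adjacency, SimpleGraph.fromRel_adj] at hadj
      rcases hadj.2 with ⟨d, hd⟩ | ⟨d, hd⟩
      · exact hfst (hσ _ (hstart (v', d) rfl)) (hb.trans hd.symm)
      · exact hfst (hinv (hstart (G.contraction (w', d)) hd)) hb
  intro l hl
  exact hreach l.1 (mem_component.1 hl) l rfl

/-- No connected component is divergent. -/
def NoDivergentComponent (G : VacuumGraph) : Prop :=
  ∀ g : Finset G.Line, G.IsComponent g → G.degree g < 0

/-- In a component without divergence, the number of faces one can exhibit is less than twice the
number of lines. -/
theorem NoDivergentComponent.card_lt (hG : G.NoDivergentComponent) {I : Type*} [Fintype I]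
    (x : G.Line) (Z : Finset G.Line) (hx : x ∈ Z) (hσ : ∀ a ∈ Z, G.contraction a ∈ Z)
    (hι : ∀ a ∈ Z, flip a ∈ Z) (φ : I → G.Line × Fin 4)
    (hφ : ∀ i, (φ i).1 ∈ G.component x.1)
    (hinj : Function.Injective fun i => G.faceOf (φ i).1 (φ i).2) :
    Fintype.card I < 2 * Z.card := by
  have hdeg := hG _ (isComponent_component x.1)
  unfold degree at hdeg
  have h₁ := Finset.card_le_card (component_subset hσ hι hx)
  have h₂ : Nat.card I ≤ Nat.card {f : G.Face // G.IsInternal (G.component x.1) f} := by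
    refine Nat.card_le_card_of_injective
      (fun i => ⟨G.faceOf (φ i).1 (φ i).2, isInternal_component (hφ i) _⟩) ?_
    intro i j hij
    exact hinj (congrArg Subtype.val hij)
  rw [Nat.card_eq_fintype_card] at h₂
  omega

/-! ### Vacuum graphs with too many faces -/

open Classical in
/-- The lines of the cycle of the contraction through `x`, that is, the corners of a vertex of the
intermediate field map. -/
noncomputable def corners (x : G.Line) : Finset G.Line :=
  Finset.univ.filter fun e => G.contraction.SameCycle x e

theorem mem_corners {x e : G.Line} : e ∈ corners x ↔ G.contraction.SameCycle x e := by
  simp [corners]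

theorem self_mem_corners (x : G.Line) : x ∈ corners x :=
  mem_corners.2 (Equiv.Perm.SameCycle.refl _ _)

theorem contraction_mem_corners {x e : G.Line} (h : e ∈ corners x) :
    G.contraction e ∈ corners x :=
  mem_corners.2 (Equiv.Perm.sameCycle_apply_right.2 (mem_corners.1 h))

theorem self_mem_component (x : G.Line) : x ∈ G.component x.1 :=
  mem_component.2 (SimpleGraph.Reachable.refl _)

theorem corners_subset_component {x e : G.Line} (h : e ∈ corners x) : e ∈ G.component x.1 :=
  mem_component_of_sameCycle (self_mem_component x) (mem_corners.1 h)

/-- A graph `M₂` attached to a vertex of the intermediate field map does not meet that vertex. -/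
theorem IsOuter.not_sameCycle {e l : G.Line} (h : IsOuter (flip e)) (hl : l ∈ outerLines (flip e)) :
    ¬ G.contraction.SameCycle l e := by
  have hne : ∀ l', G.contraction.SameCycle (flip e) l' → l' ≠ e := by
    rintro l' hs rfl
    rcases h.eq_or_eq_of_sameCycle hs with h' | h'
    · exact flip_ne _ h'.symm
    · exact h.flip_ne_contraction (by rwa [flip_flip])
  rcases mem_outerLines.1 hl with rfl | rfl | rfl
  · exact fun hs => hne _ hs rfl
  · exact fun hs => hne _ (Equiv.Perm.sameCycle_apply_left.1 hs) rfl
  · intro hs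
    have := h.2.1.eq_of_sameCycle hs
    rw [eq_comm, flip_eq_iff] at this
    exact h.contraction_ne this

/-- A vertex of the intermediate field map to which only graphs `M₁` and `M₂` are attached spans a
tree, with `t` edges say, hence at least `3t + 4` faces and `2t` lines. Without divergence `t ≥ 5`. -/
theorem NoDivergentComponent.five_le (hG : G.NoDivergentComponent) (x : G.Line)
    (h : ∀ e ∈ corners x, IsLeaf (flip e) ∨ IsOuter (flip e)) :
    5 ≤ (corners x).card + (open Classical in (corners x).filter fun e => IsOuter (flip e)).card := by
  classical
  set C := corners x with hC
  set C' := C.filter fun e => IsOuter (flip e) with hC'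
  have hC'C : ∀ {e}, e ∈ C' → e ∈ C ∧ IsOuter (flip e) := fun he => Finset.mem_filter.1 he
  let Z : Finset G.Line := (C ∪ C.image flip) ∪
    (C'.image (fun e => G.contraction (flip e)) ∪ C'.image fun e => flip (G.contraction (flip e)))
  have hZ : ∀ {a}, a ∈ Z ↔ (a ∈ C ∨ ∃ e ∈ C, flip e = a) ∨
      ((∃ e ∈ C', G.contraction (flip e) = a) ∨ ∃ e ∈ C', flip (G.contraction (flip e)) = a) := by
    intro a
    simp only [Z, Finset.mem_union, Finset.mem_image]
  have hZcard : Z.card ≤ 2 * C.card + 2 * C'.card := by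
    have h₁ := Finset.card_union_le (C ∪ C.image flip)
      (C'.image (fun e => G.contraction (flip e)) ∪ C'.image fun e => flip (G.contraction (flip e)))
    have h₂ := Finset.card_union_le C (C.image flip)
    have h₃ := Finset.card_union_le (C'.image (fun e => G.contraction (flip e)))
      (C'.image fun e => flip (G.contraction (flip e)))
    have h₄ := Finset.card_image_le (s := C) (f := flip)
    have h₅ := Finset.card_image_le (s := C') (f := fun e => G.contraction (flip e))
    have h₆ := Finset.card_image_le (s := C') (f := fun e => flip (G.contraction (flip e)))
    simp only [Z]
    omega
  have hσ : ∀ a ∈ Z, G.contraction a ∈ Z := by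
    intro a ha
    rw [hZ] at ha ⊢
    rcases ha with (ha | ⟨e, he, rfl⟩) | (⟨e, he, rfl⟩ | ⟨e, he, rfl⟩)
    · exact Or.inl (Or.inl (contraction_mem_corners ha))
    · rcases h e he with hl | ho
      · exact Or.inl (Or.inr ⟨e, he, hl.symm⟩)
      · exact Or.inr (Or.inl ⟨e, Finset.mem_filter.2 ⟨he, ho⟩, rfl⟩)
    · obtain ⟨he, ho⟩ := hC'C he
      exact Or.inl (Or.inr ⟨e, he, ho.1.symm⟩)
    · exact Or.inr (Or.inr ⟨e, he, (hC'C he).2.2.1.symm⟩)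
  have hι : ∀ a ∈ Z, flip a ∈ Z := by
    intro a ha
    rw [hZ] at ha ⊢
    rcases ha with (ha | ⟨e, he, rfl⟩) | (⟨e, he, rfl⟩ | ⟨e, he, rfl⟩)
    · exact Or.inl (Or.inr ⟨a, ha, rfl⟩)
    · exact Or.inl (Or.inl (by rwa [flip_flip]))
    · exact Or.inr (Or.inr ⟨e, he, rfl⟩)
    · exact Or.inr (Or.inl ⟨e, he, by rw [flip_flip]⟩)
  let φ : Fin 4 ⊕ ({e // e ∈ C} × Fin 3) ⊕ ({e // e ∈ C'} × Fin 3) → G.Line × Fin 4 := fun i =>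
    match i with
    | Sum.inl k => (x, k)
    | Sum.inr (Sum.inl (e, j)) => (flip e.1, (G.colour e.1.1).succAbove j)
    | Sum.inr (Sum.inr (e, j)) => (flip (G.contraction (flip e.1)),
        (G.colour (G.contraction (flip e.1)).1).succAbove j)
  have hCsame : ∀ {e}, e ∈ C → G.contraction.SameCycle x e := fun he => mem_corners.1 he
  have hx_out : ∀ {e}, e ∈ C' → x ∉ outerLines (flip e) := fun he hx =>
    (hC'C he).2.not_sameCycle hx (hCsame (hC'C he).1)
  -- the internal faces of the tadpoles and of the graphs `M₂` do not run through `x`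
  have hx_flip : ∀ {e} {k : Fin 4}, e ∈ C → k ≠ G.colour e.1 →
      ¬ (G.facePerm k).SameCycle (flip e) x := by
    intro e k he hk hs
    rcases h e he with hl | ho
    · have hxe := hl.eq_of_sameCycle_facePerm hk hs
      subst hxe
      exact flip_ne e (hl.eq_of_sameCycle (hCsame he)).symm
    · exact hx_out (Finset.mem_filter.2 ⟨he, ho⟩)
        (ho.mem_of_sameCycle_facePerm hk (by simp [mem_outerLines]) hs)
  have hx_inner : ∀ {e} {k : Fin 4}, e ∈ C' → k ≠ G.colour (G.contraction (flip e)).1 →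
      ¬ (G.facePerm k).SameCycle (flip (G.contraction (flip e))) x := by
    intro e k he hk hs
    have hxe := (hC'C he).2.2.1.eq_of_sameCycle_facePerm hk hs
    exact hx_out he (by simp [mem_outerLines, hxe])
  have hflip_flip : ∀ {e e'} {k : Fin 4}, e ∈ C → e' ∈ C → k ≠ G.colour e.1 → k ≠ G.colour e'.1 →
      (G.facePerm k).SameCycle (flip e) (flip e') → e = e' := by
    intro e e' k he he' hk hk' hs
    rcases h e he with hl | ho
    · exact (flip_injective (hl.eq_of_sameCycle_facePerm hk hs)).symm
    · rcases h e' he' with hl' | ho'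
      · exact flip_injective (hl'.eq_of_sameCycle_facePerm hk' hs.symm)
      · rcases mem_outerLines.1 (ho.mem_of_sameCycle_facePerm hk (by simp [mem_outerLines]) hs)
          with h' | h' | h'
        · exact (flip_injective h').symm
        · have hle : IsLeaf e := by
            have := ho'.2.1
            rwa [h', ho.1, flip_flip] at this
          exact (hle.eq_of_sameCycle ((hCsame he).symm.trans (hCsame he'))).symm
        · exact absurd (h' ▸ ho.2.1) ho'.not_isLeaf
  have hflip_inner : ∀ {e e'} {k : Fin 4}, e ∈ C → e' ∈ C' →
      k ≠ G.colour (G.contraction (flip e')).1 →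
      ¬ (G.facePerm k).SameCycle (flip e) (flip (G.contraction (flip e'))) := by
    intro e e' k he he' hk hs
    have := flip_injective ((hC'C he').2.2.1.eq_of_sameCycle_facePerm hk hs.symm)
    refine (hC'C he').2.not_sameCycle (l := e) (by simp [mem_outerLines, this]) ?_
    exact (hCsame he).symm.trans (hCsame (hC'C he').1)
  have hinj : Function.Injective fun i => G.faceOf (φ i).1 (φ i).2 := by
    rintro (k | ⟨⟨e, he⟩, j⟩ | ⟨⟨e, he⟩, j⟩) (k' | ⟨⟨e', he'⟩, j'⟩ | ⟨⟨e', he'⟩, j'⟩) hij <;>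
      obtain ⟨hk, hs⟩ := faceOf_eq_faceOf hij <;> simp only [φ] at hk hs
    · rw [hk]
    · exact absurd hs.symm (hx_flip he' (hk ▸ Fin.succAbove_ne _ _))
    · exact absurd hs.symm (hx_inner he' (hk ▸ Fin.succAbove_ne _ _))
    · exact absurd hs (hx_flip he (Fin.succAbove_ne _ _))
    · obtain rfl := hflip_flip he he' (Fin.succAbove_ne _ _) (hk ▸ Fin.succAbove_ne _ _) hs
      rw [Fin.succAbove_right_injective hk]
    · exact absurd hs (hflip_inner he he' (hk ▸ Fin.succAbove_ne _ _))
    · exact absurd hs (hx_inner he (Fin.succAbove_ne _ _))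
    · exact absurd hs.symm (hflip_inner he' he (Fin.succAbove_ne _ _))
    · have h₁ := (hC'C he).2.2.1.eq_of_sameCycle_facePerm (Fin.succAbove_ne _ _) hs
      obtain rfl := flip_injective (G.contraction.injective (flip_injective h₁))
      rw [Fin.succAbove_right_injective hk]
  have hmem : ∀ i, (φ i).1 ∈ G.component x.1 := by
    rintro (k | ⟨⟨e, he⟩, j⟩ | ⟨⟨e, he⟩, j⟩)
    · exact self_mem_component x
    · exact flip_mem_component (corners_subset_component he)
    · exact flip_mem_component (contraction_mem_component
        (flip_mem_component (corners_subset_component (hC'C he).1)))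
  have hlt := hG.card_lt x Z (hZ.2 (Or.inl (Or.inl (self_mem_corners x)))) hσ hι φ hmem hinj
  simp only [Fintype.card_sum, Fintype.card_prod, Fintype.card_fin, Fintype.card_coe] at hlt
  omega

/-- A self-loop alone has five faces and two lines. -/
theorem NoDivergentComponent.not_selfLoop (hG : G.NoDivergentComponent) {y : G.Line}
    (h₁ : G.contraction y = flip y) (h₂ : G.contraction (flip y) = y) : False := by
  classical
  let φ : Fin 3 ⊕ Bool → G.Line × Fin 4 := fun i =>
    match i with
    | Sum.inl j => (y, (G.colour y.1).succAbove j)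
    | Sum.inr true => (y, G.colour y.1)
    | Sum.inr false => (flip y, G.colour y.1)
  have hfix : G.facePerm (G.colour y.1) y = y := by
    rw [facePerm_of_eq (by rw [h₁]; rfl), h₁, flip_flip]
  have hne := flip_ne y
  have hlt := hG.card_lt y {y, flip y} (by simp)
    (by
      intro a ha
      simp only [Finset.mem_insert, Finset.mem_singleton] at ha
      rcases ha with rfl | rfl <;> simp [h₁, h₂])
    (by
      intro a ha
      simp only [Finset.mem_insert, Finset.mem_singleton] at ha
      rcases ha with rfl | rfl <;> simp) φ
    (by
      rintro (j | b | b)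
      · exact self_mem_component y
      · exact flip_mem_component (self_mem_component y)
      · exact self_mem_component y)
    (by
      rintro (j | b | b) (j' | b' | b') hij <;>
        obtain ⟨hk, hs⟩ := faceOf_eq_faceOf hij <;> simp only [φ] at hk hs
      · rw [Fin.succAbove_right_injective hk]
      · exact absurd hk (Fin.succAbove_ne _ _)
      · exact absurd hk (Fin.succAbove_ne _ _)
      · exact absurd hk.symm (Fin.succAbove_ne _ _)
      · rfl
      · exact absurd (hs.eq_of_right hfix) hne
      · exact absurd hk.symm (Fin.succAbove_ne _ _)
      · exact absurd (hs.eq_of_left hfix).symm hne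
      · rfl)
  have := Finset.card_le_two (a := y) (b := flip y)
  simp only [Fintype.card_sum, Fintype.card_fin, Fintype.card_bool] at hlt
  omega

/-- A self-loop with a single tadpole attached has eight faces and four lines. -/
theorem NoDivergentComponent.not_selfLoop_leaf (hG : G.NoDivergentComponent) {y e : G.Line}
    (h₁ : G.contraction y = flip y) (h₂ : G.contraction (flip y) = e) (h₃ : G.contraction e = y)
    (h₄ : IsLeaf (flip e)) : False := by
  classical
  let φ : (Fin 3 ⊕ Fin 3) ⊕ Bool → G.Line × Fin 4 := fun i =>
    match i with
    | Sum.inl (Sum.inl j) => (y, (G.colour y.1).succAbove j)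
    | Sum.inl (Sum.inr j) => (flip e, (G.colour e.1).succAbove j)
    | Sum.inr true => (y, G.colour y.1)
    | Sum.inr false => (flip y, G.colour y.1)
  have hfix : G.facePerm (G.colour y.1) y = y := by
    rw [facePerm_of_eq (by rw [h₁]; rfl), h₁, flip_flip]
  have hne := flip_ne y
  have hy : ¬ IsLeaf y := fun h => hne (h₁.symm.trans h)
  have hey : flip e ≠ y := fun h => hy (h ▸ h₄)
  have hey' : e ≠ y := by
    rintro rfl
    exact hne (h₁.symm.trans h₃)
  have hey'' : flip e ≠ flip y := fun h => hey' (flip_injective h)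
  have hlt := hG.card_lt y {y, flip y, e, flip e} (by simp)
    (by
      intro a ha
      simp only [Finset.mem_insert, Finset.mem_singleton] at ha
      have h₄' : G.contraction (flip e) = flip e := h₄
      rcases ha with rfl | rfl | rfl | rfl <;> simp [h₁, h₂, h₃, h₄'])
    (by
      intro a ha
      simp only [Finset.mem_insert, Finset.mem_singleton] at ha
      rcases ha with rfl | rfl | rfl | rfl <;> simp) φ
    (by
      have hyc := self_mem_component y
      rintro ((j | j) | b | b)
      · exact hyc
      · refine flip_mem_component ?_
        rw [← h₂]
        exact contraction_mem_component (flip_mem_component hyc)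
      · exact flip_mem_component hyc
      · exact hyc)
    (by
      have hleaf : ∀ {k : Fin 4} {l : G.Line}, k ≠ G.colour e.1 →
          (G.facePerm k).SameCycle (flip e) l → l = flip e :=
        fun hk hs => h₄.eq_of_sameCycle_facePerm hk hs
      rintro ((j | j) | b | b) ((j' | j') | b' | b') hij <;>
        obtain ⟨hk, hs⟩ := faceOf_eq_faceOf hij <;> simp only [φ] at hk hs
      · rw [Fin.succAbove_right_injective hk]
      · exact absurd (hleaf (hk ▸ Fin.succAbove_ne _ _) hs.symm).symm hey
      · exact absurd hk (Fin.succAbove_ne _ _)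
      · exact absurd hk (Fin.succAbove_ne _ _)
      · exact absurd (hleaf (Fin.succAbove_ne _ _) hs).symm hey
      · rw [Fin.succAbove_right_injective hk]
      · exact absurd (hleaf (Fin.succAbove_ne _ _) hs).symm hey''
      · exact absurd (hleaf (Fin.succAbove_ne _ _) hs).symm hey
      · exact absurd hk.symm (Fin.succAbove_ne _ _)
      · exact absurd (hleaf (hk ▸ Fin.succAbove_ne _ _) hs.symm).symm hey''
      · rfl
      · exact absurd (hs.eq_of_right hfix) hne
      · exact absurd hk.symm (Fin.succAbove_ne _ _)
      · exact absurd (hleaf (hk ▸ Fin.succAbove_ne _ _) hs.symm).symm hey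
      · exact absurd (hs.eq_of_left hfix).symm hne
      · rfl)
  have := Finset.card_le_four (a := y) (b := flip y) (c := e) (d := flip e)
  simp only [Fintype.card_sum, Fintype.card_fin, Fintype.card_bool] at hlt
  omega

/-- Two vertices of the intermediate field map joined by two edges of the same colour have eight
faces and four lines. -/
theorem NoDivergentComponent.not_doubleEdge (hG : G.NoDivergentComponent) {y z : G.Line}
    (h₁ : G.contraction y = z) (h₂ : G.contraction z = y)
    (h₃ : G.contraction (flip y) = flip z) (h₄ : G.contraction (flip z) = flip y) (hyz : y ≠ z)
    (hyz' : flip y ≠ z) (hcol : G.colour y.1 = G.colour z.1) : False := by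
  classical
  let φ : (Fin 3 ⊕ Fin 3) ⊕ Bool → G.Line × Fin 4 := fun i =>
    match i with
    | Sum.inl (Sum.inl j) => (y, (G.colour y.1).succAbove j)
    | Sum.inl (Sum.inr j) => (flip z, (G.colour y.1).succAbove j)
    | Sum.inr true => (y, G.colour y.1)
    | Sum.inr false => (z, G.colour y.1)
  have hyz'' : y ≠ flip z := fun h => hyz' (flip_eq_iff.2 h)
  have hA : ∀ {k : Fin 4} {l : G.Line}, k ≠ G.colour y.1 → (G.facePerm k).SameCycle y l →
      l = y ∨ l = z := by
    intro k l hk hs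
    refine mem_of_sameCycle (s := {y, z}) ?_ hs (by simp)
    rintro a (rfl | rfl)
    · rw [facePerm_of_ne (by rw [h₁, ← hcol]; exact hk.symm), h₁]
      simp
    · rw [facePerm_of_ne (by rw [h₂]; exact hk.symm), h₂]
      simp
  have hB : ∀ {l : G.Line}, (G.facePerm (G.colour y.1)).SameCycle y l → l = y ∨ l = flip z := by
    intro l hs
    refine mem_of_sameCycle (s := {y, flip z}) ?_ hs (by simp)
    rintro a (rfl | rfl)
    · rw [facePerm_of_eq (by rw [h₁, ← hcol]), h₁]
      simp
    · rw [facePerm_of_eq (by rw [h₄]; rfl), h₄]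
      simp
  have hlt := hG.card_lt y {y, flip y, z, flip z} (by simp)
    (by
      intro a ha
      simp only [Finset.mem_insert, Finset.mem_singleton] at ha
      rcases ha with rfl | rfl | rfl | rfl <;> simp [h₁, h₂, h₃, h₄])
    (by
      intro a ha
      simp only [Finset.mem_insert, Finset.mem_singleton] at ha
      rcases ha with rfl | rfl | rfl | rfl <;> simp) φ
    (by
      have hyc := self_mem_component y
      have hzc : z ∈ G.component y.1 := by
        rw [← h₁]
        exact contraction_mem_component hyc
      rintro ((j | j) | b | b)
      · exact hyc
      · exact flip_mem_component hzc
      · exact hzc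
      · exact hyc)
    (by
      have hn : ∀ {k : Fin 4}, k ≠ G.colour y.1 → ¬ (G.facePerm k).SameCycle y (flip z) := by
        intro k hk hs
        rcases hA hk hs with h | h
        · exact hyz'' h.symm
        · exact flip_ne z h
      have hn' : ¬ (G.facePerm (G.colour y.1)).SameCycle y z := by
        intro hs
        rcases hB hs with h | h
        · exact hyz h.symm
        · exact flip_ne z h.symm
      rintro ((j | j) | b | b) ((j' | j') | b' | b') hij <;>
        obtain ⟨hk, hs⟩ := faceOf_eq_faceOf hij <;> simp only [φ] at hk hs
      · rw [Fin.succAbove_right_injective hk]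
      · exact absurd hs (hn (Fin.succAbove_ne _ _))
      · exact absurd hk (Fin.succAbove_ne _ _)
      · exact absurd hk (Fin.succAbove_ne _ _)
      · exact absurd hs.symm (hn (Fin.succAbove_ne _ _))
      · rw [Fin.succAbove_right_injective hk]
      · exact absurd hk (Fin.succAbove_ne _ _)
      · exact absurd hk (Fin.succAbove_ne _ _)
      · exact absurd hk.symm (Fin.succAbove_ne _ _)
      · exact absurd hk.symm (Fin.succAbove_ne _ _)
      · rfl
      · exact absurd hs.symm hn'
      · exact absurd hk.symm (Fin.succAbove_ne _ _)
      · exact absurd hk.symm (Fin.succAbove_ne _ _)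
      · exact absurd hs hn'
      · rfl)
  have := Finset.card_le_four (a := y) (b := flip y) (c := z) (d := flip z)
  simp only [Fintype.card_sum, Fintype.card_fin, Fintype.card_bool] at hlt
  omega

/-! ### Classification of the lines and of the faces -/

/-- A tadpole `M₁` which is not inserted in a graph `M₂`. -/
def IsBareLeaf (l : G.Line) : Prop := IsLeaf l ∧ ¬ IsOuter (G.contraction (flip l))

/-- A line which belongs to no divergent two-point graph. -/
def IsReduced (l : G.Line) : Prop :=
  ¬ IsLeaf l ∧ ¬ IsOuter l ∧ ¬ IsOuter (G.contraction l)

/-- A line which belongs to no divergent two-point graph, and which starts at a vertex whose other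
line has the same property. -/
def IsOrdinary (l : G.Line) : Prop := IsReduced l ∧ IsReduced (flip l)

theorem IsOrdinary.flip {l : G.Line} (h : IsOrdinary l) : IsOrdinary (flip l) :=
  ⟨h.2, by rw [flip_flip]; exact h.1⟩

/-- A vertex of the intermediate field map with at most two edges leads to something else than
tadpoles and graphs `M₂`: otherwise the component would be a tree with at most four edges. -/
theorem NoDivergentComponent.not_star (hG : G.NoDivergentComponent) {x : G.Line}
    (hx : (corners x).card ≤ 2)
    (h : ∀ e ∈ corners x, IsLeaf (flip e) ∨ IsOuter (flip e)) : False := by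
  classical
  have h₁ := hG.five_le x h
  have h₂ := Finset.card_filter_le (corners x) fun e => IsOuter (flip e)
  omega

theorem IsLeaf.corners_eq {l : G.Line} (h : IsLeaf l) : corners l = {l} := by
  ext e
  rw [mem_corners, Finset.mem_singleton]
  refine ⟨h.eq_of_sameCycle, ?_⟩
  rintro rfl
  exact Equiv.Perm.SameCycle.refl _ _

theorem IsOuter.corners_eq {u : G.Line} (h : IsOuter u) : corners u = {u, G.contraction u} := by
  ext e
  rw [mem_corners, Finset.mem_insert, Finset.mem_singleton]
  refine ⟨h.eq_or_eq_of_sameCycle, ?_⟩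
  rintro (rfl | rfl)
  · exact Equiv.Perm.SameCycle.refl _ _
  · exact Equiv.Perm.sameCycle_apply_right.2 (Equiv.Perm.SameCycle.refl _ _)

theorem NoDivergentComponent.not_isLeaf_flip (hG : G.NoDivergentComponent) {l : G.Line}
    (h : IsLeaf l) : ¬ IsLeaf (flip l) := by
  intro h'
  refine hG.not_star (x := l) (by simp [h.corners_eq]) fun e he => ?_
  rw [h.corners_eq, Finset.mem_singleton] at he
  subst he
  exact Or.inl h'

theorem NoDivergentComponent.not_isLeaf_flip_of_isOuter (hG : G.NoDivergentComponent) {u : G.Line}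
    (h : IsOuter u) : ¬ IsLeaf (flip u) := by
  intro h'
  refine hG.not_star (x := u) (by rw [h.corners_eq]; exact Finset.card_le_two) fun e he => ?_
  rw [h.corners_eq, Finset.mem_insert, Finset.mem_singleton] at he
  rcases he with rfl | rfl
  · exact Or.inl h'
  · exact Or.inl h.2.1

theorem NoDivergentComponent.not_isOuter_flip (hG : G.NoDivergentComponent) {u : G.Line}
    (h : IsOuter u) : ¬ IsOuter (flip u) := by
  intro h'
  refine hG.not_star (x := u) (by rw [h.corners_eq]; exact Finset.card_le_two) fun e he => ?_
  rw [h.corners_eq, Finset.mem_insert, Finset.mem_singleton] at he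
  rcases he with rfl | rfl
  · exact Or.inr h'
  · exact Or.inl h.2.1

theorem NoDivergentComponent.not_isOuter_contraction (hG : G.NoDivergentComponent) {u : G.Line}
    (h : IsOuter u) : ¬ IsOuter (G.contraction u) := fun h' =>
  hG.not_isLeaf_flip_of_isOuter h (by have := h'.2.1; rwa [h.1] at this)

/-- If the flip of `l` returns from a graph `M₂`, then `l` is the tadpole inserted in it. -/
theorem not_isOuter_contraction_flip {l : G.Line} (h : ¬ IsLeaf l) :
    ¬ IsOuter (G.contraction (flip l)) := by
  intro ho
  have h₁ : G.contraction (G.contraction (flip l)) = flip l := G.contraction.injective ho.1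
  have h₂ := ho.2.1
  rw [h₁, flip_flip] at h₂
  exact h h₂

theorem IsReduced.flip_cases {l : G.Line} (h : IsReduced l) :
    IsBareLeaf (flip l) ∨ IsOuter (flip l) ∨ IsReduced (flip l) := by
  by_cases h₁ : IsLeaf (flip l)
  · exact Or.inl ⟨h₁, by rw [flip_flip]; exact h.2.2⟩
  · by_cases h₂ : IsOuter (flip l)
    · exact Or.inr (Or.inl h₂)
    · exact Or.inr (Or.inr ⟨h₁, h₂, not_isOuter_contraction_flip h.1⟩)

theorem NoDivergentComponent.isReduced_flip_of_isBareLeaf (hG : G.NoDivergentComponent)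
    {l : G.Line} (h : IsBareLeaf l) : IsReduced (flip l) :=
  ⟨hG.not_isLeaf_flip h.1, fun ho => hG.not_isLeaf_flip_of_isOuter ho (by
    rw [flip_flip]; exact h.1), h.2⟩

theorem NoDivergentComponent.isReduced_flip_of_isOuter (hG : G.NoDivergentComponent)
    {u : G.Line} (h : IsOuter u) : IsReduced (flip u) :=
  ⟨hG.not_isLeaf_flip_of_isOuter h, hG.not_isOuter_flip h,
    not_isOuter_contraction_flip h.not_isLeaf⟩

theorem IsReduced.contraction {l : G.Line} (h : IsReduced l) : IsReduced (G.contraction l) := by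
  refine ⟨fun hl => h.1 (G.contraction.injective hl), h.2.2, fun ho => h.2.1 ?_⟩
  have h₁ := G.contraction.injective (G.contraction.injective ho.1)
  rwa [h₁] at ho

theorem IsReduced.of_sameCycle {l l' : G.Line} (h : IsReduced l)
    (hs : G.contraction.SameCycle l l') : IsReduced l' :=
  mem_of_sameCycle (s := {l | IsReduced l}) (fun _ ha => IsReduced.contraction ha) hs h

/-- Every line is of exactly one kind: a bare tadpole, one of the three lines of a graph `M₂`, or
reduced. -/
theorem NoDivergentComponent.bijective_lines (hG : G.NoDivergentComponent) :
    Function.Bijective (Sum.elim (fun l => l.1) (Sum.elim (fun u => u.1)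
      (Sum.elim (fun u => G.contraction u.1) (Sum.elim (fun u => flip (G.contraction u.1))
        fun l => l.1))) :
      {l : G.Line // IsBareLeaf l} ⊕ {u : G.Line // IsOuter u} ⊕ {u : G.Line // IsOuter u} ⊕
        {u : G.Line // IsOuter u} ⊕ {l : G.Line // IsReduced l} → G.Line) := by
  constructor
  · have hA : ∀ {l : G.Line}, IsBareLeaf l → IsLeaf l ∧ ¬ IsOuter (G.contraction (flip l)) :=
      fun h => h
    have hB : ∀ {u : G.Line}, IsOuter u → ¬ IsLeaf u ∧ IsOuter u :=
      fun h => ⟨h.not_isLeaf, h⟩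
    have hC : ∀ {u : G.Line}, IsOuter u → ¬ IsLeaf (G.contraction u) ∧
        ¬ IsOuter (G.contraction u) ∧ IsOuter (G.contraction (G.contraction u)) :=
      fun h => ⟨h.not_isLeaf_contraction, hG.not_isOuter_contraction h, by rwa [h.1]⟩
    have hD : ∀ {u : G.Line}, IsOuter u → IsLeaf (flip (G.contraction u)) ∧
        IsOuter (G.contraction (flip (flip (G.contraction u)))) :=
      fun h => ⟨h.2.1, by rwa [flip_flip, h.1]⟩
    rintro (⟨a, ha⟩ | ⟨a, ha⟩ | ⟨a, ha⟩ | ⟨a, ha⟩ | ⟨a, ha⟩)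
      (⟨b, hb⟩ | ⟨b, hb⟩ | ⟨b, hb⟩ | ⟨b, hb⟩ | ⟨b, hb⟩) hab <;>
      simp only [Sum.elim_inl, Sum.elim_inr] at hab
    · subst hab; rfl
    · exact absurd (hab ▸ (hA ha).1) (hB hb).1
    · exact absurd (hab ▸ (hA ha).1) (hC hb).1
    · exact absurd (hab ▸ (hD hb).2) (hA ha).2
    · exact absurd (hab ▸ (hA ha).1) hb.1
    · exact absurd (hab ▸ (hA hb).1) (hB ha).1
    · subst hab; rfl
    · exact absurd (hab ▸ ha) (hC hb).2.1
    · exact absurd (hab ▸ (hD hb).1) (hB ha).1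
    · exact absurd (hab ▸ ha) hb.2.1
    · exact absurd (hab ▸ (hA hb).1) (hC ha).1
    · exact absurd (hab ▸ hb) (hC ha).2.1
    · rw [G.contraction.injective.eq_iff] at hab
      subst hab; rfl
    · exact absurd (hab ▸ (hD hb).1) (hC ha).1
    · exact absurd (hab ▸ (hC ha).2.2) hb.2.2
    · exact absurd (hab ▸ (hD ha).2) (hA hb).2
    · exact absurd (hab ▸ (hD ha).1) (hB hb).1
    · exact absurd (hab ▸ (hD ha).1) (hC hb).1
    · rw [flip_injective.eq_iff, G.contraction.injective.eq_iff] at hab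
      subst hab; rfl
    · exact absurd (hab ▸ (hD ha).1) hb.1
    · exact absurd (hab ▸ (hA hb).1) ha.1
    · exact absurd (hab ▸ hb) ha.2.1
    · exact absurd (hab ▸ (hC hb).2.2) ha.2.2
    · exact absurd (hab ▸ (hD hb).1) ha.1
    · subst hab; rfl
  · intro l
    by_cases h₁ : IsLeaf l
    · by_cases h₂ : IsOuter (G.contraction (flip l))
      · refine ⟨Sum.inr (Sum.inr (Sum.inr (Sum.inl ⟨_, h₂⟩))), ?_⟩
        simp only [Sum.elim_inl, Sum.elim_inr]
        rw [G.contraction.injective h₂.1, flip_flip]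
      · exact ⟨Sum.inl ⟨l, h₁, h₂⟩, rfl⟩
    · by_cases h₂ : IsOuter l
      · exact ⟨Sum.inr (Sum.inl ⟨l, h₂⟩), rfl⟩
      · by_cases h₃ : IsOuter (G.contraction l)
        · refine ⟨Sum.inr (Sum.inr (Sum.inl ⟨_, h₃⟩)), ?_⟩
          simp only [Sum.elim_inl, Sum.elim_inr]
          exact G.contraction.injective h₃.1
        · exact ⟨Sum.inr (Sum.inr (Sum.inr (Sum.inr ⟨l, h₁, h₂, h₃⟩))), rfl⟩

open Classical in
/-- A product over the lines is a product over the bare tadpoles, the graphs `M₂` and the reduced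
lines. -/
theorem NoDivergentComponent.prod_lines (hG : G.NoDivergentComponent) {α : Type*} [CommMonoid α]
    (f : G.Line → α) :
    ∏ l, f l = (∏ l : {l : G.Line // IsBareLeaf l}, f l) *
      ((∏ u : {u : G.Line // IsOuter u}, f u * f (G.contraction u) * f (flip (G.contraction u))) *
        ∏ l : {l : G.Line // IsReduced l}, f l) := by
  rw [← hG.bijective_lines.prod_comp]
  simp only [Fintype.prod_sum_type, Sum.elim_inl, Sum.elim_inr, Finset.prod_mul_distrib, mul_assoc]

/-- The external face of a tadpole runs through the other line which starts at its vertex. -/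
theorem IsLeaf.faceOf_flip {l : G.Line} (h : IsLeaf l) :
    G.faceOf (flip l) (G.colour l.1) = G.faceOf l (G.colour l.1) := by
  have h' : G.contraction l = l := h
  conv_rhs => rw [← faceOf_facePerm, facePerm_of_eq (by rw [h']), h']

/-- The two outer lines of a graph `M₂` belong to the same faces: a face which makes a detour through
the inserted tadpole comes back. -/
theorem IsOuter.faceOf_contraction {u : G.Line} (h : IsOuter u) (k : Fin 4) :
    G.faceOf (G.contraction u) k = G.faceOf u k := by
  rw [← faceOf_facePerm k u]
  by_cases hk : G.colour (G.contraction u).1 = k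
  · rw [facePerm_of_eq hk]
    subst hk
    have := h.2.1.faceOf_flip
    rwa [flip_flip] at this
  · rw [facePerm_of_ne hk]

/-- The external face of a graph `M₂` runs through the other line which starts at its external
vertex. -/
theorem IsOuter.faceOf_flip {u : G.Line} (h : IsOuter u) :
    G.faceOf (flip u) (G.colour u.1) = G.faceOf u (G.colour u.1) := by
  rw [← h.faceOf_contraction]
  conv_rhs => rw [← faceOf_facePerm, facePerm_of_eq (by rw [h.1]), h.1]

/-- The face is run through by a reduced line. -/
def IsReducedFace (f : G.Face) : Prop := ∃ l : G.Line, IsReduced l ∧ G.faceOf l f.1 = f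

theorem IsReduced.isReducedFace {l : G.Line} (h : IsReduced l) (k : Fin 4) :
    IsReducedFace (G.faceOf l k) := ⟨l, h, rfl⟩

theorem NoDivergentComponent.isReducedFace_of_isBareLeaf (hG : G.NoDivergentComponent)
    {l : G.Line} (h : IsBareLeaf l) : IsReducedFace (G.faceOf l (G.colour l.1)) :=
  ⟨flip l, hG.isReduced_flip_of_isBareLeaf h, h.1.faceOf_flip⟩

theorem NoDivergentComponent.isReducedFace_of_isOuter (hG : G.NoDivergentComponent)
    {u : G.Line} (h : IsOuter u) : IsReducedFace (G.faceOf u (G.colour u.1)) :=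
  ⟨flip u, hG.isReduced_flip_of_isOuter h, h.faceOf_flip⟩

/-- A face which is not reduced is internal to a divergent two-point graph. -/
theorem NoDivergentComponent.face_cases (hG : G.NoDivergentComponent) (f : G.Face) :
    (∃ l k, IsLeaf l ∧ k ≠ G.colour l.1 ∧ f = G.faceOf l k) ∨
      (∃ u k, IsOuter u ∧ k ≠ G.colour u.1 ∧ f = G.faceOf u k) ∨ IsReducedFace f := by
  have hB : ∀ (u : G.Line) (k : Fin 4), IsOuter u →
      (∃ l k', IsLeaf l ∧ k' ≠ G.colour l.1 ∧ G.faceOf u k = G.faceOf l k') ∨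
      (∃ u' k', IsOuter u' ∧ k' ≠ G.colour u'.1 ∧ G.faceOf u k = G.faceOf u' k') ∨
      IsReducedFace (G.faceOf u k) := by
    intro u k hu
    by_cases hk : k = G.colour u.1
    · subst hk
      exact Or.inr (Or.inr (hG.isReducedFace_of_isOuter hu))
    · exact Or.inr (Or.inl ⟨u, k, hu, hk, rfl⟩)
  obtain ⟨l, hl⟩ := exists_faceOf_eq f
  generalize f.1 = k at hl
  subst hl
  obtain ⟨i, rfl⟩ := hG.bijective_lines.2 l
  rcases i with ⟨l, h⟩ | ⟨u, h⟩ | ⟨u, h⟩ | ⟨u, h⟩ | ⟨l, h⟩ <;> simp only [Sum.elim_inl, Sum.elim_inr]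
  · by_cases hk : k = G.colour l.1
    · subst hk
      exact Or.inr (Or.inr (hG.isReducedFace_of_isBareLeaf h))
    · exact Or.inl ⟨l, k, h.1, hk, rfl⟩
  · exact hB u k h
  · rw [h.faceOf_contraction]
    exact hB u k h
  · by_cases hk : k = G.colour (flip (G.contraction u)).1
    · subst hk
      rw [← h.2.1.faceOf_flip, flip_flip, h.faceOf_contraction]
      exact hB u _ h
    · exact Or.inl ⟨_, k, h.2.1, hk, rfl⟩
  · exact Or.inr (Or.inr (h.isReducedFace k))

/-! ### Distribution of the decrease of the reduced lines -/

/-- Following a face of colour `k` from a reduced line, one runs through the whole cycle of the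
contraction, unless one meets an ordinary line of colour `k`. -/
theorem IsReduced.walk {y w : G.Line} (hy : IsReduced y) (k : Fin 4)
    (hw : G.contraction.SameCycle y w) :
    (∃ h, G.contraction.SameCycle y h ∧ IsOrdinary h ∧ G.colour h.1 = k ∧
      G.faceOf (flip h) k = G.faceOf y k) ∨ G.faceOf w k = G.faceOf y k := by
  by_contra! hcon
  obtain ⟨hno, hne⟩ := hcon
  refine hne ?_
  refine (mem_of_sameCycle (s := {w | G.contraction.SameCycle y w ∧
    G.faceOf w k = G.faceOf y k}) ?_ hw ⟨Equiv.Perm.SameCycle.refl _ _, rfl⟩).2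
  rintro a ⟨ha, haf⟩
  have hσ : G.contraction.SameCycle y (G.contraction a) :=
    Equiv.Perm.sameCycle_apply_right.2 ha
  refine ⟨hσ, ?_⟩
  rw [← haf]
  have hred := hy.of_sameCycle hσ
  by_cases hk : G.colour (G.contraction a).1 = k
  · have hstep : G.faceOf (flip (G.contraction a)) k = G.faceOf a k := by
      rw [← faceOf_facePerm k a, facePerm_of_eq hk]
    rcases hred.flip_cases with h | h | h
    · have := h.1.faceOf_flip
      rw [flip_flip, flip_fst, hk] at this
      rw [this, hstep]
    · have := h.faceOf_flip
      rw [flip_flip, flip_fst, hk] at this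
      rw [this, hstep]
    · exact absurd (hstep.trans haf) (hno _ hσ ⟨hred, h⟩ hk)
  · rw [← faceOf_facePerm k a, facePerm_of_ne hk]

/-- If there is an ordinary line of colour `k` in the cycle, a face of colour `k` leaves the cycle
through one of them. -/
theorem IsReduced.exists_arc {y h₀ : G.Line} (hy : IsReduced y)
    (hs : G.contraction.SameCycle y h₀) (ho : IsOrdinary h₀) :
    ∃ h, G.contraction.SameCycle y h ∧ IsOrdinary h ∧ G.colour h.1 = G.colour h₀.1 ∧
      G.faceOf (flip h) (G.colour h₀.1) = G.faceOf y (G.colour h₀.1) := by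
  rcases hy.walk (G.colour h₀.1) (Equiv.Perm.sameCycle_symm_apply_right.2 hs) with h | h
  · exact h
  · refine ⟨h₀, hs, ho, rfl, ?_⟩
    rw [← h, ← faceOf_facePerm _ (G.contraction.symm h₀), facePerm_of_eq (by simp)]
    simp

/-- The two ends of the edge lie at the same vertex of the intermediate field map. -/
def IsSelfLoop (y : G.Line) : Prop := G.contraction.SameCycle y (flip y)

/-- The line `y` starts at a vertex of the intermediate field map with just two edges, which are
distinct, ordinary, and of the same colour. -/
def IsDeficient (y : G.Line) : Prop :=
  G.contraction (G.contraction y) = y ∧ G.contraction y ≠ y ∧ IsOrdinary (G.contraction y) ∧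
    G.colour (G.contraction y).1 = G.colour y.1

open Classical in
/-- The share of an ordinary line in the face of its own colour which it begins to follow. -/
noncomputable def share (y : G.Line) : ℝ :=
  if IsSelfLoop y then 1 else if IsDeficient y then 1 / 3 else 2 / 3

theorem third_le_share (y : G.Line) : 1 / 3 ≤ share y := by
  unfold share
  split_ifs <;> norm_num

theorem share_le_one (y : G.Line) : share y ≤ 1 := by
  unfold share
  split_ifs <;> norm_num

theorem share_le_of_not_isSelfLoop {y : G.Line} (h : ¬ IsSelfLoop y) : share y ≤ 2 / 3 := by
  unfold share
  rw [if_neg h]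
  split_ifs <;> norm_num

open Classical in
/-- The ordinary lines give each of the faces they follow a total share of at least one. Two
deficient lines do not suffice, but they would form a divergent component. -/
theorem NoDivergentComponent.one_le_sum_share (hG : G.NoDivergentComponent) {y : G.Line}
    (hy : IsOrdinary y) :
    1 ≤ ∑ w : G.Line with (IsOrdinary w ∧ G.colour w.1 = G.colour y.1 ∧
      G.faceOf w (G.colour y.1) = G.faceOf y (G.colour y.1)), share w := by
  set k := G.colour y.1 with hk
  set T : Finset G.Line := Finset.univ.filter fun w => IsOrdinary w ∧ G.colour w.1 = k ∧
      G.faceOf w k = G.faceOf y k with hT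
  have hmem : ∀ {w}, w ∈ T ↔ IsOrdinary w ∧ G.colour w.1 = k ∧ G.faceOf w k = G.faceOf y k := by
    intro w
    simp [hT]
  have hyT : y ∈ T := hmem.2 ⟨hy, rfl, rfl⟩
  have hnn : ∀ w ∈ T, 0 ≤ share w := fun w _ => by linarith [third_le_share w]
  have hpair : ∀ {a b}, a ∈ T → b ∈ T → a ≠ b → share a + share b ≤ ∑ w ∈ T, share w := by
    intro a b ha hb hab
    rw [← Finset.sum_pair hab]
    refine Finset.sum_le_sum_of_subset_of_nonneg ?_ fun w hw _ => hnn w hw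
    intro w hw
    rcases Finset.mem_insert.1 hw with rfl | hw
    · exact ha
    · rw [Finset.mem_singleton.1 hw]; exact hb
  by_cases hdef : ∀ w ∈ T, ¬ IsSelfLoop w ∧ IsDeficient w
  · have hnext : ∀ {w}, w ∈ T → flip (G.contraction w) ∈ T ∧ flip (G.contraction w) ≠ w := by
      intro w hw
      obtain ⟨hloop, h₁, h₂, h₃, h₄⟩ := hdef w hw
      obtain ⟨hwo, hwk, hwf⟩ := hmem.1 hw
      refine ⟨hmem.2 ⟨h₃.flip, by rw [flip_fst, h₄, hwk], ?_⟩, fun h => hloop ?_⟩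
      · rw [← hwf, ← faceOf_facePerm k w, facePerm_of_eq (h₄.trans hwk)]
      · rw [flip_eq_iff] at h
        rw [IsSelfLoop, ← h]
        exact Equiv.Perm.sameCycle_apply_right.2 (Equiv.Perm.SameCycle.refl _ _)
    obtain ⟨hy₁, hne₁⟩ := hnext hyT
    obtain ⟨hy₂, hne₂⟩ := hnext hy₁
    set y₁ := flip (G.contraction y) with hy₁def
    set y₂ := flip (G.contraction y₁) with hy₂def
    by_cases hyy : y₂ = y
    · exfalso
      obtain ⟨hloop, h₁, h₂, h₃, h₄⟩ := hdef y hyT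
      have e₁ : G.contraction y₁ = flip y := by
        rw [← hyy, hy₂def, flip_flip]
      refine hG.not_doubleEdge (y := y) (z := G.contraction y) rfl h₁ ?_ e₁ h₂.symm ?_ h₄.symm
      · rw [← e₁]
        exact (hdef y₁ hy₁).2.1
      · intro h
        rw [hy₁def, ← h, flip_flip] at hne₁
        exact hne₁ rfl
    · have hthree : ∑ w ∈ ({y, y₁, y₂} : Finset G.Line), share w ≤ ∑ w ∈ T, share w := by
        refine Finset.sum_le_sum_of_subset_of_nonneg ?_ fun w hw _ => hnn w hw
        intro w hw
        simp only [Finset.mem_insert, Finset.mem_singleton] at hw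
        rcases hw with rfl | rfl | rfl <;> assumption
      rw [Finset.sum_insert (by
        simp only [Finset.mem_insert, Finset.mem_singleton, not_or]
        exact ⟨hne₁.symm, fun h => hyy h.symm⟩), Finset.sum_pair hne₂.symm] at hthree
      linarith [third_le_share y, third_le_share y₁, third_le_share y₂]
  · push Not at hdef
    obtain ⟨w, hw, hwd⟩ := hdef
    have hshare : 2 / 3 ≤ share w := by
      unfold share
      by_cases hl : IsSelfLoop w
      · rw [if_pos hl]; norm_num
      · rw [if_neg hl, if_neg (hwd hl)]
    by_cases hone : ∃ w' ∈ T, w' ≠ w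
    · obtain ⟨w', hw', hne⟩ := hone
      linarith [hpair hw' hw hne, third_le_share w']
    · push Not at hone
      obtain ⟨hwo, hwk, hwf⟩ := hmem.1 hw
      obtain ⟨h, hs, ho, hc, hf⟩ := hwo.1.exists_arc (Equiv.Perm.SameCycle.refl _ w) hwo
      rw [hwk] at hc hf
      have hh := hone (flip h) (hmem.2 ⟨ho.flip, hc, hf.trans hwf⟩)
      have hloop : IsSelfLoop w := by
        rw [flip_eq_iff] at hh
        rw [IsSelfLoop, ← hh]
        exact hs
      have h1 : share w = 1 := by
        unfold share
        rw [if_pos hloop]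
      rw [← h1]
      exact Finset.single_le_sum hnn hw

open Classical in
/-- The decrease of a reduced line, in powers of its largest index, which is left once the growth of
the tadpole or of the graph `M₂` attached at its start is taken into account. The propagator provides
`47/24`; a tadpole takes `2 · 13/24` and a graph `M₂` takes `2 · 5/48`. -/
noncomputable def capacity (y : G.Line) : ℝ :=
  if IsLeaf (flip y) then 21 / 24 else if IsOuter (flip y) then 42 / 24 else 47 / 24

theorem capacity_nonneg (y : G.Line) : 0 ≤ capacity y := by
  unfold capacity
  split_ifs <;> norm_num

theorem IsOrdinary.capacity_eq {y : G.Line} (h : IsOrdinary y) : capacity y = 47 / 24 := by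
  unfold capacity
  rw [if_neg h.2.1, if_neg h.2.2.1]

open Classical in
/-- The part of the capacity of a line which is not used by the face of its own colour. -/
noncomputable def residue (y : G.Line) : ℝ :=
  capacity y - if IsOrdinary y then 101 / 100 * share y else 0

theorem residue_nonneg (y : G.Line) : 0 ≤ residue y := by
  unfold residue
  split_ifs with h
  · rw [h.capacity_eq]
    linarith [share_le_one y]
  · linarith [capacity_nonneg y]

open Classical in
/-- The colours `k` such that no ordinary line of the cycle of `x` has colour `k`. The face of such a
colour through `x` contains the whole cycle. -/
noncomputable def absentColours (x : G.Line) : Finset (Fin 4) :=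
  Finset.univ.filter fun k => ∀ e ∈ corners x, IsOrdinary e → G.colour e.1 ≠ k

theorem mem_absentColours {x : G.Line} {k : Fin 4} :
    k ∈ absentColours x ↔ ∀ e ∈ corners x, IsOrdinary e → G.colour e.1 ≠ k := by
  simp [absentColours]

theorem card_absentColours_le_four (x : G.Line) : (absentColours x).card ≤ 4 :=
  (Finset.card_le_univ _).trans (by simp)

theorem card_absentColours_le_three {x e : G.Line} (he : e ∈ corners x) (ho : IsOrdinary e) :
    (absentColours x).card ≤ 3 := by
  have hsub : absentColours x ⊆ Finset.univ.erase (G.colour e.1) := by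
    intro k hk
    refine Finset.mem_erase.2 ⟨?_, Finset.mem_univ _⟩
    exact fun h => mem_absentColours.1 hk e he ho h.symm
  refine (Finset.card_le_card hsub).trans ?_
  rw [Finset.card_erase_of_mem (Finset.mem_univ _)]
  simp

theorem card_absentColours_le_two {x e e' : G.Line} (he : e ∈ corners x) (ho : IsOrdinary e)
    (he' : e' ∈ corners x) (ho' : IsOrdinary e') (hne : G.colour e.1 ≠ G.colour e'.1) :
    (absentColours x).card ≤ 2 := by
  have hsub : absentColours x ⊆ (Finset.univ.erase (G.colour e.1)).erase (G.colour e'.1) := by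
    intro k hk
    refine Finset.mem_erase.2 ⟨?_, Finset.mem_erase.2 ⟨?_, Finset.mem_univ _⟩⟩
    · exact fun h => mem_absentColours.1 hk e' he' ho' h.symm
    · exact fun h => mem_absentColours.1 hk e he ho h.symm
  refine (Finset.card_le_card hsub).trans ?_
  rw [Finset.card_erase_of_mem (Finset.mem_erase.2 ⟨hne.symm, Finset.mem_univ _⟩),
    Finset.card_erase_of_mem (Finset.mem_univ _)]
  simp

theorem corners_eq_of_mem {x y : G.Line} (h : y ∈ corners x) : corners y = corners x := by
  ext e
  rw [mem_corners, mem_corners]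
  exact ⟨(mem_corners.1 h).trans, (mem_corners.1 h).symm.trans⟩

theorem absentColours_eq_of_mem {x y : G.Line} (h : y ∈ corners x) :
    absentColours y = absentColours x := by
  unfold absentColours
  rw [corners_eq_of_mem h]

/-- What is left at a vertex of the intermediate field map pays for the faces of absent colour. -/
theorem NoDivergentComponent.card_absentColours_le (hG : G.NoDivergentComponent) {x : G.Line}
    (hx : IsReduced x) :
    101 / 100 * ((absentColours x).card : ℝ) ≤ ∑ e ∈ corners x, residue e := by
  classical
  set C := corners x with hC
  set O := C.filter IsOrdinary with hO
  set D₁ := C.filter fun e => IsLeaf (flip e) with hD₁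
  set D₂ := C.filter fun e => IsOuter (flip e) with hD₂
  have hred : ∀ e ∈ C, IsReduced e := fun e he => hx.of_sameCycle (mem_corners.1 he)
  have hOC : ∀ {e}, e ∈ O → e ∈ C ∧ IsOrdinary e := fun he => Finset.mem_filter.1 he
  have hcases : ∀ e ∈ C, IsLeaf (flip e) ∨ IsOuter (flip e) ∨ IsOrdinary e := by
    intro e he
    rcases (hred e he).flip_cases with h | h | h
    · exact Or.inl h.1
    · exact Or.inr (Or.inl h)
    · exact Or.inr (Or.inr ⟨hred e he, h⟩)
  have hsum : ∑ e ∈ C, residue e = (47 / 24 * (O.card : ℝ) + 21 / 24 * (D₁.card : ℝ) +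
      42 / 24 * (D₂.card : ℝ)) - 101 / 100 * ∑ e ∈ O, share e := by
    have h₁ : ∀ e ∈ C, residue e = ((if IsOrdinary e then 47 / 24 else 0) +
        (if IsLeaf (flip e) then 21 / 24 else 0) + (if IsOuter (flip e) then 42 / 24 else 0)) -
        (if IsOrdinary e then 101 / 100 * share e else 0) := by
      intro e he
      unfold residue
      congr 1
      unfold capacity
      rcases hcases e he with h | h | h
      · have h' : ¬ IsOuter (flip e) := fun ho => ho.not_isLeaf h
        have h'' : ¬ IsOrdinary e := fun ho => ho.2.1 h
        simp [h, h', h'']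
      · have h' : ¬ IsLeaf (flip e) := h.not_isLeaf
        have h'' : ¬ IsOrdinary e := fun ho => ho.2.2.1 h
        simp [h, h', h'']
      · have h' : ¬ IsLeaf (flip e) := h.2.1
        have h'' : ¬ IsOuter (flip e) := h.2.2.1
        simp [h, h', h'']
    rw [Finset.sum_congr rfl h₁, Finset.sum_sub_distrib, Finset.sum_add_distrib,
      Finset.sum_add_distrib, ← Finset.sum_filter, ← Finset.sum_filter, ← Finset.sum_filter,
      ← Finset.sum_filter, ← Finset.mul_sum]
    simp only [Finset.sum_const, nsmul_eq_mul, hO, hD₁, hD₂]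
    ring
  have hcard : C.card = O.card + D₁.card + D₂.card := by
    have h₁ : ∀ e ∈ C, 1 = (if IsOrdinary e then 1 else 0) +
        (if IsLeaf (flip e) then 1 else 0) + (if IsOuter (flip e) then 1 else 0) := by
      intro e he
      rcases hcases e he with h | h | h
      · have h' : ¬ IsOuter (flip e) := fun ho => ho.not_isLeaf h
        have h'' : ¬ IsOrdinary e := fun ho => ho.2.1 h
        simp [h, h', h'']
      · have h' : ¬ IsLeaf (flip e) := h.not_isLeaf
        have h'' : ¬ IsOrdinary e := fun ho => ho.2.2.1 h
        simp [h, h', h'']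
      · have h' : ¬ IsLeaf (flip e) := h.2.1
        have h'' : ¬ IsOuter (flip e) := h.2.2.1
        simp [h, h', h'']
    rw [Finset.card_eq_sum_ones, Finset.sum_congr rfl h₁, Finset.sum_add_distrib,
      Finset.sum_add_distrib, ← Finset.card_filter, ← Finset.card_filter, ← Finset.card_filter]
  have hloopO : ∀ {e}, e ∈ O → IsSelfLoop e → flip e ∈ O := by
    intro e he hl
    refine Finset.mem_filter.2 ⟨?_, (hOC he).2.flip⟩
    exact mem_corners.2 ((mem_corners.1 (hOC he).1).trans hl)
  have hσC : ∀ {e}, e ∈ C → G.contraction e ∈ C := fun he => contraction_mem_corners he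
  have hnofix : ∀ {e}, e ∈ C → G.contraction e ≠ e := fun he => (hred _ he).1
  have hCO : D₁.card = 0 → D₂.card = 0 → C = O := by
    intro h₁ h₂
    refine (Finset.eq_of_subset_of_card_le (Finset.filter_subset _ _) ?_).symm
    rw [hcard, h₁, h₂]
    simp [hO]
  have hA4 : ((absentColours x).card : ℝ) ≤ 4 := by exact_mod_cast card_absentColours_le_four x
  have hA3 : ∀ {e}, e ∈ O → ((absentColours x).card : ℝ) ≤ 3 := fun he => by
    exact_mod_cast card_absentColours_le_three (hOC he).1 (hOC he).2
  have hA2 : ∀ {e e'}, e ∈ O → e' ∈ O → G.colour e.1 ≠ G.colour e'.1 →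
      ((absentColours x).card : ℝ) ≤ 2 := fun he he' hne => by
    exact_mod_cast card_absentColours_le_two (hOC he).1 (hOC he).2 (hOC he').1 (hOC he').2 hne
  -- `24 · 1.01 (∑ share + #absent colours) ≤ 47 q + 21 t` remains to be proved, where `q` is the number
  -- of ordinary lines of the cycle and `t` counts each tadpole once and each graph `M₂` twice
  rw [hsum]
  have hd₁ : (0 : ℝ) ≤ D₁.card := Nat.cast_nonneg _
  have hd₂ : (0 : ℝ) ≤ D₂.card := Nat.cast_nonneg _
  obtain hq | hq | hq | hq | hq : O.card = 0 ∨ O.card = 1 ∨ O.card = 2 ∨ O.card = 3 ∨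
    4 ≤ O.card := by omega
  · -- only tadpoles and graphs `M₂` are attached
    have hO0 : O = ∅ := Finset.card_eq_zero.1 hq
    have h5 := hG.five_le x fun e he => by
      rcases hcases e he with h | h | h
      · exact Or.inl h
      · exact Or.inr h
      · have : e ∈ O := Finset.mem_filter.2 ⟨he, h⟩
        simp [hO0] at this
    have h5' : 5 ≤ D₁.card + 2 * D₂.card := by
      have : C.card + D₂.card = (corners x).card +
        (open Classical in (corners x).filter fun e => IsOuter (flip e)).card := by
        congr!
      omega
    have h5'' : (5 : ℝ) ≤ D₁.card + 2 * D₂.card := by exact_mod_cast h5'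
    rw [hO0]
    simp only [Finset.card_empty, Finset.sum_empty, Nat.cast_zero]
    linarith
  · -- a single ordinary line: the cycle carries other lines, and more than a single tadpole
    obtain ⟨y, hy⟩ := Finset.card_eq_one.1 hq
    have hyO : y ∈ O := by simp [hy]
    obtain ⟨hyC, hyo⟩ := hOC hyO
    have hloop : ¬ IsSelfLoop y := by
      intro hl
      have := hloopO hyO hl
      rw [hy, Finset.mem_singleton] at this
      exact flip_ne y this
    have ht : 2 ≤ D₁.card + 2 * D₂.card := by
      by_contra! ht
      have h₂ : D₂.card = 0 := by omega
      obtain h₁ | h₁ : D₁.card = 0 ∨ D₁.card = 1 := by omega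
      · have := hσC hyC
        rw [hCO h₁ h₂, hy, Finset.mem_singleton] at this
        exact hnofix hyC this
      · -- the cycle has two lines, one of them with a tadpole: they are the outer lines of a graph `M₂`
        obtain ⟨e, he⟩ := Finset.card_eq_one.1 h₁
        have heD : e ∈ D₁ := by simp [he]
        obtain ⟨heC, hel⟩ := Finset.mem_filter.1 heD
        have hCe : ∀ {a}, a ∈ C → a = y ∨ a = e := by
          intro a ha
          rcases hcases a ha with h | h | h
          · have : a ∈ D₁ := Finset.mem_filter.2 ⟨ha, h⟩
            rw [he, Finset.mem_singleton] at this
            exact Or.inr this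
          · have : a ∈ D₂ := Finset.mem_filter.2 ⟨ha, h⟩
            rw [Finset.card_eq_zero.1 h₂] at this
            simp at this
          · have : a ∈ O := Finset.mem_filter.2 ⟨ha, h⟩
            rw [hy, Finset.mem_singleton] at this
            exact Or.inl this
        have hye : G.contraction y = e := (hCe (hσC hyC)).resolve_left (hnofix hyC)
        have hey : G.contraction e = y := (hCe (hσC heC)).resolve_right (hnofix heC)
        refine hyo.1.2.1 ⟨by rw [hye, hey], by rw [hye]; exact hel, ?_⟩
        intro h
        rcases eq_or_eq_flip h with h | h
        · exact hnofix hyC h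
        · rw [hye] at h
          rw [h, flip_flip] at hel
          exact hyo.1.1 hel
    have ht' : (2 : ℝ) ≤ D₁.card + 2 * D₂.card := by exact_mod_cast ht
    have hs := share_le_of_not_isSelfLoop hloop
    have := hA3 hyO
    rw [hy, Finset.sum_singleton, Finset.card_singleton]
    push_cast
    linarith
  · -- two ordinary lines: if they form a self-loop, the cycle carries more than a single tadpole; if
    -- they have the same colour and nothing else is attached, they are deficient
    obtain ⟨y, y', hne, hy⟩ := Finset.card_eq_two.1 hq
    have hyO : y ∈ O := by simp [hy]
    have hyO' : y' ∈ O := by simp [hy]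
    obtain ⟨hyC, hyo⟩ := hOC hyO
    obtain ⟨hyC', hyo'⟩ := hOC hyO'
    have hmemO : ∀ {a}, a ∈ O → a = y ∨ a = y' := by
      intro a ha
      rw [hy] at ha
      simpa using ha
    have hA := hA3 hyO
    rw [hq, hy, Finset.sum_pair hne]
    push_cast
    by_cases hloop : IsSelfLoop y ∨ IsSelfLoop y'
    · have hyy : y' = flip y := by
        rcases hloop with h | h
        · exact ((hmemO (hloopO hyO h)).resolve_left (flip_ne y)).symm
        · have := (hmemO (hloopO hyO' h)).resolve_right (flip_ne y')
          rw [← this, flip_flip]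
      subst hyy
      have ht : 2 ≤ D₁.card + 2 * D₂.card := by
        by_contra! ht
        have h₂ : D₂.card = 0 := by omega
        obtain h₁ | h₁ : D₁.card = 0 ∨ D₁.card = 1 := by omega
        · have hC' := hCO h₁ h₂
          have e₁ := (hmemO (hC' ▸ hσC hyC)).resolve_left (hnofix hyC)
          have e₂ := (hmemO (hC' ▸ hσC hyC')).resolve_right (hnofix hyC')
          exact hG.not_selfLoop e₁ e₂
        · obtain ⟨e, he⟩ := Finset.card_eq_one.1 h₁
          have heD : e ∈ D₁ := by simp [he]
          obtain ⟨heC, hel⟩ := Finset.mem_filter.1 heD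
          have hCe : ∀ {a}, a ∈ C → a = y ∨ a = flip y ∨ a = e := by
            intro a ha
            rcases hcases a ha with h | h | h
            · have : a ∈ D₁ := Finset.mem_filter.2 ⟨ha, h⟩
              rw [he, Finset.mem_singleton] at this
              exact Or.inr (Or.inr this)
            · have : a ∈ D₂ := Finset.mem_filter.2 ⟨ha, h⟩
              rw [Finset.card_eq_zero.1 h₂] at this
              simp at this
            · rcases hmemO (Finset.mem_filter.2 ⟨ha, h⟩) with h | h
              · exact Or.inl h
              · exact Or.inr (Or.inl h)
          have hey : e ≠ y := by
            rintro rfl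
            exact hyo.2.1 hel
          have hey' : e ≠ flip y := by
            rintro rfl
            rw [flip_flip] at hel
            exact hyo.1.1 hel
          -- a cycle of the contraction cannot avoid the third line
          have key : ∀ {a : G.Line}, a ∈ C → flip a ∈ C → e ≠ a → e ≠ flip a →
              (∀ {b}, b ∈ C → b = a ∨ b = flip a ∨ b = e) →
              G.contraction a = flip a → False := by
            intro a ha ha' hea hea' hall h₁
            have h₂ : G.contraction (flip a) = e := by
              rcases hall (hσC ha') with h | h | h
              · exfalso
                have : e ∈ ({a, flip a} : Set G.Line) := by
                  refine mem_of_sameCycle (f := G.contraction) (a := a) ?_ ?_ (by simp)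
                  · rintro b (rfl | rfl)
                    · simp [h₁]
                    · simp [h]
                  · exact (mem_corners.1 ha).symm.trans (mem_corners.1 heC)
                rcases this with h' | h'
                · exact hea h'
                · exact hea' h'
              · exact absurd h (hnofix ha')
              · exact h
            have h₃ : G.contraction e = a := by
              rcases hall (hσC heC) with h | h | h
              · exact h
              · exact absurd (G.contraction.injective (h.trans h₁.symm)) hea
              · exact absurd h (hnofix heC)
            exact hG.not_selfLoop_leaf h₁ h₂ h₃ hel
          rcases hCe (hσC hyC) with h | h | h
          · exact hnofix hyC h
          · exact key hyC hyC' hey hey' hCe h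
          · refine key hyC' (by rwa [flip_flip]) hey' (by rwa [flip_flip]) ?_ ?_
            · intro b hb
              rw [flip_flip]
              rcases hCe hb with h | h | h
              · exact Or.inr (Or.inl h)
              · exact Or.inl h
              · exact Or.inr (Or.inr h)
            · rw [flip_flip]
              rcases hCe (hσC hyC') with h' | h' | h'
              · exact h'
              · exact absurd h' (hnofix hyC')
              · exact absurd (G.contraction.injective (h'.trans h.symm)) (flip_ne y)
      have ht' : (2 : ℝ) ≤ D₁.card + 2 * D₂.card := by exact_mod_cast ht
      linarith [share_le_one y, share_le_one (flip y)]
    · push Not at hloop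
      have hs := share_le_of_not_isSelfLoop hloop.1
      have hs' := share_le_of_not_isSelfLoop hloop.2
      by_cases hcol : G.colour y.1 = G.colour y'.1
      · by_cases ht : D₁.card + 2 * D₂.card = 0
        · have hC' := hCO (by omega) (by omega)
          have e₁ := (hmemO (hC' ▸ hσC hyC)).resolve_left (hnofix hyC)
          have e₂ := (hmemO (hC' ▸ hσC hyC')).resolve_right (hnofix hyC')
          have s₁ : share y = 1 / 3 := by
            unfold share
            rw [if_neg hloop.1, if_pos]
            exact ⟨by rw [e₁, e₂], by rw [e₁]; exact hne.symm, by rw [e₁]; exact hyo',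
              by rw [e₁]; exact hcol.symm⟩
          have s₂ : share y' = 1 / 3 := by
            unfold share
            rw [if_neg hloop.2, if_pos]
            exact ⟨by rw [e₂, e₁], by rw [e₂]; exact hne, by rw [e₂]; exact hyo,
              by rw [e₂]; exact hcol⟩
          rw [s₁, s₂]
          linarith
        · have ht' : (1 : ℝ) ≤ D₁.card + 2 * D₂.card := by
            exact_mod_cast Nat.one_le_iff_ne_zero.2 ht
          linarith
      · have := hA2 hyO hyO' hcol
        linarith
  · obtain ⟨a, b, c, hab, hac, hbc, habc⟩ := Finset.card_eq_three.1 hq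
    have haO : a ∈ O := by simp [habc]
    have hbO : b ∈ O := by simp [habc]
    have hcO : c ∈ O := by simp [habc]
    have hmemO : ∀ {e}, e ∈ O → e = a ∨ e = b ∨ e = c := by
      intro e he
      rw [habc] at he
      simpa using he
    have hA := hA3 haO
    rw [hq, habc, Finset.sum_insert (by simp [hab, hac]), Finset.sum_pair hbc]
    push_cast
    have h1a := share_le_one a
    have h1b := share_le_one b
    have h1c := share_le_one c
    by_cases hcol : G.colour a.1 = G.colour b.1 ∧ G.colour a.1 = G.colour c.1
    · -- three half-edges cannot all belong to self-loops
      by_cases hall : IsSelfLoop a ∧ IsSelfLoop b ∧ IsSelfLoop c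
      · exfalso
        obtain ⟨la, lb, lc⟩ := hall
        have fa := (hmemO (hloopO haO la)).resolve_left (flip_ne a)
        have fb := hmemO (hloopO hbO lb)
        have fc := hmemO (hloopO hcO lc)
        have nb := flip_ne b
        have nc := flip_ne c
        rcases fa with fa | fa
        · have fb' : flip b = a := by rw [← fa, flip_flip]
          rcases fc with h | h | h
          · exact hbc (flip_injective (fb'.trans h.symm))
          · exact hac (flip_injective (fa.trans h.symm))
          · exact nc h
        · have fc' : flip c = a := by rw [← fa, flip_flip]
          rcases fb with h | h | h
          · exact hbc (flip_injective (h.trans fc'.symm))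
          · exact nb h
          · exact hab (flip_injective (fa.trans h.symm))
      · have : share a + share b + share c ≤ 8 / 3 := by
          by_cases la : IsSelfLoop a
          · by_cases lb : IsSelfLoop b
            · have := share_le_of_not_isSelfLoop (fun lc => hall ⟨la, lb, lc⟩)
              linarith
            · have := share_le_of_not_isSelfLoop lb
              linarith
          · have := share_le_of_not_isSelfLoop la
            linarith
        linarith
    · have : ((absentColours x).card : ℝ) ≤ 2 := by
        by_cases h : G.colour a.1 = G.colour b.1
        · exact hA2 haO hcO fun h' => hcol ⟨h, h'⟩
        · exact hA2 haO hbO h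
      linarith
  · obtain ⟨y, hy⟩ : O.Nonempty := Finset.card_pos.1 (by omega)
    have hA := hA3 hy
    have hs : ∑ e ∈ O, share e ≤ O.card := by
      simpa using Finset.sum_le_card_nsmul O share 1 fun e _ => share_le_one e
    have hq' : (4 : ℝ) ≤ O.card := by exact_mod_cast hq
    linarith

open Classical in
/-- How the capacity of a line is distributed among the faces of the four colours which run through
it. An ordinary line serves the face of its own colour first; the rest of the capacity is divided
equally among the absent colours. Any value slightly larger than `1` could stand for `101/100`. -/
noncomputable def allotment (y : G.Line) (k : Fin 4) : ℝ :=
  if IsOrdinary y ∧ G.colour y.1 = k then 101 / 100 * share y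
  else if k ∈ absentColours y then residue y / (absentColours y).card else 0

theorem allotment_nonneg (y : G.Line) (k : Fin 4) : 0 ≤ allotment y k := by
  have h₁ := third_le_share y
  have h₂ := residue_nonneg y
  unfold allotment
  split_ifs
  · linarith
  · positivity
  · exact le_rfl

theorem sum_allotment_le (y : G.Line) : ∑ k, allotment y k ≤ capacity y := by
  classical
  have hsplit : ∀ k, allotment y k =
      (if G.colour y.1 = k then (if IsOrdinary y then 101 / 100 * share y else 0) else 0) +
      if k ∈ absentColours y then residue y / (absentColours y).card else 0 := by
    intro k
    unfold allotment
    by_cases ho : IsOrdinary y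
    · by_cases hk : G.colour y.1 = k
      · have : k ∉ absentColours y := fun h => mem_absentColours.1 h y (self_mem_corners y) ho hk
        simp [ho, hk, this]
      · simp [hk]
    · simp [ho]
  rw [Finset.sum_congr rfl fun k _ => hsplit k, Finset.sum_add_distrib,
    Finset.sum_ite_eq Finset.univ (G.colour y.1), if_pos (Finset.mem_univ _), ← Finset.sum_filter]
  have h₁ : Finset.univ.filter (fun k => k ∈ absentColours y) = absentColours y := by
    ext k
    simp
  have h₂ : (absentColours y).card * (residue y / (absentColours y).card) ≤ residue y := by
    rcases Nat.eq_zero_or_pos (absentColours y).card with h | h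
    · rw [h]
      simpa using residue_nonneg y
    · have : (0 : ℝ) < (absentColours y).card := by exact_mod_cast h
      rw [mul_div_cancel₀ _ this.ne']
  rw [h₁, Finset.sum_const, nsmul_eq_mul]
  unfold residue at h₂ ⊢
  linarith

open Classical in
/-- Every reduced face is allotted more than the critical value one. -/
theorem NoDivergentComponent.le_sum_allotment (hG : G.NoDivergentComponent) {f : G.Face}
    (hf : IsReducedFace f) :
    101 / 100 ≤ ∑ y : G.Line with (IsReduced y ∧ G.faceOf y f.1 = f),
      allotment y f.1 := by
  obtain ⟨x, hx, hxf⟩ := hf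
  generalize f.1 = k at hxf
  subst hxf
  have hnn : ∀ y : G.Line, 0 ≤ allotment y k := fun y => allotment_nonneg y k
  by_cases hk : k ∈ absentColours x
  · calc (101 / 100 : ℝ) ≤ ∑ e ∈ corners x, allotment e k := by
          have hpos : (0 : ℝ) < (absentColours x).card := by
            exact_mod_cast Finset.card_pos.2 ⟨k, hk⟩
          have heq : ∀ e ∈ corners x, allotment e k = residue e / (absentColours x).card := by
            intro e he
            unfold allotment
            rw [if_neg (fun h => mem_absentColours.1 hk e he h.1 h.2), absentColours_eq_of_mem he,
              if_pos hk]
          rw [Finset.sum_congr rfl heq, ← Finset.sum_div, le_div_iff₀ hpos]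
          exact hG.card_absentColours_le hx
      _ ≤ _ := by
          refine Finset.sum_le_sum_of_subset_of_nonneg ?_ fun y _ _ => hnn y
          intro e he
          refine Finset.mem_filter.2 ⟨Finset.mem_univ _, hx.of_sameCycle (mem_corners.1 he), ?_⟩
          rcases hx.walk k (mem_corners.1 he) with ⟨h, hs, ho, hc, -⟩ | h
          · exact absurd hc (mem_absentColours.1 hk h (mem_corners.2 hs) ho)
          · exact h
  · rw [mem_absentColours] at hk
    push Not at hk
    obtain ⟨h₀, hh₀, ho₀, rfl⟩ := hk
    obtain ⟨h, -, ho, hc, hf⟩ := hx.exists_arc (mem_corners.1 hh₀) ho₀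
    have hsum := hG.one_le_sum_share ho.flip
    rw [flip_fst, hc, hf] at hsum
    -- the face leaves the cycle through an ordinary line, and the ordinary lines it follows pay for it
    calc (101 / 100 : ℝ) ≤ 101 / 100 * _ := le_mul_of_one_le_right (by norm_num) hsum
      _ = ∑ w : G.Line with (IsOrdinary w ∧ G.colour w.1 = G.colour h₀.1 ∧
            G.faceOf w (G.colour h₀.1) = G.faceOf x (G.colour h₀.1)),
            allotment w (G.colour h₀.1) := by
          rw [Finset.mul_sum]
          refine Finset.sum_congr rfl fun w hw => ?_
          obtain ⟨-, h₁, h₂, -⟩ := Finset.mem_filter.1 hw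
          unfold allotment
          rw [if_pos ⟨h₁, h₂⟩]
      _ ≤ _ := by
          refine Finset.sum_le_sum_of_subset_of_nonneg ?_ fun y _ _ => hnn y
          intro w hw
          obtain ⟨-, h₁, -, h₃⟩ := Finset.mem_filter.1 hw
          exact Finset.mem_filter.2 ⟨Finset.mem_univ _, h₁.1, h₃⟩

/-! ### Graphs with a divergent component -/

theorem mem_component_of_mem_vertices {v w : Fin G.order} {h : Finset G.Line}
    (hw : w ∈ G.vertices h) (hv : G.adjacency.Reachable v w) :
    ∃ l ∈ h, l ∈ G.component v := by
  obtain ⟨l, hl, rfl | rfl⟩ := hw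
  · exact ⟨l, hl, mem_component.2 hv⟩
  · exact ⟨l, hl, mem_component.2 (hv.trans (reachable_contraction l).symm)⟩

theorem reachable_of_mem_vertices_component {v w : Fin G.order}
    (hw : w ∈ G.vertices (G.component v)) : G.adjacency.Reachable v w := by
  obtain ⟨l, hl, rfl | rfl⟩ := hw
  · exact mem_component.1 hl
  · exact (mem_component.1 hl).trans (reachable_contraction l)

/-- A divergent graph is connected. -/
theorem IsDivergent.subset_component {h : Finset G.Line} (hh : G.IsDivergent h) {v : Fin G.order}
    {l : G.Line} (hl : l ∈ h) (hv : l ∈ G.component v) : h ⊆ G.component v := by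
  rcases hh with hh | hh | ⟨hh, -⟩
  · obtain ⟨l', -, rfl⟩ := isM1_iff.1 hh
    rw [Finset.mem_singleton] at hl
    subst hl
    simpa using hv
  · obtain ⟨u, hu, rfl⟩ := isM2_iff.1 hh
    have huv : u ∈ G.component v := by
      rcases mem_outerLines.1 hl with rfl | rfl | rfl
      · exact hv
      · rw [← hu.1]
        exact contraction_mem_component hv
      · rw [← hu.1]
        have := flip_mem_component hv
        rw [flip_flip] at this
        exact contraction_mem_component this
    intro a ha
    rcases mem_outerLines.1 ha with rfl | rfl | rfl
    · exact huv
    · exact contraction_mem_component huv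
    · exact flip_mem_component (contraction_mem_component huv)
  · obtain ⟨w, rfl⟩ := isComponent_iff.1 hh
    intro a ha
    rw [mem_component] at *
    exact hv.trans (hl.symm.trans ha)

theorem IsDivergent.subset_or_disjoint {h : Finset G.Line} (hh : G.IsDivergent h)
    (v : Fin G.order) :
    h ⊆ G.component v ∨ Disjoint (G.vertices h) (G.vertices (G.component v)) := by
  by_contra! hcon
  obtain ⟨h₁, h₂⟩ := hcon
  obtain ⟨w, hw, hwv⟩ := Set.not_disjoint_iff.1 h₂
  obtain ⟨l, hl, hlv⟩ :=
    mem_component_of_mem_vertices hw (reachable_of_mem_vertices_component hwv)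
  exact h₁ (hh.subset_component hl hlv)

open Classical in
/-- A divergent component may be added to any forest, since every divergent subgraph is either
contained in it or disjoint from it. -/
theorem IsForest.insert_component {F : Finset (Finset G.Line)} (hF : G.IsForest F)
    {v : Fin G.order} (hv : G.IsDivergent (G.component v)) :
    G.IsForest (insert (G.component v) F) := by
  refine ⟨fun g hg => ?_, fun g hg h hh => ?_⟩
  · rcases Finset.mem_insert.1 hg with rfl | hg
    · exact hv
    · exact hF.1 g hg
  · rcases Finset.mem_insert.1 hg with rfl | hg <;> rcases Finset.mem_insert.1 hh with rfl | hh
    · exact Or.inl le_rfl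
    · rcases (hF.1 h hh).subset_or_disjoint v with h' | h'
      · exact Or.inr (Or.inl h')
      · exact Or.inr (Or.inr h'.symm)
    · rcases (hF.1 g hg).subset_or_disjoint v with h' | h'
      · exact Or.inl h'
      · exact Or.inr (Or.inr h')
    · exact hF.2 g hg h hh

theorem IsForest.mono {F F' : Finset (Finset G.Line)} (hF : G.IsForest F) (h : F' ⊆ F) :
    G.IsForest F' :=
  ⟨fun g hg => hF.1 g (h hg), fun g hg g' hg' => hF.2 g (h hg) g' (h hg')⟩

open Classical in
/-- A vacuum graph has no external indices, so `τ_g` is the identity. -/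
theorem lineIndex_insert_component (F : Finset (Finset G.Line)) (v : Fin G.order)
    (n : G.Face → ℤ) (l : G.Line) :
    G.lineIndex (insert (G.component v) F) n l = G.lineIndex F n l := by
  funext k
  unfold lineIndex
  congr 1
  rw [eq_iff_iff]
  constructor
  · rintro ⟨g, hg, hl, hi⟩
    rcases Finset.mem_insert.1 hg with rfl | hg
    · exact absurd (isInternal_component hl k) hi
    · exact ⟨g, hg, hl, hi⟩
  · rintro ⟨g, hg, hl, hi⟩
    exact ⟨g, Finset.mem_insert_of_mem hg, hl, hi⟩

/-- A divergent component provides the factor `1 - τ_g = 0`. -/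
theorem renormalisedAmplitude_eq_zero {v : Fin G.order} (hv : G.IsDivergent (G.component v))
    (M : ℕ) (μ : G.ScaleAttribution) : G.renormalisedAmplitude M μ = 0 := by
  classical
  set g := G.component v with hg
  have hamp : ∀ F, G.forestAmplitude M (insert g F) μ = G.forestAmplitude M F μ := by
    intro F
    unfold forestAmplitude
    refine tsum_congr fun n => Finset.prod_congr rfl fun l _ => ?_
    congr 1
    convert lineIndex_insert_component F v n l
  unfold renormalisedAmplitude
  refine Finset.sum_involution
    (fun F _ => if g ∈ F then F.erase g else insert g F) ?_ ?_ ?_ ?_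
  · intro F _
    by_cases h : g ∈ F
    · have h₁ : G.forestAmplitude M F μ = G.forestAmplitude M (F.erase g) μ := by
        rw [← hamp (F.erase g), Finset.insert_erase h]
      have h₂ : (-1 : ℝ) ^ F.card = (-1) ^ (F.erase g).card * -1 := by
        rw [← pow_succ, Finset.card_erase_add_one h]
      rw [if_pos h, h₁, h₂]
      ring
    · rw [if_neg h, Finset.card_insert_of_notMem h, pow_succ, hamp]
      ring
  · intro F _ _
    by_cases h : g ∈ F
    · rw [if_pos h]
      intro h'
      rw [← h'] at h
      exact Finset.notMem_erase _ _ h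
    · rw [if_neg h]
      intro h'
      exact h (h' ▸ Finset.mem_insert_self g F)
  · intro F hF
    have hF := (Finset.mem_filter.1 hF).2
    refine Finset.mem_filter.2 ⟨Finset.mem_univ _, ?_⟩
    split_ifs with h
    · exact hF.mono (Finset.erase_subset _ _)
    · convert hF.insert_component hv
  · intro F _
    by_cases h : g ∈ F
    · simp [h]
    · simp [h]

/-! ### The forests of divergent two-point graphs -/

/-- The divergent two-point graphs, when no component is divergent: the graphs `M₁` which are not
inserted in a graph `M₂`, those which are, and the graphs `M₂`; the last two are labelled by the
outer line. -/
abbrev TwoPoint (G : VacuumGraph) : Type :=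
  {l : G.Line // IsBareLeaf l} ⊕ {u : G.Line // IsOuter u} ⊕ {u : G.Line // IsOuter u}

/-- The set of lines of a divergent two-point graph. -/
def TwoPoint.lines : G.TwoPoint → Finset G.Line
  | Sum.inl l => {l.1}
  | Sum.inr (Sum.inl u) => {flip (G.contraction u.1)}
  | Sum.inr (Sum.inr u) => outerLines u.1

/-- An outer line belongs to a single graph `M₂`. -/
theorem NoDivergentComponent.outerLines_injOn (hG : G.NoDivergentComponent) {u u' : G.Line}
    (h : IsOuter u) (h' : IsOuter u') (hu : u ∈ outerLines u') : u = u' := by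
  rcases mem_outerLines.1 hu with rfl | rfl | rfl
  · rfl
  · exact absurd h (hG.not_isOuter_contraction h')
  · exact absurd h'.2.1 h.not_isLeaf

theorem NoDivergentComponent.lines_injective (hG : G.NoDivergentComponent) :
    Function.Injective (TwoPoint.lines : G.TwoPoint → Finset G.Line) := by
  have hsing : ∀ {l u : G.Line}, IsOuter u → IsLeaf l → ({l} : Finset G.Line) ≠ outerLines u := by
    intro l u hu hl h
    have : u ∈ outerLines u := mem_outerLines.2 (Or.inl rfl)
    rw [← h, Finset.mem_singleton] at this
    exact hu.not_isLeaf (this ▸ hl)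
  have hbare : ∀ {l u : G.Line}, IsOuter u → IsBareLeaf l → l ≠ flip (G.contraction u) := by
    rintro l u hu hl rfl
    refine hl.2 ?_
    rwa [flip_flip, hu.1]
  rintro (⟨a, ha⟩ | ⟨a, ha⟩ | ⟨a, ha⟩) (⟨b, hb⟩ | ⟨b, hb⟩ | ⟨b, hb⟩) hab <;>
    simp only [TwoPoint.lines] at hab
  · rw [Finset.singleton_inj] at hab
    subst hab; rfl
  · exact absurd (Finset.singleton_inj.1 hab) (hbare hb ha)
  · exact absurd hab (hsing hb ha.1)
  · exact absurd (Finset.singleton_inj.1 hab).symm (hbare ha hb)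
  · rw [Finset.singleton_inj, flip_injective.eq_iff, G.contraction.injective.eq_iff] at hab
    subst hab; rfl
  · exact absurd hab (hsing hb ha.2.1)
  · exact absurd hab.symm (hsing ha hb.1)
  · exact absurd hab.symm (hsing ha hb.2.1)
  · have : a ∈ outerLines b := hab ▸ mem_outerLines.2 (Or.inl rfl)
    obtain rfl := hG.outerLines_injOn ha hb this
    rfl

theorem NoDivergentComponent.isDivergent_iff (hG : G.NoDivergentComponent) {g : Finset G.Line} :
    G.IsDivergent g ↔ ∃ i : G.TwoPoint, i.lines = g := by
  constructor
  · rintro (h | h | ⟨h, h'⟩)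
    · obtain ⟨l, hl, rfl⟩ := isM1_iff.1 h
      by_cases h₂ : IsOuter (G.contraction (flip l))
      · refine ⟨Sum.inr (Sum.inl ⟨_, h₂⟩), ?_⟩
        simp only [TwoPoint.lines]
        rw [G.contraction.injective h₂.1, flip_flip]
      · exact ⟨Sum.inl ⟨l, hl, h₂⟩, rfl⟩
    · obtain ⟨u, hu, rfl⟩ := isM2_iff.1 h
      exact ⟨Sum.inr (Sum.inr ⟨u, hu⟩), rfl⟩
    · exact absurd (hG g h) (not_lt.2 h')
  · rintro ⟨⟨l, hl⟩ | ⟨u, hu⟩ | ⟨u, hu⟩, rfl⟩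
    · exact Or.inl (isM1_iff.2 ⟨l, hl.1, rfl⟩)
    · exact Or.inl (isM1_iff.2 ⟨_, hu.2.1, rfl⟩)
    · exact Or.inr (Or.inl (isM2_iff.2 ⟨u, hu, rfl⟩))

theorem IsLeaf.vertices_singleton {l : G.Line} (h : IsLeaf l) {v : Fin G.order}
    (hv : v ∈ G.vertices {l}) : l.1 = v := by
  obtain ⟨a, ha, hav⟩ := hv
  rw [Finset.mem_singleton] at ha
  subst ha
  have h' : G.contraction a = a := h
  rwa [h', or_self] at hav

theorem IsOuter.vertices_outerLines {u : G.Line} (h : IsOuter u) {v : Fin G.order}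
    (hv : v ∈ G.vertices (outerLines u)) : u.1 = v ∨ (G.contraction u).1 = v := by
  obtain ⟨a, ha, hav⟩ := hv
  have h' : G.contraction (flip (G.contraction u)) = flip (G.contraction u) := h.2.1
  rcases mem_outerLines.1 ha with rfl | rfl | rfl
  · exact hav
  · rw [h.1] at hav
    exact hav.symm
  · rw [h', or_self] at hav
    exact Or.inr hav

/-- Divergent two-point graphs do not overlap. -/
theorem NoDivergentComponent.lines_nested_or_disjoint (hG : G.NoDivergentComponent)
    (i j : G.TwoPoint) : i.lines ⊆ j.lines ∨ j.lines ⊆ i.lines ∨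
      Disjoint (G.vertices i.lines) (G.vertices j.lines) := by
  have h₁₁ : ∀ {l l' : G.Line}, IsLeaf l → IsLeaf l' →
      ¬ Disjoint (G.vertices {l}) (G.vertices {l'}) → ({l} : Finset G.Line) ⊆ {l'} := by
    intro l l' hl hl' hd
    obtain ⟨v, hv, hv'⟩ := Set.not_disjoint_iff.1 hd
    rcases eq_or_eq_flip ((hl.vertices_singleton hv).trans (hl'.vertices_singleton hv').symm)
      with rfl | rfl
    · exact le_rfl
    · exact absurd hl (hG.not_isLeaf_flip hl')
  have h₁₂ : ∀ {l u : G.Line}, IsLeaf l → IsOuter u →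
      ¬ Disjoint (G.vertices {l}) (G.vertices (outerLines u)) →
      ({l} : Finset G.Line) ⊆ outerLines u := by
    intro l u hl hu hd
    obtain ⟨v, hv, hv'⟩ := Set.not_disjoint_iff.1 hd
    have e := hl.vertices_singleton hv
    rw [Finset.singleton_subset_iff, mem_outerLines]
    rcases hu.vertices_outerLines hv' with e' | e' <;>
      rcases eq_or_eq_flip (e.trans e'.symm) with rfl | rfl
    · exact Or.inl rfl
    · exact absurd hl (hG.not_isLeaf_flip_of_isOuter hu)
    · exact Or.inr (Or.inl rfl)
    · exact Or.inr (Or.inr rfl)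
  have h₂₂ : ∀ {u u' : G.Line}, IsOuter u → IsOuter u' →
      ¬ Disjoint (G.vertices (outerLines u)) (G.vertices (outerLines u')) →
      outerLines u ⊆ outerLines u' := by
    intro u u' hu hu' hd
    obtain ⟨v, hv, hv'⟩ := Set.not_disjoint_iff.1 hd
    suffices u = u' by rw [this]
    rcases hu.vertices_outerLines hv with e | e <;>
      rcases hu'.vertices_outerLines hv' with e' | e' <;>
      rcases eq_or_eq_flip (e.trans e'.symm) with h | h
    · exact h
    · exact absurd hu (h ▸ hG.not_isOuter_flip hu')
    · exact absurd hu (h ▸ hG.not_isOuter_contraction hu')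
    · exact absurd hu'.2.1 (h ▸ hu.not_isLeaf)
    · exact absurd hu' (h ▸ hG.not_isOuter_contraction hu)
    · refine absurd hu.2.1 ?_
      rw [h, flip_flip]
      exact hu'.not_isLeaf
    · exact G.contraction.injective h
    · exact absurd hu'.2.1 (h ▸ hu.not_isLeaf_contraction)
  by_cases hd : Disjoint (G.vertices i.lines) (G.vertices j.lines)
  · exact Or.inr (Or.inr hd)
  have hd' : ¬ Disjoint (G.vertices j.lines) (G.vertices i.lines) := fun h => hd h.symm
  rcases i with ⟨a, ha⟩ | ⟨a, ha⟩ | ⟨a, ha⟩ <;> rcases j with ⟨b, hb⟩ | ⟨b, hb⟩ | ⟨b, hb⟩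
  · exact Or.inl (h₁₁ ha.1 hb.1 hd)
  · exact Or.inl (h₁₁ ha.1 hb.2.1 hd)
  · exact Or.inl (h₁₂ ha.1 hb hd)
  · exact Or.inl (h₁₁ ha.2.1 hb.1 hd)
  · exact Or.inl (h₁₁ ha.2.1 hb.2.1 hd)
  · exact Or.inl (h₁₂ ha.2.1 hb hd)
  · exact Or.inr (Or.inl (h₁₂ hb.1 ha hd'))
  · exact Or.inr (Or.inl (h₁₂ hb.2.1 ha hd'))
  · exact Or.inl (h₂₂ ha hb hd)

open Classical in
/-- The forests are the sets of divergent two-point graphs. -/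
theorem NoDivergentComponent.sum_forests (hG : G.NoDivergentComponent)
    (f : Finset (Finset G.Line) → ℝ) :
    ∑ F : Finset (Finset G.Line) with G.IsForest F, f F =
      ∑ S : Finset G.TwoPoint, f (S.map ⟨TwoPoint.lines, hG.lines_injective⟩) := by
  set e : G.TwoPoint ↪ Finset G.Line := ⟨TwoPoint.lines, hG.lines_injective⟩ with he
  symm
  refine Finset.sum_bij (fun S _ => S.map e) (fun S _ => ?_)
    (fun S _ T _ h => Finset.map_injective e h) (fun F hF => ?_) (fun _ _ => rfl)
  · refine Finset.mem_filter.2 ⟨Finset.mem_univ _, fun g hg => ?_, fun g hg h hh => ?_⟩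
    · obtain ⟨i, -, rfl⟩ := Finset.mem_map.1 hg
      exact hG.isDivergent_iff.2 ⟨i, rfl⟩
    · obtain ⟨i, -, rfl⟩ := Finset.mem_map.1 hg
      obtain ⟨j, -, rfl⟩ := Finset.mem_map.1 hh
      exact hG.lines_nested_or_disjoint i j
  · have hF' := (Finset.mem_filter.1 hF).2
    have hsub : F ⊆ Finset.univ.map e := by
      intro g hg
      obtain ⟨i, rfl⟩ := hG.isDivergent_iff.1 (hF'.1 g hg)
      exact Finset.mem_map.2 ⟨i, Finset.mem_univ _, rfl⟩
    obtain ⟨S, -, rfl⟩ := Finset.subset_map_iff.1 hsub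
    exact ⟨S, Finset.mem_univ _, rfl⟩

/-! ### Action of the forests on the indices -/

theorem IsLeaf.isInternal_singleton_iff {l : G.Line} (h : IsLeaf l) {k : Fin 4} :
    G.IsInternal {l} (G.faceOf l k) ↔ k ≠ G.colour l.1 := by
  constructor
  · rintro hi rfl
    have := hi (flip l) h.faceOf_flip
    rw [Finset.mem_singleton] at this
    exact flip_ne l this
  · intro hk l' hl'
    rw [Finset.mem_singleton]
    exact h.eq_of_sameCycle_facePerm hk (faceOf_eq_iff.1 hl'.symm)

theorem IsOuter.isInternal_outerLines_iff {u : G.Line} (h : IsOuter u) {k : Fin 4} :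
    G.IsInternal (outerLines u) (G.faceOf u k) ↔ k ≠ G.colour u.1 := by
  constructor
  · rintro hi rfl
    rcases mem_outerLines.1 (hi (flip u) h.faceOf_flip) with h' | h' | h'
    · exact flip_ne u h'
    · exact h.flip_ne_contraction h'
    · exact h.contraction_ne (flip_injective h').symm
  · intro hk l' hl'
    exact h.mem_of_sameCycle_facePerm hk (mem_outerLines.2 (Or.inl rfl)) (faceOf_eq_iff.1 hl'.symm)

theorem IsOuter.faceOf_tadpole {u : G.Line} (h : IsOuter u) :
    G.faceOf (flip (G.contraction u)) (G.colour (G.contraction u).1) =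
      G.faceOf u (G.colour (G.contraction u).1) := by
  have := h.2.1.faceOf_flip
  rw [flip_flip, h.faceOf_contraction] at this
  exact this.symm

theorem IsOuter.isInternal_outerLines_tadpole_iff {u : G.Line} (h : IsOuter u) {k : Fin 4} :
    G.IsInternal (outerLines u) (G.faceOf (flip (G.contraction u)) k) ↔
      ¬ (k = G.colour (G.contraction u).1 ∧ k = G.colour u.1) := by
  by_cases hk : k = G.colour (G.contraction u).1
  · subst hk
    rw [h.faceOf_tadpole, h.isInternal_outerLines_iff]
    simp
  · refine iff_of_true (fun l' hl' => ?_) fun h' => hk h'.1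
    have := h.2.1.eq_of_sameCycle_facePerm (k := k) hk (faceOf_eq_iff.1 hl'.symm)
    rw [this]
    exact mem_outerLines.2 (Or.inr (Or.inr rfl))

/-- The indices of the four faces which run through the line `l`. -/
def indices (n : G.Face → ℤ) (l : G.Line) (k : Fin 4) : ℤ := n (G.faceOf l k)

/-- The operators `τ_g` set the index of colour `k` to `0` on the line `l`. -/
def IsZeroed (S : Finset G.TwoPoint) (l : G.Line) (k : Fin 4) : Prop :=
  ∃ i ∈ S, l ∈ i.lines ∧ ¬ G.IsInternal i.lines (G.faceOf l k)

open Classical in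
theorem NoDivergentComponent.lineIndex_map (hG : G.NoDivergentComponent) (S : Finset G.TwoPoint)
    (n : G.Face → ℤ) (l : G.Line) (k : Fin 4) :
    G.lineIndex (S.map ⟨TwoPoint.lines, hG.lines_injective⟩) n l k =
      if IsZeroed S l k then 0 else indices n l k := by
  unfold lineIndex
  congr 1
  rw [eq_iff_iff]
  constructor
  · rintro ⟨g, hg, h⟩
    obtain ⟨i, hi, rfl⟩ := Finset.mem_map.1 hg
    exact ⟨i, hi, h⟩
  · rintro ⟨i, hi, h⟩
    exact ⟨i.lines, Finset.mem_map.2 ⟨i, hi, rfl⟩, h⟩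

theorem IsReduced.not_mem_lines {l : G.Line} (h : IsReduced l) (i : G.TwoPoint) : l ∉ i.lines := by
  rcases i with ⟨a, ha⟩ | ⟨a, ha⟩ | ⟨a, ha⟩ <;> simp only [TwoPoint.lines, Finset.mem_singleton]
  · rintro rfl
    exact h.1 ha.1
  · rintro rfl
    exact h.1 ha.2.1
  · intro hl
    rcases mem_outerLines.1 hl with rfl | rfl | rfl
    · exact h.2.1 ha
    · refine h.2.2 ?_
      rwa [ha.1]
    · exact h.1 ha.2.1

theorem IsReduced.not_isZeroed {l : G.Line} (h : IsReduced l) (S : Finset G.TwoPoint)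
    (k : Fin 4) : ¬ IsZeroed S l k := by
  rintro ⟨i, -, hi, -⟩
  exact h.not_mem_lines i hi

theorem isZeroed_bareLeaf_iff (l : {l : G.Line // IsBareLeaf l}) (S : Finset G.TwoPoint)
    (k : Fin 4) : IsZeroed S l.1 k ↔ Sum.inl l ∈ S ∧ k = G.colour l.1.1 := by
  obtain ⟨l, hl⟩ := l
  constructor
  · rintro ⟨⟨a, ha⟩ | ⟨a, ha⟩ | ⟨a, ha⟩, hi, hmem, hint⟩ <;>
      simp only [TwoPoint.lines, Finset.mem_singleton] at hmem hint
    · subst hmem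
      rw [hl.1.isInternal_singleton_iff, not_not] at hint
      exact ⟨hi, hint⟩
    · subst hmem
      refine absurd ?_ hl.2
      rwa [flip_flip, ha.1]
    · exfalso
      rcases mem_outerLines.1 hmem with rfl | rfl | rfl
      · exact ha.not_isLeaf hl.1
      · exact ha.not_isLeaf_contraction hl.1
      · refine hl.2 ?_
        rwa [flip_flip, ha.1]
  · rintro ⟨hi, hk⟩
    refine ⟨_, hi, Finset.mem_singleton_self _, ?_⟩
    simp only [TwoPoint.lines]
    rw [hl.1.isInternal_singleton_iff, not_not]
    exact hk

theorem NoDivergentComponent.isZeroed_outer_iff (hG : G.NoDivergentComponent)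
    (u : {u : G.Line // IsOuter u}) (S : Finset G.TwoPoint) (k : Fin 4) :
    IsZeroed S u.1 k ↔ Sum.inr (Sum.inr u) ∈ S ∧ k = G.colour u.1.1 := by
  obtain ⟨u, hu⟩ := u
  constructor
  · rintro ⟨⟨a, ha⟩ | ⟨a, ha⟩ | ⟨a, ha⟩, hi, hmem, hint⟩ <;>
      simp only [TwoPoint.lines, Finset.mem_singleton] at hmem hint
    · exact absurd (hmem ▸ ha.1) hu.not_isLeaf
    · exact absurd (hmem ▸ ha.2.1) hu.not_isLeaf
    · obtain rfl := hG.outerLines_injOn hu ha hmem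
      rw [hu.isInternal_outerLines_iff, not_not] at hint
      exact ⟨hi, hint⟩
  · rintro ⟨hi, hk⟩
    refine ⟨_, hi, mem_outerLines.2 (Or.inl rfl), ?_⟩
    simp only [TwoPoint.lines]
    rw [hu.isInternal_outerLines_iff, not_not]
    exact hk

theorem NoDivergentComponent.isZeroed_contraction_iff (hG : G.NoDivergentComponent)
    (u : {u : G.Line // IsOuter u}) (S : Finset G.TwoPoint) (k : Fin 4) :
    IsZeroed S (G.contraction u.1) k ↔ Sum.inr (Sum.inr u) ∈ S ∧ k = G.colour u.1.1 := by
  obtain ⟨u, hu⟩ := u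
  constructor
  · rintro ⟨⟨a, ha⟩ | ⟨a, ha⟩ | ⟨a, ha⟩, hi, hmem, hint⟩ <;>
      simp only [TwoPoint.lines, Finset.mem_singleton] at hmem hint
    · exact absurd (hmem ▸ ha.1) hu.not_isLeaf_contraction
    · exact absurd (hmem ▸ ha.2.1) hu.not_isLeaf_contraction
    · have hua : u = a := by
        rcases mem_outerLines.1 hmem with h | h | h
        · exact absurd (h ▸ ha) (hG.not_isOuter_contraction hu)
        · exact G.contraction.injective h
        · exact absurd (h ▸ ha.2.1) hu.not_isLeaf_contraction
      subst hua
      rw [hu.faceOf_contraction, hu.isInternal_outerLines_iff, not_not] at hint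
      exact ⟨hi, hint⟩
  · rintro ⟨hi, hk⟩
    refine ⟨_, hi, mem_outerLines.2 (Or.inr (Or.inl rfl)), ?_⟩
    simp only [TwoPoint.lines]
    rw [hu.faceOf_contraction, hu.isInternal_outerLines_iff, not_not]
    exact hk

/-- The operator of a graph `M₂` acts on the inserted tadpole only if the external face of the graph
runs through the tadpole, that is, if both vertices have the same colour. -/
theorem isZeroed_tadpole_iff
    (u : {u : G.Line // IsOuter u}) (S : Finset G.TwoPoint) (k : Fin 4) :
    IsZeroed S (flip (G.contraction u.1)) k ↔
      (Sum.inr (Sum.inl u) ∈ S ∨ Sum.inr (Sum.inr u) ∈ S ∧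
        G.colour (G.contraction u.1).1 = G.colour u.1.1) ∧
          k = G.colour (G.contraction u.1).1 := by
  obtain ⟨u, hu⟩ := u
  constructor
  · rintro ⟨⟨a, ha⟩ | ⟨a, ha⟩ | ⟨a, ha⟩, hi, hmem, hint⟩ <;>
      simp only [TwoPoint.lines, Finset.mem_singleton] at hmem hint
    · subst hmem
      refine absurd ?_ ha.2
      rwa [flip_flip, hu.1]
    · rw [flip_injective.eq_iff, G.contraction.injective.eq_iff] at hmem
      subst hmem
      rw [hu.2.1.isInternal_singleton_iff, not_not] at hint
      exact ⟨Or.inl hi, hint⟩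
    · have hua : u = a := by
        rcases mem_outerLines.1 hmem with h | h | h
        · exact absurd (h ▸ hu.2.1) ha.not_isLeaf
        · exact absurd (h ▸ hu.2.1) ha.not_isLeaf_contraction
        · rwa [flip_injective.eq_iff, G.contraction.injective.eq_iff] at h
      subst hua
      rw [hu.isInternal_outerLines_tadpole_iff, not_not] at hint
      exact ⟨Or.inr ⟨hi, hint.1.symm.trans hint.2⟩, hint.1⟩
  · rintro ⟨hi | ⟨hi, hc⟩, hk⟩
    · refine ⟨_, hi, Finset.mem_singleton_self _, ?_⟩
      simp only [TwoPoint.lines]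
      rw [hu.2.1.isInternal_singleton_iff, not_not]
      exact hk
    · refine ⟨_, hi, mem_outerLines.2 (Or.inr (Or.inr rfl)), ?_⟩
      simp only [TwoPoint.lines]
      rw [hu.isInternal_outerLines_tadpole_iff, not_not]
      exact ⟨hk, hk.trans hc⟩

/-! ### Factorisation of the forest formula -/

/-- Every face runs through a line on which no operator `τ_g` sets its index to `0`. -/
theorem NoDivergentComponent.exists_not_isZeroed (hG : G.NoDivergentComponent)
    (S : Finset G.TwoPoint) (f : G.Face) : ∃ l k, G.faceOf l k = f ∧ ¬ IsZeroed S l k := by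
  rcases hG.face_cases f with ⟨l, k, hl, hk, rfl⟩ | ⟨u, k, hu, hk, rfl⟩ | ⟨l, hl, hf⟩
  · refine ⟨l, k, rfl, ?_⟩
    rintro ⟨i, -, hi, hint⟩
    refine hint fun l' hl' => ?_
    rw [hl.eq_of_sameCycle_facePerm hk (faceOf_eq_iff.1 hl'.symm)]
    exact hi
  · refine ⟨u, k, rfl, fun h => hk ?_⟩
    exact ((hG.isZeroed_outer_iff ⟨u, hu⟩ S k).1 h).2
  · exact ⟨l, f.1, hf, hl.not_isZeroed S f.1⟩

theorem sq_le_of_slicePropagator_ne_zero {M : ℕ} {i : ℕ+} {n : Fin 4 → ℤ}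
    (h : slicePropagator M i n ≠ 0) (k : Fin 4) : n k ^ 2 ≤ (M : ℤ) ^ (2 * (i : ℕ)) := by
  have hs : InSlice M i n := by
    by_contra hs
    exact h (if_neg hs)
  have := one_add_sq_le_symbol n k
  have h' : 1 + n k ^ 2 ≤ symbol n := by exact_mod_cast this
  have := hs.1
  linarith

open Classical in
/-- At fixed scales, only finitely many indices contribute. -/
theorem NoDivergentComponent.summable_forest (hG : G.NoDivergentComponent) (M : ℕ)
    (μ : G.ScaleAttribution) (S : Finset G.TwoPoint) :
    Summable fun n : G.Face → ℤ => ∏ l : G.Line, slicePropagator M (μ l)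
      (G.lineIndex (S.map ⟨TwoPoint.lines, hG.lines_injective⟩) n l) := by
  have : Fintype G.Face := Fintype.ofFinite _
  set B : ℤ := ∑ l : G.Line, (M : ℤ) ^ (2 * (μ l : ℕ)) with hB
  have hBl : ∀ l, (M : ℤ) ^ (2 * (μ l : ℕ)) ≤ B := fun l =>
    Finset.single_le_sum (f := fun l : G.Line => (M : ℤ) ^ (2 * (μ l : ℕ)))
      (fun _ _ => by positivity) (Finset.mem_univ l)
  -- the indices which contribute satisfy `n f ^ 2 ≤ B` for all the faces `f`
  refine summable_of_hasFiniteSupport ((Set.finite_Icc (fun _ : G.Face => -B) fun _ => B).subset ?_)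
  intro n hn
  have hne : ∀ l, slicePropagator M (μ l)
      (G.lineIndex (S.map ⟨TwoPoint.lines, hG.lines_injective⟩) n l) ≠ 0 := fun l =>
    Finset.prod_ne_zero_iff.1 hn l (Finset.mem_univ l)
  have hsq : ∀ f, n f ^ 2 ≤ B := by
    intro f
    obtain ⟨l, k, rfl, hz⟩ := hG.exists_not_isZeroed S f
    have := sq_le_of_slicePropagator_ne_zero (hne l) k
    rw [hG.lineIndex_map, if_neg hz] at this
    exact this.trans (hBl l)
  constructor
  · intro f
    have := hsq f
    change -B ≤ n f
    nlinarith [sq_nonneg (n f + 1), sq_nonneg (n f)]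
  · intro f
    have := hsq f
    change n f ≤ B
    nlinarith [sq_nonneg (n f - 1), sq_nonneg (n f)]

/-- The indices of the line `l`, with that of colour `k` set to `0`. -/
def zeroed (n : G.Face → ℤ) (l : G.Line) (k : Fin 4) : Fin 4 → ℤ :=
  Function.update (indices n l) k 0

open Classical in
theorem NoDivergentComponent.lineIndex_eq_of (hG : G.NoDivergentComponent) {S : Finset G.TwoPoint}
    {l : G.Line} {P : Prop} {c : Fin 4} (h : ∀ k, IsZeroed S l k ↔ P ∧ k = c) (n : G.Face → ℤ) :
    G.lineIndex (S.map ⟨TwoPoint.lines, hG.lines_injective⟩) n l =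
      if P then zeroed n l c else indices n l := by
  funext k
  rw [hG.lineIndex_map, h k]
  by_cases hP : P
  · by_cases hk : k = c
    · subst hk
      simp [hP, zeroed]
    · simp [hP, hk, zeroed]
  · simp [hP]

/-- The operators `τ_g` do not act on the reduced lines. -/
theorem NoDivergentComponent.lineIndex_reduced (hG : G.NoDivergentComponent)
    (S : Finset G.TwoPoint) {l : G.Line} (hl : IsReduced l) (n : G.Face → ℤ) :
    G.lineIndex (S.map ⟨TwoPoint.lines, hG.lines_injective⟩) n l = indices n l := by
  classical
  funext k
  rw [hG.lineIndex_map, if_neg (hl.not_isZeroed S k)]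

theorem indices_contraction {u : G.Line} (hu : IsOuter u) (n : G.Face → ℤ) :
    indices n (G.contraction u) = indices n u := by
  funext k
  rw [indices, indices, hu.faceOf_contraction]

open Classical in
/-- A sum over the subsets of a disjoint union factorises. -/
theorem sum_finset_prod {B U : Type*} [Fintype B] [Fintype U] (X : B → Prop → ℝ)
    (Y : U → Prop → Prop → ℝ) :
    ∑ S : Finset (B ⊕ U ⊕ U), (∏ b, X b (Sum.inl b ∈ S)) *
        ∏ u, Y u (Sum.inr (Sum.inl u) ∈ S) (Sum.inr (Sum.inr u) ∈ S) =
      (∏ b, (X b True + X b False)) *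
        ∏ u, (Y u True True + Y u True False + (Y u False True + Y u False False)) := by
  have hX : ∀ b, X b True + X b False = ∑ p : Prop, X b p := fun b => by
    rw [Fintype.univ_Prop]
    simp
  have hY : ∀ u, Y u True True + Y u True False + (Y u False True + Y u False False) =
      ∑ p : Prop × Prop, Y u p.1 p.2 := fun u => by
    rw [Fintype.sum_prod_type]
    simp [Fintype.univ_Prop]
  simp only [hX, hY, Finset.prod_univ_sum, Fintype.piFinset_univ]
  rw [Finset.sum_mul_sum, ← Fintype.sum_prod_type']
  let e : Finset (B ⊕ U ⊕ U) ≃ (B → Prop) × (U → Prop × Prop) :=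
    Fintype.finsetEquivSet.trans ((Equiv.sumArrowEquivProdArrow B (U ⊕ U) Prop).trans
      ((Equiv.refl _).prodCongr ((Equiv.sumArrowEquivProdArrow U U Prop).trans
        (Equiv.arrowProdEquivProdArrow U (fun _ => Prop) (fun _ => Prop)).symm)))
  refine Fintype.sum_equiv e _ _ fun S => ?_
  rfl

/-- The factor `1 - τ` applied to a tadpole of scale `i`. -/
noncomputable def tadpoleFactor (M : ℕ) (i : ℕ+) (n : G.Face → ℤ) (l : G.Line) : ℝ :=
  slicePropagator M i (indices n l) - slicePropagator M i (zeroed n l (G.colour l.1))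

open Classical in
/-- The factor of the two outer lines of a graph `M₂`. The external index of a graph `M₂` with two
vertices of the same colour runs through the inserted tadpole as well; then the renormalisation of
the tadpole is enough. -/
noncomputable def outerFactor (M : ℕ) (i j : ℕ+) (n : G.Face → ℤ) (u : G.Line) : ℝ :=
  if G.colour (G.contraction u).1 = G.colour u.1 then
    slicePropagator M i (indices n u) * slicePropagator M j (indices n u)
  else slicePropagator M i (indices n u) * slicePropagator M j (indices n u) -
    slicePropagator M i (zeroed n u (G.colour u.1)) *
      slicePropagator M j (zeroed n u (G.colour u.1))

open Classical in
/-- The forest formula factorises. -/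
theorem NoDivergentComponent.sum_forest_integrand (hG : G.NoDivergentComponent) (M : ℕ)
    (μ : G.ScaleAttribution) (n : G.Face → ℤ) :
    ∑ S : Finset G.TwoPoint, (-1 : ℝ) ^ S.card * ∏ l : G.Line, slicePropagator M (μ l)
        (G.lineIndex (S.map ⟨TwoPoint.lines, hG.lines_injective⟩) n l) =
      (∏ l : {l : G.Line // IsBareLeaf l}, tadpoleFactor M (μ l) n l) *
        ((∏ u : {u : G.Line // IsOuter u}, outerFactor M (μ u) (μ (G.contraction u)) n u *
          tadpoleFactor M (μ (flip (G.contraction u))) n (flip (G.contraction u))) *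
        ∏ l : {l : G.Line // IsReduced l}, slicePropagator M (μ l) (indices n l)) := by
  obtain ⟨sgn, hsgn⟩ : ∃ sgn : Prop → ℝ, ∀ p, sgn p = if p then -1 else 1 := ⟨_, fun _ => rfl⟩
  obtain ⟨sel, hsel⟩ : ∃ sel : Prop → (Fin 4 → ℤ) → (Fin 4 → ℤ) → Fin 4 → ℤ,
    ∀ p a b, sel p a b = if p then a else b := ⟨_, fun _ _ _ => rfl⟩
  set X : {l : G.Line // IsBareLeaf l} → Prop → ℝ := fun l p =>
    sgn p * slicePropagator M (μ l) (sel p (zeroed n l (G.colour l.1.1)) (indices n l)) with hX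
  set Y : {u : G.Line // IsOuter u} → Prop → Prop → ℝ := fun u p q =>
    (sgn p * sgn q) *
      (slicePropagator M (μ u) (sel q (zeroed n u (G.colour u.1.1)) (indices n u)) *
        slicePropagator M (μ (G.contraction u))
          (sel q (zeroed n u (G.colour u.1.1)) (indices n u)) *
        slicePropagator M (μ (flip (G.contraction u)))
          (sel (p ∨ q ∧ G.colour (G.contraction u).1 = G.colour u.1.1)
            (zeroed n (flip (G.contraction u)) (G.colour (G.contraction u.1).1))
            (indices n (flip (G.contraction u))))) with hY
  have hterm : ∀ S : Finset G.TwoPoint, (-1 : ℝ) ^ S.card * ∏ l : G.Line, slicePropagator M (μ l)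
        (G.lineIndex (S.map ⟨TwoPoint.lines, hG.lines_injective⟩) n l) =
      ((∏ l, X l (Sum.inl l ∈ S)) *
        ∏ u, Y u (Sum.inr (Sum.inl u) ∈ S) (Sum.inr (Sum.inr u) ∈ S)) *
        ∏ l : {l : G.Line // IsReduced l}, slicePropagator M (μ l) (indices n l) := by
    intro S
    have hsign : (-1 : ℝ) ^ S.card = ∏ i : G.TwoPoint, sgn (i ∈ S) := by
      have : ∏ i : G.TwoPoint, sgn (i ∈ S) = ∏ i : G.TwoPoint, if i ∈ S then (-1 : ℝ) else 1 :=
        Finset.prod_congr rfl fun i _ => by rw [hsgn]; congr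
      rw [this, Finset.prod_ite_mem, Finset.univ_inter, Finset.prod_const]
    rw [hsign, hG.prod_lines, Fintype.prod_sum_type, Fintype.prod_sum_type]
    have h₁ : ∀ l : {l : G.Line // IsBareLeaf l},
        G.lineIndex (S.map ⟨TwoPoint.lines, hG.lines_injective⟩) n l =
          sel (Sum.inl l ∈ S) (zeroed n l (G.colour l.1.1)) (indices n l) := fun l => by
      rw [hG.lineIndex_eq_of (isZeroed_bareLeaf_iff l S) n, hsel]
    have h₂ : ∀ u : {u : G.Line // IsOuter u},
        G.lineIndex (S.map ⟨TwoPoint.lines, hG.lines_injective⟩) n u =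
          sel (Sum.inr (Sum.inr u) ∈ S) (zeroed n u (G.colour u.1.1)) (indices n u) := fun u => by
      rw [hG.lineIndex_eq_of (hG.isZeroed_outer_iff u S) n, hsel]
    have h₃ : ∀ u : {u : G.Line // IsOuter u},
        G.lineIndex (S.map ⟨TwoPoint.lines, hG.lines_injective⟩) n (G.contraction u) =
          sel (Sum.inr (Sum.inr u) ∈ S) (zeroed n u (G.colour u.1.1)) (indices n u) := fun u => by
      rw [hG.lineIndex_eq_of (hG.isZeroed_contraction_iff u S) n, hsel, zeroed, zeroed,
        indices_contraction u.2]
    have h₄ : ∀ u : {u : G.Line // IsOuter u},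
        G.lineIndex (S.map ⟨TwoPoint.lines, hG.lines_injective⟩) n (flip (G.contraction u)) =
          sel (Sum.inr (Sum.inl u) ∈ S ∨ Sum.inr (Sum.inr u) ∈ S ∧
            G.colour (G.contraction u.1).1 = G.colour u.1.1)
          (zeroed n (flip (G.contraction u)) (G.colour (G.contraction u.1).1))
          (indices n (flip (G.contraction u))) := fun u => by
      rw [hG.lineIndex_eq_of (isZeroed_tadpole_iff u S) n, hsel]
    simp only [hX, hY, h₁, h₂, h₃, h₄, fun l : {l : G.Line // IsReduced l} =>
      hG.lineIndex_reduced S l.2 n]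
    simp only [Finset.prod_mul_distrib]
    ring
  rw [Finset.sum_congr rfl fun S _ => hterm S, ← Finset.sum_mul, sum_finset_prod X Y, mul_assoc]
  congr 1
  · refine Finset.prod_congr rfl fun l _ => ?_
    simp only [hX, hsgn, hsel, if_true, if_false, tadpoleFactor]
    ring
  · congr 1
    refine Finset.prod_congr rfl fun u _ => ?_
    by_cases hc : G.colour (G.contraction u.1).1 = G.colour u.1.1
    · simp only [hY, hsgn, hsel, hc, if_true, if_false, tadpoleFactor, outerFactor, flip_fst,
        or_true, and_true, or_false]
      ring
    · simp only [hY, hsgn, hsel, hc, if_true, if_false, tadpoleFactor, outerFactor, flip_fst,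
        and_false, or_false]
      ring

open Classical in
/-- The bound on the contribution of each of the two outer lines of a graph `M₂`. -/
noncomputable def outerBound (M : ℕ) (i : ℕ+) (n : G.Face → ℤ) (u : G.Line) : ℝ :=
  if G.colour (G.contraction u).1 = G.colour u.1 then slicePropagator M i (indices n u)
  else sliceRoot M i (symbol (zeroed n u (G.colour u.1))) (symbol (indices n u))

theorem outerBound_nonneg (M : ℕ) (i : ℕ+) (n : G.Face → ℤ) (u : G.Line) :
    0 ≤ outerBound M i n u := by
  unfold outerBound
  split_ifs
  · exact slicePropagator_nonneg _ _ _
  · exact sliceRoot_nonneg _ _ _ _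

theorem abs_outerFactor_le {M : ℕ} (hM : 1 < M) (i j : ℕ+) (n : G.Face → ℤ) (u : G.Line) :
    |outerFactor M i j n u| ≤ outerBound M i n u * outerBound M j n u := by
  unfold outerFactor outerBound
  split_ifs
  · rw [abs_of_nonneg (mul_nonneg (slicePropagator_nonneg _ _ _) (slicePropagator_nonneg _ _ _))]
  · exact abs_mul_sub_mul_le_sliceRoot hM i j _ _

open Classical in
/-- The bound on the contribution of the line `l` at scale `i`, for each kind of line. -/
noncomputable def lineBound (M : ℕ) (i : ℕ+) (n : G.Face → ℤ) (l : G.Line) : ℝ :=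
  if IsLeaf l then |tadpoleFactor M i n l|
  else if IsOuter l then outerBound M i n l
  else if IsOuter (G.contraction l) then outerBound M i n (G.contraction l)
  else slicePropagator M i (indices n l)

theorem lineBound_nonneg (M : ℕ) (i : ℕ+) (n : G.Face → ℤ) (l : G.Line) :
    0 ≤ lineBound M i n l := by
  unfold lineBound
  split_ifs
  · exact abs_nonneg _
  · exact outerBound_nonneg _ _ _ _
  · exact outerBound_nonneg _ _ _ _
  · exact slicePropagator_nonneg _ _ _

theorem lineBound_of_isLeaf (M : ℕ) (i : ℕ+) (n : G.Face → ℤ) {l : G.Line} (h : IsLeaf l) :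
    lineBound M i n l = |tadpoleFactor M i n l| := if_pos h

theorem lineBound_of_isOuter (M : ℕ) (i : ℕ+) (n : G.Face → ℤ) {u : G.Line} (h : IsOuter u) :
    lineBound M i n u = outerBound M i n u := by
  rw [lineBound, if_neg h.not_isLeaf, if_pos h]

theorem NoDivergentComponent.lineBound_contraction (hG : G.NoDivergentComponent) (M : ℕ) (i : ℕ+)
    (n : G.Face → ℤ) {u : G.Line} (h : IsOuter u) :
    lineBound M i n (G.contraction u) = outerBound M i n u := by
  rw [lineBound, if_neg h.not_isLeaf_contraction, if_neg (hG.not_isOuter_contraction h), h.1,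
    if_pos h]

theorem lineBound_of_isReduced (M : ℕ) (i : ℕ+) (n : G.Face → ℤ) {l : G.Line} (h : IsReduced l) :
    lineBound M i n l = slicePropagator M i (indices n l) := by
  rw [lineBound, if_neg h.1, if_neg h.2.1, if_neg h.2.2]

open Classical in
/-- At fixed indices, the renormalised integrand is bounded by a product over the lines, each factor
of which depends only on the scale of its line. This is what allows to sum over the scales line by
line. -/
theorem NoDivergentComponent.abs_sum_forest_integrand_le (hG : G.NoDivergentComponent) {M : ℕ}
    (hM : 1 < M) (μ : G.ScaleAttribution) (n : G.Face → ℤ) :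
    |∑ S : Finset G.TwoPoint, (-1 : ℝ) ^ S.card * ∏ l : G.Line, slicePropagator M (μ l)
        (G.lineIndex (S.map ⟨TwoPoint.lines, hG.lines_injective⟩) n l)| ≤
      ∏ l : G.Line, lineBound M (μ l) n l := by
  rw [hG.sum_forest_integrand, hG.prod_lines, abs_mul, abs_mul, Finset.abs_prod, Finset.abs_prod,
    Finset.abs_prod]
  have h₁ : ∏ l : {l : G.Line // IsBareLeaf l}, |tadpoleFactor M (μ l) n l| =
      ∏ l : {l : G.Line // IsBareLeaf l}, lineBound M (μ l) n l :=
    Finset.prod_congr rfl fun l _ => (lineBound_of_isLeaf M _ n l.2.1).symm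
  have h₂ : ∏ l : {l : G.Line // IsReduced l}, |slicePropagator M (μ l) (indices n l)| =
      ∏ l : {l : G.Line // IsReduced l}, lineBound M (μ l) n l :=
    Finset.prod_congr rfl fun l _ => by
      rw [lineBound_of_isReduced M _ n l.2, abs_of_nonneg (slicePropagator_nonneg _ _ _)]
  rw [h₁, h₂]
  refine mul_le_mul_of_nonneg_left (mul_le_mul_of_nonneg_right ?_ ?_) ?_
  · refine Finset.prod_le_prod (fun _ _ => abs_nonneg _) fun u _ => ?_
    rw [abs_mul, lineBound_of_isOuter M _ n u.2, hG.lineBound_contraction M _ n u.2,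
      lineBound_of_isLeaf M _ n u.2.2.1]
    exact mul_le_mul_of_nonneg_right (abs_outerFactor_le hM _ _ n u) (abs_nonneg _)
  · exact Finset.prod_nonneg fun _ _ => lineBound_nonneg _ _ _ _
  · exact Finset.prod_nonneg fun _ _ => lineBound_nonneg _ _ _ _


/-- The sum over the scale of the weighted bound on the contribution of a line. -/
noncomputable def lineSum (M : ℕ) (n : G.Face → ℤ) (l : G.Line) : ℝ≥0∞ :=
  ∑' i : ℕ+, ENNReal.ofReal (scaleWeight M i * lineBound M i n l)

theorem NoDivergentComponent.abs_renormalisedAmplitude_le (hG : G.NoDivergentComponent) {M : ℕ}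
    (hM : 1 < M) (μ : G.ScaleAttribution) :
    ENNReal.ofReal |G.renormalisedAmplitude M μ| ≤
      ∑' n : G.Face → ℤ, ENNReal.ofReal (∏ l : G.Line, lineBound M (μ l) n l) := by
  classical
  have heq : G.renormalisedAmplitude M μ = ∑' n : G.Face → ℤ, ∑ S : Finset G.TwoPoint,
      (-1 : ℝ) ^ S.card * ∏ l : G.Line, slicePropagator M (μ l)
        (G.lineIndex (S.map ⟨TwoPoint.lines, hG.lines_injective⟩) n l) := by
    rw [Summable.tsum_finsetSum fun S _ => (hG.summable_forest M μ S).mul_left _]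
    unfold renormalisedAmplitude
    rw [hG.sum_forests fun F => (-1 : ℝ) ^ F.card * G.forestAmplitude M F μ]
    refine Finset.sum_congr rfl fun S _ => ?_
    rw [tsum_mul_left, Finset.card_map]
    rfl
  rw [heq, ← Real.enorm_eq_ofReal_abs]
  refine (enorm_tsum_le_tsum_enorm).trans ?_
  refine ENNReal.tsum_le_tsum fun n => ?_
  rw [Real.enorm_eq_ofReal_abs]
  exact ENNReal.ofReal_le_ofReal (hG.abs_sum_forest_integrand_le hM μ n)

/-- The sum over the scales and over the indices is bounded by a sum over the indices of a product
over the lines. -/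
theorem NoDivergentComponent.tsum_scales_le (hG : G.NoDivergentComponent) {M : ℕ} (hM : 1 < M) :
    ∑' μ : G.ScaleAttribution, ENNReal.ofReal (|G.renormalisedAmplitude M μ| *
      ∏ l : G.Line, scaleWeight M (μ l)) ≤ ∑' n : G.Face → ℤ, ∏ l : G.Line, lineSum M n l := by
  calc ∑' μ : G.ScaleAttribution, ENNReal.ofReal (|G.renormalisedAmplitude M μ| *
        ∏ l : G.Line, scaleWeight M (μ l))
      ≤ ∑' μ : G.ScaleAttribution, ∑' n : G.Face → ℤ,
          ∏ l : G.Line, ENNReal.ofReal (scaleWeight M (μ l) * lineBound M (μ l) n l) := by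
        refine ENNReal.tsum_le_tsum fun μ => ?_
        rw [ENNReal.ofReal_mul (abs_nonneg _), mul_comm]
        refine (mul_le_mul_right (hG.abs_renormalisedAmplitude_le hM μ) _).trans ?_
        rw [← ENNReal.tsum_mul_left]
        refine ENNReal.tsum_le_tsum fun n => le_of_eq ?_
        rw [ENNReal.ofReal_prod_of_nonneg fun l _ => scaleWeight_nonneg M _,
          ENNReal.ofReal_prod_of_nonneg fun l _ => lineBound_nonneg M _ n l,
          ← Finset.prod_mul_distrib]
        exact Finset.prod_congr rfl fun l _ =>
          (ENNReal.ofReal_mul (scaleWeight_nonneg M _)).symm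
    _ = ∑' n : G.Face → ℤ, ∑' μ : G.ScaleAttribution,
          ∏ l : G.Line, ENNReal.ofReal (scaleWeight M (μ l) * lineBound M (μ l) n l) :=
        ENNReal.tsum_comm
    _ ≤ _ := ENNReal.tsum_le_tsum fun n =>
        tsum_pi_prod_le fun l i => ENNReal.ofReal (scaleWeight M i * lineBound M i n l)

/-! ### Summation over the faces internal to two-point graphs -/

/-- The indices of the line `l` of the colours other than `c`. -/
def otherIndices (n : G.Face → ℤ) (l : G.Line) (c : Fin 4) : Fin 3 → ℤ :=
  fun j => n (G.faceOf l (c.succAbove j))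

theorem insertNth_otherIndices (n : G.Face → ℤ) (l : G.Line) (c : Fin 4) :
    c.insertNth (α := fun _ => ℤ) (n (G.faceOf l c)) (otherIndices n l c) = indices n l :=
  Fin.insertNth_self_removeNth c (indices n l)

theorem symbol_indices (n : G.Face → ℤ) (l : G.Line) (c : Fin 4) :
    symbol (indices n l) = symbol3 (otherIndices n l c) + n (G.faceOf l c) ^ 2 := by
  rw [← insertNth_otherIndices n l c, symbol_insertNth]

theorem symbol_zeroed (n : G.Face → ℤ) (l : G.Line) (c : Fin 4) :
    symbol (zeroed n l c) = symbol3 (otherIndices n l c) := by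
  have : zeroed n l c = c.insertNth (α := fun _ => ℤ) 0 (otherIndices n l c) := by
    rw [zeroed, ← insertNth_otherIndices n l c, Fin.update_insertNth]
  rw [this, symbol_insertNth]
  simp

theorem lineSum_of_isLeaf (M : ℕ) (n : G.Face → ℤ) {l : G.Line} (h : IsLeaf l) :
    lineSum M n l =
      tadpoleSum M (n (G.faceOf l (G.colour l.1))) (otherIndices n l (G.colour l.1)) := by
  unfold lineSum tadpoleSum
  refine tsum_congr fun i => ?_
  rw [lineBound_of_isLeaf M i n h, tadpoleFactor, slicePropagator_eq_sliceValue,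
    slicePropagator_eq_sliceValue, symbol_zeroed, symbol_indices n l (G.colour l.1)]

theorem tsum_outerBound (M : ℕ) (n : G.Face → ℤ) (u : G.Line) :
    ∑' i : ℕ+, ENNReal.ofReal (scaleWeight M i * outerBound M i n u) =
      outerSum M (G.colour u.1) (G.colour (G.contraction u).1) (n (G.faceOf u (G.colour u.1)))
        (otherIndices n u (G.colour u.1)) := by
  unfold outerSum outerBound
  split_ifs
  · refine tsum_congr fun i => ?_
    rw [slicePropagator_eq_sliceValue, symbol_indices n u (G.colour u.1)]
  · refine tsum_congr fun i => ?_
    rw [symbol_zeroed, symbol_indices n u (G.colour u.1)]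

/-- The three lines of a graph `M₂` together. The tadpole depends on the other faces only through the
index of its external face, which is the index of the outer lines of the same colour. -/
theorem NoDivergentComponent.lineSum_cluster (hG : G.NoDivergentComponent) (M : ℕ)
    (n : G.Face → ℤ) {u : G.Line} (h : IsOuter u) :
    lineSum M n u * lineSum M n (G.contraction u) * lineSum M n (flip (G.contraction u)) =
      clusterSum M (G.colour u.1) (G.colour (G.contraction u).1)
        (n (G.faceOf u (G.colour u.1))) (otherIndices n u (G.colour u.1))
        (otherIndices n (flip (G.contraction u)) (G.colour (G.contraction u).1)) := by
  have h₁ : lineSum M n u = outerSum M (G.colour u.1) (G.colour (G.contraction u).1)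
      (n (G.faceOf u (G.colour u.1))) (otherIndices n u (G.colour u.1)) := by
    rw [← tsum_outerBound]
    exact tsum_congr fun i => by rw [lineBound_of_isOuter M i n h]
  have h₂ : lineSum M n (G.contraction u) = lineSum M n u := by
    rw [h₁, ← tsum_outerBound]
    exact tsum_congr fun i => by rw [hG.lineBound_contraction M i n h]
  rw [h₂, h₁, lineSum_of_isLeaf M n h.2.1, clusterSum, pow_two, insertNth_otherIndices, flip_fst,
    h.faceOf_tadpole]
  rfl

/-- The indices of the reduced faces, those of the faces internal to the bare tadpoles, and, for each
graph `M₂`, those of the outer lines and those of the inserted tadpole, its external colour left out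
in each case. -/
abbrev Coordinates (G : VacuumGraph) : Type :=
  ({f : G.Face // IsReducedFace f} → ℤ) × ({l : G.Line // IsBareLeaf l} → Fin 3 → ℤ) ×
    ({u : G.Line // IsOuter u} → (Fin 3 → ℤ) × (Fin 3 → ℤ))

/-- The indices of the faces, read off from tadpoles, graphs `M₂` and reduced faces. -/
def coordinates (n : G.Face → ℤ) : G.Coordinates :=
  (fun f => n f, fun l => otherIndices n l (G.colour l.1.1), fun u =>
    (otherIndices n u (G.colour u.1.1),
      otherIndices n (flip (G.contraction u.1)) (G.colour (G.contraction u.1).1)))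

/-- Every face is reduced, internal to a tadpole, or internal to a graph `M₂`. -/
theorem NoDivergentComponent.coordinates_injective (hG : G.NoDivergentComponent) :
    Function.Injective (coordinates : (G.Face → ℤ) → G.Coordinates) := by
  intro n n' h
  have h₀ : ∀ f, IsReducedFace f → n f = n' f := fun f hf =>
    congrFun (congrArg Prod.fst h) ⟨f, hf⟩
  have h₁ : ∀ l, IsBareLeaf l → otherIndices n l (G.colour l.1) =
      otherIndices n' l (G.colour l.1) := fun l hl =>
    congrFun (congrArg (fun x => x.2.1) h) ⟨l, hl⟩
  have h₂ : ∀ u, IsOuter u → otherIndices n u (G.colour u.1) =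
      otherIndices n' u (G.colour u.1) := fun u hu =>
    congrArg (fun x : G.Coordinates => (x.2.2 ⟨u, hu⟩).1) h
  have h₃ : ∀ u, IsOuter u →
      otherIndices n (flip (G.contraction u)) (G.colour (G.contraction u).1) =
        otherIndices n' (flip (G.contraction u)) (G.colour (G.contraction u).1) := fun u hu =>
    congrArg (fun x : G.Coordinates => (x.2.2 ⟨u, hu⟩).2) h
  funext f
  rcases hG.face_cases f with ⟨l, k, hl, hk, rfl⟩ | ⟨u, k, hu, hk, rfl⟩ | hf
  · obtain ⟨j, rfl⟩ := Fin.exists_succAbove_eq hk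
    by_cases ho : IsOuter (G.contraction (flip l))
    · have := h₃ _ ho
      rw [G.contraction.injective ho.1, flip_flip, flip_fst] at this
      exact congrFun this j
    · exact congrFun (h₁ l ⟨hl, ho⟩) j
  · obtain ⟨j, rfl⟩ := Fin.exists_succAbove_eq hk
    exact congrFun (h₂ u hu) j
  · exact h₀ f hf

open Classical in
/-- The extension by zero of the indices of the reduced faces. -/
noncomputable def extend (r : {f : G.Face // IsReducedFace f} → ℤ) (f : G.Face) : ℤ :=
  if h : IsReducedFace f then r ⟨f, h⟩ else 0

theorem extend_apply (r : {f : G.Face // IsReducedFace f} → ℤ) {f : G.Face}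
    (h : IsReducedFace f) : extend r f = r ⟨f, h⟩ := dif_pos h

theorem lineSum_of_isReduced (M : ℕ) (n : G.Face → ℤ) {l : G.Line} (h : IsReduced l) :
    lineSum M n l =
      ∑' i : ℕ+, ENNReal.ofReal (scaleWeight M i * sliceValue M i (symbol (indices n l))) :=
  tsum_congr fun i => by rw [lineBound_of_isReduced M i n h, slicePropagator_eq_sliceValue]

open Classical in
/-- The summation over the indices of the faces internal to the divergent two-point graphs. Each of
these graphs leaves a power of its external index. -/
theorem exists_tsum_indices_le {M : ℕ} (hM : 1 < M) : ∃ K₁ K₂ : ℝ, 0 < K₁ ∧ 0 < K₂ ∧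
    ∀ G : VacuumGraph, G.NoDivergentComponent →
      ∑' n : G.Face → ℤ, ∏ l : G.Line, lineSum M n l ≤
        ∑' r : {f : G.Face // IsReducedFace f} → ℤ,
          (∏ l : {l : G.Line // IsBareLeaf l}, ENNReal.ofReal
            (K₁ * (1 + (extend r (G.faceOf l (G.colour l.1.1)) : ℝ) ^ 2) ^ (13 / 24 : ℝ))) *
          ((∏ u : {u : G.Line // IsOuter u}, ENNReal.ofReal
            (K₂ * (1 + (extend r (G.faceOf u (G.colour u.1.1)) : ℝ) ^ 2) ^ (5 / 48 : ℝ))) *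
          ∏ l : {l : G.Line // IsReduced l}, lineSum M (extend r) l) := by
  obtain ⟨K₁, hK₁, h₁⟩ := exists_tsum_tadpole_le hM
  obtain ⟨K₂, hK₂, h₂⟩ := exists_tsum_clusterSum_le hM
  refine ⟨K₁, K₂, hK₁, hK₂, fun G hG => ?_⟩
  set Φ : G.Coordinates → ℝ≥0∞ := fun x =>
    (∏ l : {l : G.Line // IsBareLeaf l},
      tadpoleSum M (extend x.1 (G.faceOf l (G.colour l.1.1))) (x.2.1 l)) *
    ((∏ u : {u : G.Line // IsOuter u}, clusterSum M (G.colour u.1.1)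
      (G.colour (G.contraction u.1).1) (extend x.1 (G.faceOf u (G.colour u.1.1)))
        (x.2.2 u).1 (x.2.2 u).2) *
    ∏ l : {l : G.Line // IsReduced l}, lineSum M (extend x.1) l) with hΦ
  have hterm : ∀ n : G.Face → ℤ, ∏ l : G.Line, lineSum M n l = Φ (coordinates n) := by
    intro n
    have hext : ∀ {f}, IsReducedFace f → extend (coordinates n).1 f = n f := fun h =>
      extend_apply _ h
    rw [hG.prod_lines, hΦ]
    refine congrArg₂ _ ?_ (congrArg₂ _ ?_ ?_)
    · refine Finset.prod_congr rfl fun l _ => ?_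
      rw [lineSum_of_isLeaf M n l.2.1, hext (hG.isReducedFace_of_isBareLeaf l.2)]
      rfl
    · refine Finset.prod_congr rfl fun u _ => ?_
      rw [hG.lineSum_cluster M n u.2, hext (hG.isReducedFace_of_isOuter u.2)]
      rfl
    · refine Finset.prod_congr rfl fun l _ => ?_
      have : indices (extend (coordinates n).1) l.1 = indices n l.1 := funext fun k =>
        hext (l.2.isReducedFace k)
      rw [lineSum_of_isReduced M _ l.2, lineSum_of_isReduced M _ l.2, this]
  calc ∑' n : G.Face → ℤ, ∏ l : G.Line, lineSum M n l
      = ∑' n : G.Face → ℤ, Φ (coordinates n) := tsum_congr hterm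
    _ ≤ ∑' x, Φ x := ENNReal.tsum_comp_le_tsum_of_injective hG.coordinates_injective Φ
    _ = ∑' r, ∑' p, ∑' w, Φ (r, p, w) := by
        rw [ENNReal.tsum_prod']
        exact tsum_congr fun r => ENNReal.tsum_prod'
    _ ≤ _ := by
        refine ENNReal.tsum_le_tsum fun r => ?_
        simp only [hΦ, ENNReal.tsum_mul_left, ENNReal.tsum_mul_right]
        gcongr
        · refine (tsum_pi_prod_le _).trans ?_
          gcongr
          exact h₁ _
        · refine (tsum_pi_prod_le fun (u : {u : G.Line // IsOuter u})
            (w : (Fin 3 → ℤ) × (Fin 3 → ℤ)) => clusterSum M (G.colour u.1.1)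
            (G.colour (G.contraction u.1).1) (extend r (G.faceOf u (G.colour u.1.1)))
            w.1 w.2).trans ?_
          gcongr
          exact h₂ _ _ _

/-! ### Summation over the reduced faces -/

open Classical in
/-- What is attached at the start of the reduced lines is attributed to these lines. -/
theorem prod_subtype_flip {P : G.Line → Prop} (hP : ∀ l, P l → IsReduced (flip l))
    (φ : G.Line → ℝ≥0∞) :
    ∏ l : {l : G.Line // P l}, φ l =
      ∏ y : {l : G.Line // IsReduced l}, if P (flip y) then φ (flip y) else 1 := by
  refine Fintype.prod_of_injective (fun l => ⟨flip l.1, hP l.1 l.2⟩) ?_ _ _ ?_ ?_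
  · intro a b h
    exact Subtype.ext (flip_injective (congrArg Subtype.val h))
  · rintro ⟨y, hy⟩ hr
    refine if_neg fun h => hr ⟨⟨flip y, h⟩, ?_⟩
    simp
  · rintro ⟨l, hl⟩
    simp [hl]

theorem lineSum_le {M : ℕ} (hM : 1 < M) (n : G.Face → ℤ) {y : G.Line} (hy : IsReduced y) :
    lineSum M n y ≤ ENNReal.ofReal (M * (symbol (indices n y) : ℝ) ^ (-(47 / 48) : ℝ)) := by
  rw [lineSum_of_isReduced M n hy]
  exact tsum_scaleWeight_mul_sliceValue_le hM (one_le_symbol _)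

theorem one_add_sq_le_symbol_indices (n : G.Face → ℤ) (y : G.Line) (k : Fin 4) :
    1 + (n (G.faceOf y k) : ℝ) ^ 2 ≤ symbol (indices n y) :=
  one_add_sq_le_symbol (indices n y) k

open Classical in
/-- The decrease of a reduced line controls the growth of what is attached at its start. -/
theorem decorated_lineSum_le {M : ℕ} (hM : 1 < M) {K₁ K₂ : ℝ} (hK₁ : 0 < K₁) (hK₂ : 0 < K₂)
    (n : G.Face → ℤ) {y : G.Line} (hy : IsReduced y) :
    (if IsBareLeaf (flip y) then ENNReal.ofReal (K₁ *
        (1 + (n (G.faceOf (flip y) (G.colour (flip y).1)) : ℝ) ^ 2) ^ (13 / 24 : ℝ)) else 1) *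
      ((if IsOuter (flip y) then ENNReal.ofReal (K₂ *
        (1 + (n (G.faceOf (flip y) (G.colour (flip y).1)) : ℝ) ^ 2) ^ (5 / 48 : ℝ)) else 1) *
        lineSum M n y) ≤
      ENNReal.ofReal ((1 + K₁ + K₂) * M * (symbol (indices n y) : ℝ) ^ (-(capacity y / 2))) := by
  set s : ℝ := ((symbol (indices n y) : ℤ) : ℝ) with hs
  have hs1 : 1 ≤ s := by
    rw [hs]
    exact_mod_cast one_le_symbol (indices n y)
  have hs0 : 0 < s := by linarith
  have hM0 : (0 : ℝ) ≤ M := Nat.cast_nonneg M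
  have hline := lineSum_le hM n hy
  rw [← hs] at hline
  have key : ∀ {K : ℝ} {m : ℤ} {x : ℝ}, 0 < K → K ≤ 1 + K₁ + K₂ → 1 + (m : ℝ) ^ 2 ≤ s → 0 ≤ x →
      ENNReal.ofReal (K * (1 + (m : ℝ) ^ 2) ^ x) * lineSum M n y ≤
        ENNReal.ofReal ((1 + K₁ + K₂) * M * s ^ (x - 47 / 48)) := by
    intro K m x hK hK' hm hx
    refine (mul_le_mul_right hline _).trans ?_
    rw [← ENNReal.ofReal_mul (by positivity)]
    refine ENNReal.ofReal_le_ofReal ?_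
    rw [sub_eq_add_neg, Real.rpow_add hs0]
    calc K * (1 + (m : ℝ) ^ 2) ^ x * (M * s ^ (-(47 / 48) : ℝ))
        ≤ (1 + K₁ + K₂) * s ^ x * (M * s ^ (-(47 / 48) : ℝ)) := by gcongr
      _ = _ := by ring
  have hface : ∀ {l : G.Line}, G.faceOf (flip l) (G.colour l.1) = G.faceOf l (G.colour l.1) →
      l = flip y → 1 + (n (G.faceOf (flip y) (G.colour (flip y).1)) : ℝ) ^ 2 ≤ s := by
    rintro l h rfl
    rw [← h, flip_flip]
    exact one_add_sq_le_symbol_indices n y _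
  rcases hy.flip_cases with h | h | h
  · rw [if_pos h, if_neg fun h' => h'.not_isLeaf h.1, one_mul]
    refine (key hK₁ (by linarith) (hface h.1.faceOf_flip rfl) (by norm_num)).trans (le_of_eq ?_)
    rw [capacity, if_pos h.1]
    norm_num
  · rw [if_neg fun h' => h.not_isLeaf h'.1, if_pos h, one_mul]
    refine (key hK₂ (by linarith) (hface h.faceOf_flip rfl) (by norm_num)).trans (le_of_eq ?_)
    rw [capacity, if_neg h.not_isLeaf, if_pos h]
    norm_num
  · rw [if_neg fun h' => h.1 h'.1, if_neg h.2.1, one_mul, one_mul]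
    refine hline.trans (ENNReal.ofReal_le_ofReal ?_)
    rw [capacity, if_neg h.1, if_neg h.2.1]
    rw [show (-(47 / 24 / 2) : ℝ) = -(47 / 48) by norm_num, mul_assoc]
    exact le_mul_of_one_le_left (by positivity) (by linarith)

/-- The decrease of a line is shared among the faces which run through it. -/
theorem symbol_rpow_le_prod (n : G.Face → ℤ) (y : G.Line) :
    (symbol (indices n y) : ℝ) ^ (-(capacity y / 2)) ≤
      ∏ k, (1 + (n (G.faceOf y k) : ℝ) ^ 2) ^ (-(allotment y k / 2)) := by
  have hs1 : (1 : ℝ) ≤ symbol (indices n y) := by exact_mod_cast one_le_symbol (indices n y)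
  calc (symbol (indices n y) : ℝ) ^ (-(capacity y / 2))
      ≤ (symbol (indices n y) : ℝ) ^ (∑ k, -(allotment y k / 2)) := by
        refine Real.rpow_le_rpow_of_exponent_le hs1 ?_
        rw [Finset.sum_neg_distrib, ← Finset.sum_div]
        have := sum_allotment_le y
        linarith
    _ = ∏ k, (symbol (indices n y) : ℝ) ^ (-(allotment y k / 2)) :=
        Real.rpow_sum_of_pos (by linarith) _ _
    _ ≤ _ := by
        refine Finset.prod_le_prod (fun k _ => by positivity) fun k _ => ?_
        refine Real.rpow_le_rpow_of_nonpos (by positivity) (one_add_sq_le_symbol_indices n y k) ?_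
        have := allotment_nonneg y k
        linarith

open Classical in
/-- The decrease which is attributed to each reduced face makes the sum over its index converge. -/
theorem NoDivergentComponent.prod_rpow_le (hG : G.NoDivergentComponent)
    [Fintype {f : G.Face // IsReducedFace f}] (r : {f : G.Face // IsReducedFace f} → ℤ) :
    ∏ y : {l : G.Line // IsReduced l}, ∏ k : Fin 4,
        (1 + (extend r (G.faceOf y k) : ℝ) ^ 2) ^ (-(allotment y.1 k / 2)) ≤
      ∏ f, (1 + (r f : ℝ) ^ 2) ^ (-(101 / 200) : ℝ) := by
  rw [← Fintype.prod_prod_type', ← Fintype.prod_fiberwise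
    (fun a : {l : G.Line // IsReduced l} × Fin 4 =>
      (⟨G.faceOf a.1 a.2, a.1.2.isReducedFace a.2⟩ : {f : G.Face // IsReducedFace f}))]
  refine Finset.prod_le_prod (fun f _ => Finset.prod_nonneg fun a _ => by positivity) ?_
  rintro ⟨f, hf⟩ -
  have h1 : (1 : ℝ) ≤ 1 + (r ⟨f, hf⟩ : ℝ) ^ 2 := by linarith [sq_nonneg (r ⟨f, hf⟩ : ℝ)]
  have hval : ∀ a : {a : {l : G.Line // IsReduced l} × Fin 4 //
      (⟨G.faceOf a.1 a.2, a.1.2.isReducedFace a.2⟩ : {f : G.Face // IsReducedFace f}) = ⟨f, hf⟩},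
      (1 + (extend r (G.faceOf a.1.1 a.1.2) : ℝ) ^ 2) ^ (-(allotment a.1.1.1 a.1.2 / 2)) =
        (1 + (r ⟨f, hf⟩ : ℝ) ^ 2) ^ (-(allotment a.1.1.1 f.1 / 2)) := by
    rintro ⟨⟨y, k⟩, ha⟩
    have ha' : G.faceOf y k = f := congrArg Subtype.val ha
    subst ha'
    simp only
    rw [extend_apply r hf]
    rfl
  rw [Finset.prod_congr rfl fun a _ => hval a, ← Real.rpow_sum_of_pos (by linarith)]
  refine Real.rpow_le_rpow_of_exponent_le h1 ?_
  rw [Finset.sum_neg_distrib, ← Finset.sum_div]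
  have hle := hG.le_sum_allotment hf
  have hsum : ∑ y : G.Line with (IsReduced y ∧ G.faceOf y f.1 = f), allotment y f.1 ≤
      ∑ a : {a : {l : G.Line // IsReduced l} × Fin 4 //
        (⟨G.faceOf a.1 a.2, a.1.2.isReducedFace a.2⟩ : {f : G.Face // IsReducedFace f}) =
          ⟨f, hf⟩}, allotment a.1.1.1 f.1 := by
    refine le_of_eq (Finset.sum_bij (fun y hy => ⟨(⟨y, (Finset.mem_filter.1 hy).2.1⟩, f.1),
      Subtype.ext (Finset.mem_filter.1 hy).2.2⟩) (fun _ _ => Finset.mem_univ _) ?_ ?_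
      fun _ _ => rfl)
    · intro a ha b hb hab
      exact congrArg (fun x => x.1.1.1) hab
    · rintro ⟨⟨y, k⟩, ha⟩ -
      have ha' : G.faceOf y k = f := congrArg Subtype.val ha
      subst ha'
      exact ⟨y, Finset.mem_filter.2 ⟨Finset.mem_univ _, y.2, rfl⟩, rfl⟩
  linarith

theorem card_reducedFace_le [Fintype {f : G.Face // IsReducedFace f}] :
    Fintype.card {f : G.Face // IsReducedFace f} ≤ 8 * G.order := by
  have : Fintype G.Face := Fintype.ofFinite _
  calc Fintype.card {f : G.Face // IsReducedFace f}
      ≤ Fintype.card G.Face := Fintype.card_le_of_injective _ Subtype.val_injective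
    _ ≤ Fintype.card (G.Line × Fin 4) :=
        Fintype.card_le_of_surjective (fun a => G.faceOf a.1 a.2) fun f => by
          obtain ⟨l, hl⟩ := exists_faceOf_eq f
          exact ⟨(l, f.1), hl⟩
    _ = 8 * G.order := by
        simp
        ring

/-- The bound for the graphs without divergent component. -/
theorem exists_tsum_scales_le {M : ℕ} (hM : 1 < M) : ∃ K : ℝ, 0 < K ∧
    ∀ G : VacuumGraph, G.NoDivergentComponent →
      ∑' μ : G.ScaleAttribution, ENNReal.ofReal (|G.renormalisedAmplitude M μ| *
        ∏ l : G.Line, scaleWeight M (μ l)) ≤ ENNReal.ofReal (K ^ G.order) := by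
  classical
  obtain ⟨K₁, K₂, hK₁, hK₂, hK⟩ := exists_tsum_indices_le hM
  have hM1 : (1 : ℝ) ≤ M := by exact_mod_cast hM.le
  obtain ⟨K, hKdef⟩ : ∃ K : ℝ, K = (1 + K₁ + K₂) * M := ⟨_, rfl⟩
  have hK1 : 1 ≤ K := by
    rw [hKdef]
    nlinarith
  have hZtop := tsum_one_add_sq_rpow_lt_top (x := 101 / 200) (by norm_num)
  set Z : ℝ≥0∞ := ∑' a : ℤ, ENNReal.ofReal ((1 + (a : ℝ) ^ 2) ^ (-(101 / 200) : ℝ)) with hZ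
  have hZ' : Z ≤ ENNReal.ofReal (1 + Z.toReal) := by
    rw [← ENNReal.ofReal_toReal hZtop.ne]
    refine ENNReal.ofReal_le_ofReal ?_
    simp
  set Y : ℝ := 1 + Z.toReal with hY
  have hY1 : 1 ≤ Y := by
    have : 0 ≤ Z.toReal := ENNReal.toReal_nonneg
    linarith
  have hK0 : 0 ≤ K := by linarith
  have hY0 : 0 ≤ Y := by linarith
  -- there are `2n` lines and at most `8n` faces
  refine ⟨K ^ 2 * Y ^ 8, by positivity, fun G hG => ?_⟩
  have : Fintype {f : G.Face // IsReducedFace f} := Fintype.ofFinite _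
  have hline : Fintype.card {l : G.Line // IsReduced l} ≤ 2 * G.order := by
    refine (Fintype.card_subtype_le _).trans (le_of_eq ?_)
    simp
    ring
  have hsym : ∀ (r : {f : G.Face // IsReducedFace f} → ℤ) (y : {l : G.Line // IsReduced l}),
      (0 : ℝ) ≤ symbol (indices (extend r) y.1) := fun r y => by
    exact_mod_cast zero_le_one.trans (one_le_symbol (indices (extend r) y.1))
  calc ∑' μ : G.ScaleAttribution, ENNReal.ofReal (|G.renormalisedAmplitude M μ| *
        ∏ l : G.Line, scaleWeight M (μ l))
      ≤ ∑' r : {f : G.Face // IsReducedFace f} → ℤ,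
          (∏ l : {l : G.Line // IsBareLeaf l}, ENNReal.ofReal
            (K₁ * (1 + (extend r (G.faceOf l (G.colour l.1.1)) : ℝ) ^ 2) ^ (13 / 24 : ℝ))) *
          ((∏ u : {u : G.Line // IsOuter u}, ENNReal.ofReal
            (K₂ * (1 + (extend r (G.faceOf u (G.colour u.1.1)) : ℝ) ^ 2) ^ (5 / 48 : ℝ))) *
          ∏ l : {l : G.Line // IsReduced l}, lineSum M (extend r) l) :=
        (hG.tsum_scales_le hM).trans (hK G hG)
    _ ≤ ∑' r : {f : G.Face // IsReducedFace f} → ℤ,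
          ENNReal.ofReal (K ^ (2 * G.order)) *
            ∏ f, ENNReal.ofReal ((1 + (r f : ℝ) ^ 2) ^ (-(101 / 200) : ℝ)) := by
        refine ENNReal.tsum_le_tsum fun r => ?_
        rw [prod_subtype_flip (fun l hl => hG.isReduced_flip_of_isBareLeaf hl) fun l =>
            ENNReal.ofReal (K₁ *
              (1 + (extend r (G.faceOf l (G.colour l.1)) : ℝ) ^ 2) ^ (13 / 24 : ℝ)),
          prod_subtype_flip (fun l hl => hG.isReduced_flip_of_isOuter hl) fun l =>
            ENNReal.ofReal (K₂ *
              (1 + (extend r (G.faceOf l (G.colour l.1)) : ℝ) ^ 2) ^ (5 / 48 : ℝ)),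
          ← Finset.prod_mul_distrib, ← Finset.prod_mul_distrib]
        refine (Finset.prod_le_prod' fun y _ =>
          decorated_lineSum_le hM hK₁ hK₂ (extend r) y.2).trans ?_
        rw [← hKdef, ← ENNReal.ofReal_prod_of_nonneg fun y _ =>
            mul_nonneg hK0 (Real.rpow_nonneg (hsym r y) _),
          ← ENNReal.ofReal_prod_of_nonneg fun f _ => by positivity,
          ← ENNReal.ofReal_mul (by positivity)]
        refine ENNReal.ofReal_le_ofReal ?_
        rw [Finset.prod_mul_distrib, Finset.prod_const, Finset.card_univ]
        refine mul_le_mul (pow_le_pow_right₀ hK1 hline) ?_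
          (Finset.prod_nonneg fun y _ => Real.rpow_nonneg (hsym r y) _) (by positivity)
        exact (Finset.prod_le_prod (fun y _ => Real.rpow_nonneg (hsym r y) _)
          fun y _ => symbol_rpow_le_prod (extend r) y.1).trans (hG.prod_rpow_le r)
    _ ≤ ENNReal.ofReal (K ^ (2 * G.order)) * ENNReal.ofReal (Y ^ (8 * G.order)) := by
        rw [ENNReal.tsum_mul_left]
        refine mul_le_mul_right ((tsum_pi_prod_le
          fun (_ : {f : G.Face // IsReducedFace f}) (a : ℤ) =>
            ENNReal.ofReal ((1 + (a : ℝ) ^ 2) ^ (-(101 / 200) : ℝ))).trans ?_) _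
        rw [Finset.prod_const, Finset.card_univ]
        refine (pow_le_pow_left' hZ' _).trans ?_
        rw [← ENNReal.ofReal_pow hY0]
        exact ENNReal.ofReal_le_ofReal (pow_le_pow_right₀ hY1 card_reducedFace_le)
    _ = ENNReal.ofReal ((K ^ 2 * Y ^ 8) ^ G.order) := by
        rw [← ENNReal.ofReal_mul (by positivity), mul_pow, ← pow_mul, ← pow_mul]

end VacuumGraph

end TensorT44

theorem mainTheorem6 (M : ℕ) (hM : 1 < M) :
    ∃ K : ℝ, 0 < K ∧ ∀ G : TensorT44.VacuumGraph,
      Summable (fun μ : G.ScaleAttribution =>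
        |G.renormalisedAmplitude M μ| * ∏ l : G.Line, (M : ℝ) ^ (((μ l : ℕ) : ℝ) / 24)) ∧
      ∑' μ : G.ScaleAttribution,
        |G.renormalisedAmplitude M μ| * ∏ l : G.Line, (M : ℝ) ^ (((μ l : ℕ) : ℝ) / 24)
          ≤ K ^ G.order := by
  obtain ⟨K, hK, h⟩ := TensorT44.VacuumGraph.exists_tsum_scales_le hM
  refine ⟨K, hK, fun G => ?_⟩
  by_cases hG : G.NoDivergentComponent
  · have hnn : ∀ μ : G.ScaleAttribution, 0 ≤ |G.renormalisedAmplitude M μ| *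
        ∏ l : G.Line, (M : ℝ) ^ (((μ l : ℕ) : ℝ) / 24) := fun μ => by positivity
    have hle := h G hG
    simp only [TensorT44.scaleWeight] at hle
    have hs : Summable fun μ : G.ScaleAttribution => |G.renormalisedAmplitude M μ| *
        ∏ l : G.Line, (M : ℝ) ^ (((μ l : ℕ) : ℝ) / 24) :=
      (ENNReal.summable_toReal (hle.trans_lt ENNReal.ofReal_lt_top).ne).congr fun μ =>
        ENNReal.toReal_ofReal (hnn μ)
    refine ⟨hs, ?_⟩
    rw [← ENNReal.ofReal_tsum_of_nonneg hnn hs] at hle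
    exact (ENNReal.ofReal_le_ofReal_iff (by positivity)).1 hle
  · have hzero : ∀ μ, G.renormalisedAmplitude M μ = 0 := by
      unfold TensorT44.VacuumGraph.NoDivergentComponent at hG
      push Not at hG
      obtain ⟨g, hg, hdeg⟩ := hG
      obtain ⟨v, rfl⟩ := TensorT44.VacuumGraph.isComponent_iff.1 hg
      exact TensorT44.VacuumGraph.renormalisedAmplitude_eq_zero (Or.inr (Or.inr ⟨hg, hdeg⟩)) M
    simp only [hzero, abs_zero, zero_mul, tsum_zero]
    exact ⟨summable_zero, by positivity⟩
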